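/- Theorem 4.3. Let $K$ be a field, let $A$ and $B$ be regular multiplier Hopf algebras over $K$ (with associative, non-degenerate, not necessarily unital products), and let $\langle\cdot,\cdot\rangle:A\times B\to K$ be a pairing, i.e. a non-degenerate bilinear form such that the multipliers $b\blacktriangleright a=\langle a_{(2)},b\rangle a_{(1)}$ and $a\blacktriangleleft b=\langle a_{(1)},b\rangle a_{(2)}$ belong to $A$, the multipliers $a\blacktriangleright b=\langle a,b_{(2)}\rangle b_{(1)}$ and $b\blacktriangleleft a=\langle a,b_{(1)}\rangle b_{(2)}$ belong to $B$, and products and coproducts are dual to each other: $\langle aa',b\rangle=\langle a,a'\blacktriangleright b\rangle=\langle a',b\blacktriangleleft a\rangle$ and $\langle a,bb'\rangle=\langle b'\blacktriangleright a,b\rangle=\langle a\blacktriangleleft b,b'\rangle$. Let $\mathscr D=A\bowtie B$ be the Drinfel'd double: the space $A\otimes B$ with the product $(a\bowtie b)(a'\bowtie b')=(a\otimes 1)\,T(b\otimes a')\,(1\otimes b')$, where $T(b\otimes a)=b_{(1)}\blacktriangleright a\blacktriangleleft S^{-1}(b_{(3)})\otimes b_{(2)}$, and with the comultiplication $\Delta(a\bowtie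 b)=(a_{(2)}\bowtie b_{(1)})\otimes(a_{(1)}\bowtie b_{(2)})$. Let $\mathscr H=A\# B$ be the Heisenberg double: the space $A\otimes B$ with the product $(a\# b)(a'\# b')=a(b_{(1)}\blacktriangleright a')\# b_{(2)}b'$, the $\mathscr D$-action $$(a\bowtie b)\cdot(a'\# b')=a_{(3)}(b_{(1)}\blacktriangleright a')S^{-1}(a_{(2)})\#\bigl(b_{(2)}b'S(b_{(3)})\bigr)\blacktriangleleft S^{-1}(a_{(1)})$$ and the $\mathscr D$-coaction $\Gamma(a\# b)=(a_{(2)}\bowtie b_{(1)})\otimes(a_{(1)}\# b_{(2)})\in M_0(\mathscr D\otimes\mathscr H)$. Equip $A$ and $B$ with the $\mathscr D$-actions $$(a\bowtie b)\cdot a'=a_{(2)}(b\blacktriangleright a')S^{-1}(a_{(1)}),\qquad (a\bowtie b)\cdot b'=\bigl(b_{(1)}b'S(b_{(2)})\bigr)\blacktriangleleft S^{-1}(a)$$ and the $\mathscr D$-coactions $\rho(a')=\Delta^{cop}_{13}(a')=(a'_{(2)}\bowtie 1)\otimes a'_{(1)}$ and $\rho(b')=\Delta_{23}(b')=(1\bowtie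 b'_{(1)})\otimes b'_{(2)}$. Here $M_0(\mathscr D\otimes V)$ is the completed module, consisting of the $z$ for which $z(d\otimes1)$ and $(d\otimes1)z$ belong to $\mathscr D\otimes V$ for all $d\in\mathscr D$. All these maps are well defined, and $\mathscr D$ is an associative algebra with non-degenerate product. A (left-left) Yetter–Drinfel'd $\mathscr D$-module algebra is an associative algebra $X$ with non-degenerate product that is a unital left $\mathscr D$-module and a left $\mathscr D$-comodule (with injective, coassociative coaction $x\mapsto x_{(-1)}\otimes x_{(0)}\in M_0(\mathscr D\otimes X)$), such that $d\cdot(xy)=(d_{(1)}\cdot x)(d_{(2)}\cdot y)$, such that the coaction is multiplicative, and such that $$(d_{(1)}\cdot x)_{(-1)}d_{(2)}d'\otimes(d_{(1)}\cdot x)_{(0)}=d_{(1)}x_{(-1)}d'\otimes d_{(2)}\cdot x_{(0)}$$ for all $d,d'\in\mathscr D$ and $x,y\in X$. It is braided commutative if $yx=(y_{(-1)}\cdot x)y_{(0)}$ for all $x,y\in X$. The braided product $X\propto Y$ of two such algebras is the space $X\otimes Y$ with the product $(x\propto y)(x'\propto y')=x(y_{(-1)}\cdot x')\propto y_{(0)}y'$.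 Then: 1. $\mathscr H$ is a braided commutative Yetter–Drinfel'd $\mathscr D$-module algebra; so $yx=(y_{(-1)}\cdot x)y_{(0)}$ for all $x,y\in\mathscr H$. 2. $A$ and $B$, with the above actions and coactions, are braided commutative Yetter–Drinfel'd $\mathscr D$-module algebras. 3. $\mathscr H$ is the braided product $A\propto B$: the product of $\mathscr H$ is $(a\# b)(a'\# b')=a(b_{(-1)}\cdot a')\# b_{(0)}b'$. Moreover the action and the coaction of $\mathscr D$ on $\mathscr H$ are built from those on $A$ and $B$: $d\cdot(a\# b)=(d_{(1)}\cdot a)\#(d_{(2)}\cdot b)$ and $\Gamma(a\# b)=a_{(-1)}b_{(-1)}\otimes(a_{(0)}\# b_{(0)})$. -/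

import Mathlib

open scoped TensorProduct
open TensorProduct (map lift assoc comm leftComm rightComm)

noncomputable section

/-! Conventions.  A (not necessarily unital) algebra structure on a `K`-vector space `X` is a bilinear
map `m : X →ₗ[K] X →ₗ[K] X`; for a Mathlib algebra this is `LinearMap.mul K X`.  Sweedler notation
is used in the comments, e.g. `a₁ ⊗ a₂ b` for `Δ(a)(1 ⊗ b)`. -/

namespace Heis

variable {K : Type*} [Field K]

section General

variable {X : Type*} [AddCommGroup X] [Module K X]
variable {V : Type*} [AddCommGroup V] [Module K V]
variable {W : Type*} [AddCommGroup W] [Module K W]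

/-- An algebra in the sense of the theory of multiplier Hopf algebras: the product is associative and
non-degenerate; a unit is not required. -/
structure IsAlgebra (m : X →ₗ[K] X →ₗ[K] X) : Prop where
  assoc : ∀ x y z, m (m x y) z = m x (m y z)
  nondeg_left : ∀ x, (∀ y, m x y = 0) → x = 0
  nondeg_right : ∀ y, (∀ x, m x y = 0) → y = 0

/-- The product of the algebra `X ⊗ X`. -/
abbrev mul₂ (m : X →ₗ[K] X →ₗ[K] X) : (X ⊗[K] X) →ₗ[K] (X ⊗[K] X) →ₗ[K] (X ⊗[K] X) :=
  TensorProduct.map₂ m m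

/-- A multiplier Hopf algebra `(X, Δ)`.  A multiplier of `X ⊗ X` is a pair of linear maps
`u ↦ M u`, `u ↦ u M` with `u (M v) = (u M) v`, so a linear map `Δ : X → M(X ⊗ X)` is given by
`L a u = Δ(a) u` and `R a u = u Δ(a)`.  The fields `T₁ (a ⊗ b) = Δ(a)(1 ⊗ b)` and
`T₂ (a ⊗ b) = (a ⊗ 1)Δ(b)` say that these multipliers belong to `X ⊗ X` and that the resulting
linear maps are bijective; they are determined by `Δ` since the product is non-degenerate. -/
structure MultiplierHopfAlgebra (m : X →ₗ[K] X →ₗ[K] X) where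
  isAlgebra : IsAlgebra m
  L : X →ₗ[K] Module.End K (X ⊗[K] X)
  R : X →ₗ[K] Module.End K (X ⊗[K] X)
  multiplier : ∀ a u v, mul₂ m u (L a v) = mul₂ m (R a u) v
  L_mul : ∀ a b u, L (m a b) u = L a (L b u)
  R_mul : ∀ a b u, R (m a b) u = R b (R a u)
  T₁ : (X ⊗[K] X) ≃ₗ[K] (X ⊗[K] X)
  T₂ : (X ⊗[K] X) ≃ₗ[K] (X ⊗[K] X)
  T₁_spec : ∀ a b u, mul₂ m (T₁ (a ⊗ₜ b)) u = L a ((m b).lTensor X u)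
  T₂_spec : ∀ a b u, mul₂ m (T₂ (a ⊗ₜ b)) u = (m a).rTensor X (L b u)
  /-- `(a ⊗ 1 ⊗ 1)(Δ ⊗ ι)(Δ(b)(1 ⊗ c)) = (ι ⊗ Δ)((a ⊗ 1)Δ(b))(1 ⊗ 1 ⊗ c)`. -/
  coassoc : ∀ a b c,
    assoc K X X X (T₂.toLinearMap.rTensor X ((assoc K X X X).symm (a ⊗ₜ T₁ (b ⊗ₜ c)))) =
      T₁.toLinearMap.lTensor X (assoc K X X X (T₂ (a ⊗ₜ b) ⊗ₜ c))

/-- A multiplier Hopf algebra is regular if the flipped comultiplication `Δᶜᵒᵖ = τ ∘ Δ` also makes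
it a multiplier Hopf algebra. -/
structure RegularMHA (m : X →ₗ[K] X →ₗ[K] X) extends MultiplierHopfAlgebra m where
  cop : MultiplierHopfAlgebra m
  cop_L : ∀ a u, cop.L a u = comm K X X (L a (comm K X X u))
  cop_R : ∀ a u, cop.R a u = comm K X X (R a (comm K X X u))

namespace RegularMHA

variable {m : X →ₗ[K] X →ₗ[K] X} (H : RegularMHA m)

/-- `a ⊗ b ↦ Δ(a)(b ⊗ 1) = a₁ b ⊗ a₂`. -/
def T₃ : X ⊗[K] X →ₗ[K] X ⊗[K] X := (comm K X X).toLinearMap ∘ₗ H.cop.T₁.toLinearMap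

/-- `a ⊗ b ↦ Δᶜᵒᵖ(a)(b ⊗ 1) = a₂ b ⊗ a₁`. -/
def copT₃ : X ⊗[K] X →ₗ[K] X ⊗[K] X := (comm K X X).toLinearMap ∘ₗ H.T₁.toLinearMap

/-- The characterization of the counit: `ε(a₁) a₂ b = a b` and `a b₁ ε(b₂) = a b`. -/
def IsCounit (ε : X →ₗ[K] K) : Prop :=
  ∀ a b, TensorProduct.lid K X (ε.rTensor X (H.T₁ (a ⊗ₜ b))) = m a b ∧
    TensorProduct.rid K X (ε.lTensor X (H.T₂ (a ⊗ₜ b))) = m a b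

/-- The counit: the unique linear functional with the property `IsCounit`. -/
def counit : X →ₗ[K] K := Classical.epsilon H.IsCounit

/-- The characterization of the (bijective) antipode of a regular multiplier Hopf algebra:
`S(a₁) a₂ b = ε(a) b` and `a b₁ S(b₂) = ε(b) a`. -/
def IsAntipode (S : X ≃ₗ[K] X) : Prop :=
  ∀ a b, lift m (S.toLinearMap.rTensor X (H.T₁ (a ⊗ₜ b))) = H.counit a • b ∧
    lift m (S.toLinearMap.lTensor X (H.T₂ (a ⊗ₜ b))) = H.counit b • a

/-- The antipode: the unique linear bijection with the property `IsAntipode`. -/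
def antipode : X ≃ₗ[K] X :=
  haveI : Nonempty (X ≃ₗ[K] X) := ⟨LinearEquiv.refl K X⟩
  Classical.epsilon H.IsAntipode

end RegularMHA

/-- Let `c (x ⊗ e) = Δ(x)(e ⊗ 1)` for a comultiplication on `X`, and let `V` be a unital left
`X`-module.  `IsTwist` says that `G` is the map `x ⊗ v ↦ x₁ · v ⊗ x₂`; here the first leg is covered by
the module: `x₁ · (e · v) ⊗ x₂ = (x₁ e) · v ⊗ x₂`. -/
def IsTwist (c : X ⊗[K] X →ₗ[K] X ⊗[K] X) (act : X →ₗ[K] V →ₗ[K] V)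
    (G : X ⊗[K] V ≃ₗ[K] V ⊗[K] X) : Prop :=
  ∀ x e v, G (x ⊗ₜ act e v) = (act.flip v).rTensor X (c (x ⊗ₜ e))

/-- The linear bijection `x ⊗ v ↦ x₁ · v ⊗ x₂`; it is unique because the module is unital. -/
def twist (c : X ⊗[K] X →ₗ[K] X ⊗[K] X) (act : X →ₗ[K] V →ₗ[K] V) : X ⊗[K] V ≃ₗ[K] V ⊗[K] X :=
  haveI : Nonempty (X ⊗[K] V ≃ₗ[K] V ⊗[K] X) := ⟨comm K X V⟩
  Classical.epsilon (IsTwist c act)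

/-- The twisted product `(x ⊗ v)(x' ⊗ v') = (m_X ⊗ m_V)(x ⊗ τ(v ⊗ x') ⊗ v')` on `X ⊗ V`. -/
def twistedMul (mX : X →ₗ[K] X →ₗ[K] X) (mV : V →ₗ[K] V →ₗ[K] V)
    (τ : V ⊗[K] X →ₗ[K] X ⊗[K] V) :
    X ⊗[K] V →ₗ[K] X ⊗[K] V →ₗ[K] X ⊗[K] V :=
  TensorProduct.curry <|
    map (lift mX) (lift mV)
      ∘ₗ (assoc K X X (V ⊗[K] V)).symm.toLinearMap
      ∘ₗ ((assoc K X V V).toLinearMap ∘ₗ τ.rTensor V ∘ₗ (assoc K V X V).symm.toLinearMap).lTensor X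
      ∘ₗ (assoc K X V (X ⊗[K] V)).toLinearMap

/-- The part of the structure of a multiplier Hopf algebra over which modules and comodules are
defined: the product and the comultiplication, the latter through
`cov₁ (x ⊗ y) = Δ(x)(1 ⊗ y)` and `cov₃ (x ⊗ y) = Δ(x)(y ⊗ 1)`. -/
structure HopfData (K X : Type*) [Field K] [AddCommGroup X] [Module K X] where
  mul : X →ₗ[K] X →ₗ[K] X
  cov₁ : X ⊗[K] X →ₗ[K] X ⊗[K] X
  cov₃ : X ⊗[K] X →ₗ[K] X ⊗[K] X

/-- A linear map `Γ` from `V` to the completed module `M₀(X ⊗ V)`, given by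
`L (v ⊗ x) = Γ(v)(x ⊗ 1)` and `R (x ⊗ v) = (x ⊗ 1)Γ(v)`; the law that makes such a pair an element of
`M₀(X ⊗ V)` is `IsComodule.completed`. -/
structure Coaction (K X V : Type*) [Field K] [AddCommGroup X] [Module K X]
    [AddCommGroup V] [Module K V] where
  L : V ⊗[K] X →ₗ[K] X ⊗[K] V
  R : X ⊗[K] V →ₗ[K] X ⊗[K] V

/-- Unital left modules. -/
structure IsUnitalModule (D : HopfData K X) (act : X →ₗ[K] V →ₗ[K] V) : Prop where
  mul_act : ∀ x y v, act (D.mul x y) v = act x (act y v)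
  unital : Submodule.span K {w | ∃ x v, act x v = w} = ⊤

/-- Left comodules. -/
structure IsComodule (D : HopfData K X) (Γ : Coaction K X V) : Prop where
  /-- `(x ⊗ 1)(Γ(v)(y ⊗ 1)) = ((x ⊗ 1)Γ(v))(y ⊗ 1)`, i.e. `Γ(v) ∈ M₀(X ⊗ V)`. -/
  completed : ∀ x y v,
    (D.mul x).rTensor V (Γ.L (v ⊗ₜ y)) = (D.mul.flip y).rTensor V (Γ.R (x ⊗ₜ v))
  injective : ∀ v, (∀ x, Γ.L (v ⊗ₜ x) = 0 ∧ Γ.R (x ⊗ₜ v) = 0) → v = 0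
  /-- `(ι ⊗ Γ)Γ(v) = (Δ ⊗ ι)Γ(v)`, multiplied from the right by `Δ(x)(y ⊗ 1) ⊗ 1`: on the left,
  `(ι ⊗ Γ)Γ(v) (p ⊗ q ⊗ 1) = (ι ⊗ Γ)(Γ(v)(p ⊗ 1)) (1 ⊗ q ⊗ 1)`, and on the right one obtains
  `(Δ ⊗ ι)(Γ(v)(x ⊗ 1)) (y ⊗ 1 ⊗ 1)`. -/
  coassoc : ∀ x y v,
    Γ.L.lTensor X (assoc K X V X (Γ.L.rTensor X ((assoc K V X X).symm (v ⊗ₜ D.cov₃ (x ⊗ₜ y))))) =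
      assoc K X X V ((D.cov₃ ∘ₗ (TensorProduct.mk K X X).flip y).rTensor V (Γ.L (v ⊗ₜ x)))

/-- `x · (v w) = (x₁ · v)(x₂ · w)`, where `v = y · v'` covers the first leg of `Δ(x)`. -/
def IsModuleAlgebra (D : HopfData K X) (mV : V →ₗ[K] V →ₗ[K] V) (act : X →ₗ[K] V →ₗ[K] V) : Prop :=
  ∀ x y v w, act x (mV (act y v) w) = lift mV (map (act.flip v) (act.flip w) (D.cov₃ (x ⊗ₜ y)))

/-- `Γ(v w) = Γ(v)Γ(w)`, multiplied from the right by `x ⊗ 1`. -/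
def IsComoduleAlgebra (mV : V →ₗ[K] V →ₗ[K] V) (Γ : Coaction K X V) : Prop :=
  ∀ v w x, Γ.L (mV v w ⊗ₜ x) =
    (lift mV).lTensor X (assoc K X V V
      ((Γ.L ∘ₗ TensorProduct.mk K V X v).rTensor V (Γ.L (w ⊗ₜ x))))

/-- The left-left Yetter-Drinfel'd condition
`(x₁ · v)₋₁ x₂ y ⊗ (x₁ · v)₀ = x₁ v₋₁ y ⊗ x₂ · v₀`. -/
def IsYDCompatible (D : HopfData K X) (act : X →ₗ[K] V →ₗ[K] V) (Γ : Coaction K X V) : Prop :=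
  ∀ x y v, Γ.L ((act.flip v).rTensor X (D.cov₁ (x ⊗ₜ y))) =
    (lift act).lTensor X (assoc K X X V
      ((D.cov₃ ∘ₗ TensorProduct.mk K X X x).rTensor V (Γ.L (v ⊗ₜ y))))

/-- (Left-left) Yetter-Drinfel'd module algebras. -/
structure IsYDModuleAlgebra (D : HopfData K X) (mV : V →ₗ[K] V →ₗ[K] V)
    (act : X →ₗ[K] V →ₗ[K] V) (Γ : Coaction K X V) : Prop where
  isAlgebra : IsAlgebra mV
  isUnitalModule : IsUnitalModule D act
  isComodule : IsComodule D Γ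
  isModuleAlgebra : IsModuleAlgebra D mV act
  isComoduleAlgebra : IsComoduleAlgebra mV Γ
  compatible : IsYDCompatible D act Γ

/-- Braided commutativity `w v = (w₋₁ · v) w₀`, where `v = x · v'` covers `w₋₁`, i.e.
`w₋₁ · (x · v') ⊗ w₀ = (w₋₁ x) · v' ⊗ w₀`. -/
def IsBraidedCommutative (mV : V →ₗ[K] V →ₗ[K] V)
    (act : X →ₗ[K] V →ₗ[K] V) (Γ : Coaction K X V) : Prop :=
  ∀ w x v, mV w (act x v) = lift mV ((act.flip v).rTensor V (Γ.L (w ⊗ₜ x)))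

/-- `P` is the braided product `(v ∝ w)(v' ∝ w') = v (w₋₁ · v') ∝ w₀ w'` on `V ⊗ W`, with
`v' = x · v''` covering `w₋₁`.  Since `V` is a unital module, this determines `P`. -/
def IsBraidedProduct (mV : V →ₗ[K] V →ₗ[K] V) (mW : W →ₗ[K] W →ₗ[K] W)
    (actV : X →ₗ[K] V →ₗ[K] V) (ΓW : Coaction K X W)
    (P : V ⊗[K] W →ₗ[K] V ⊗[K] W →ₗ[K] V ⊗[K] W) : Prop :=
  ∀ v w x v' w', P (v ⊗ₜ w) (actV x v' ⊗ₜ w') =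
    map (mV v ∘ₗ actV.flip v') (mW.flip w') (ΓW.L (w ⊗ₜ x))

/-- The action on `V ⊗ W` is `x · (v ⊗ w) = x₁ · v ⊗ x₂ · w`. -/
def IsDiagonalAction (D : HopfData K X) (actV : X →ₗ[K] V →ₗ[K] V) (actW : X →ₗ[K] W →ₗ[K] W)
    (act : X →ₗ[K] V ⊗[K] W →ₗ[K] V ⊗[K] W) : Prop :=
  ∀ x y v w, act x (actV y v ⊗ₜ w) = map (actV.flip v) (actW.flip w) (D.cov₃ (x ⊗ₜ y))

/-- The coaction on `V ⊗ W` is `v ⊗ w ↦ v₋₁ w₋₁ ⊗ (v₀ ⊗ w₀)`. -/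
def IsCodiagonalCoaction (ΓV : Coaction K X V) (ΓW : Coaction K X W)
    (Γ : Coaction K X (V ⊗[K] W)) : Prop :=
  (∀ v w x, Γ.L ((v ⊗ₜ w) ⊗ₜ x) =
    assoc K X V W ((ΓV.L ∘ₗ TensorProduct.mk K V X v).rTensor W (ΓW.L (w ⊗ₜ x)))) ∧
  (∀ v w x, Γ.R (x ⊗ₜ (v ⊗ₜ w)) =
    assoc K X V W (rightComm K X W V ((ΓW.R ∘ₗ (TensorProduct.mk K X W).flip w).rTensor V
      (ΓV.R (x ⊗ₜ v)))))

end General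

variable {A : Type*} [AddCommGroup A] [Module K A] {mA : A →ₗ[K] A →ₗ[K] A}
variable {B : Type*} [AddCommGroup B] [Module K B] {mB : B →ₗ[K] B →ₗ[K] B}

/-- A pairing of regular multiplier Hopf algebras: a non-degenerate bilinear form for which the four
multipliers `b ▶ a = ⟨a₂, b⟩ a₁`, `a ◀ b = ⟨a₁, b⟩ a₂`, `a ▶ b = ⟨a, b₂⟩ b₁`, `b ◀ a = ⟨a, b₁⟩ b₂`
belong to `A`, `A`, `B`, `B`, and for which products and coproducts are dual to each other.  The four
actions are determined by the form since the products are non-degenerate. -/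
structure Pairing (HA : RegularMHA mA) (HB : RegularMHA mB) where
  form : A →ₗ[K] B →ₗ[K] K
  nondeg_left : ∀ a, (∀ b, form a b = 0) → a = 0
  nondeg_right : ∀ b, (∀ a, form a b = 0) → b = 0
  /-- `lA b a = b ▶ a` -/
  lA : B →ₗ[K] A →ₗ[K] A
  /-- `rA a b = a ◀ b` -/
  rA : A →ₗ[K] B →ₗ[K] A
  /-- `lB a b = a ▶ b` -/
  lB : A →ₗ[K] B →ₗ[K] B
  /-- `rB b a = b ◀ a` -/
  rB : B →ₗ[K] A →ₗ[K] B
  lA_spec : ∀ b a a', mA (lA b a) a' =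
    TensorProduct.rid K A ((form.flip b).lTensor A (HA.T₃ (a ⊗ₜ a')))
  rA_spec : ∀ a b a', mA (rA a b) a' =
    TensorProduct.lid K A ((form.flip b).rTensor A (HA.T₁ (a ⊗ₜ a')))
  lB_spec : ∀ a b b', mB (lB a b) b' =
    TensorProduct.rid K B ((form a).lTensor B (HB.T₃ (b ⊗ₜ b')))
  rB_spec : ∀ b a b', mB (rB b a) b' =
    TensorProduct.lid K B ((form a).rTensor B (HB.T₁ (b ⊗ₜ b')))
  form_mul_left : ∀ a a' b, form (mA a a') b = form a (lB a' b) ∧ form (mA a a') b = form a' (rB b a)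
  form_mul_right : ∀ a b b', form a (mB b b') = form (lA b' a) b ∧ form a (mB b b') = form (rA a b) b'

namespace Pairing

variable {HA : RegularMHA mA} {HB : RegularMHA mB} (P : Pairing HA HB)

/-- The left action `b, a ↦ a ◀ S⁻¹(b)` of `B` on `A`. -/
def rAinv : B →ₗ[K] A →ₗ[K] A := P.rA.flip ∘ₗ HB.antipode.symm.toLinearMap

/-- The left action `a, b ↦ b ◀ S⁻¹(a)` of `A` on `B`. -/
def rBinv : A →ₗ[K] B →ₗ[K] B := P.rB.flip ∘ₗ HA.antipode.symm.toLinearMap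

/-- `R (b ⊗ a) = b₁ ▶ a ⊗ b₂`. -/
def R : B ⊗[K] A ≃ₗ[K] A ⊗[K] B := twist HB.T₃ P.lA

/-- `R' (b ⊗ a) = a ◀ S⁻¹(b₂) ⊗ b₁`. -/
def R' : B ⊗[K] A ≃ₗ[K] A ⊗[K] B := twist HB.copT₃ P.rAinv

/-- `F (a ⊗ b) = b ◀ S⁻¹(a₁) ⊗ a₂`. -/
def F : A ⊗[K] B ≃ₗ[K] B ⊗[K] A := twist HA.T₃ P.rBinv

/-- The twist map `T (b ⊗ a) = b₁ ▶ a ◀ S⁻¹(b₃) ⊗ b₂` of the Drinfel'd double. -/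
def T : B ⊗[K] A ≃ₗ[K] A ⊗[K] B := P.R ≪≫ₗ comm K A B ≪≫ₗ P.R'

/-- The maps above, which are defined through their characterizations, do satisfy them. -/
structure WellDefined : Prop where
  counitA : HA.IsCounit HA.counit
  counitB : HB.IsCounit HB.counit
  antipodeA : HA.IsAntipode HA.antipode
  antipodeB : HB.IsAntipode HB.antipode
  R : IsTwist HB.T₃ P.lA P.R
  R' : IsTwist HB.copT₃ P.rAinv P.R'
  F : IsTwist HA.T₃ P.rBinv P.F

/-! ### The Drinfel'd double `𝒟 = A ⋈ B`, with underlying space `A ⊗ B` -/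

/-- The product `(a ⋈ b)(a' ⋈ b') = (m_A ⊗ m_B)(ι ⊗ T ⊗ ι)(a ⊗ b ⊗ a' ⊗ b')` of `𝒟`.  In particular
`T (b ⊗ a)` is the product of `1 ⋈ b` and `a ⋈ 1`. -/
def mulD : A ⊗[K] B →ₗ[K] A ⊗[K] B →ₗ[K] A ⊗[K] B := twistedMul mA mB P.T.toLinearMap

/-- `a ⊗ x ↦ (a₂ ⋈ 1) x ⊗ a₁` for `x ∈ 𝒟`, using `(a ⋈ 1)(c ⋈ d) = a c ⋈ d`. -/
def leftA (_ : Pairing HA HB) : A ⊗[K] (A ⊗[K] B) →ₗ[K] (A ⊗[K] B) ⊗[K] A :=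
  (rightComm K A A B).toLinearMap ∘ₗ HA.copT₃.rTensor B ∘ₗ (assoc K A A B).symm.toLinearMap

/-- `x ⊗ a ↦ x (a₂ ⋈ 1) ⊗ a₁` for `x ∈ 𝒟`, using `T (e ⊗ f)(a ⋈ 1) = T (e ⊗ f a)`. -/
def rightA : (A ⊗[K] B) ⊗[K] A →ₗ[K] (A ⊗[K] B) ⊗[K] A :=
  P.T.toLinearMap.rTensor A ∘ₗ (assoc K B A A).symm.toLinearMap ∘ₗ
    HA.cop.T₂.toLinearMap.lTensor B ∘ₗ (assoc K B A A).toLinearMap ∘ₗ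
    P.T.symm.toLinearMap.rTensor A

/-- `b ⊗ x ↦ (1 ⋈ b₁) x ⊗ b₂` for `x ∈ 𝒟`, using `(1 ⋈ b) T (e ⊗ f) = T (b e ⊗ f)`. -/
def leftB : B ⊗[K] (A ⊗[K] B) →ₗ[K] (A ⊗[K] B) ⊗[K] B :=
  P.T.toLinearMap.rTensor B ∘ₗ (rightComm K B B A).toLinearMap ∘ₗ HB.T₃.rTensor A ∘ₗ
    (assoc K B B A).symm.toLinearMap ∘ₗ P.T.symm.toLinearMap.lTensor B

/-- `x ⊗ b ↦ x (1 ⋈ b₁) ⊗ b₂` for `x ∈ 𝒟`, using `(c ⋈ d)(1 ⋈ b) = c ⋈ d b`. -/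
def rightB (_ : Pairing HA HB) : (A ⊗[K] B) ⊗[K] B →ₗ[K] (A ⊗[K] B) ⊗[K] B :=
  (assoc K A B B).symm.toLinearMap ∘ₗ HB.T₂.toLinearMap.lTensor A ∘ₗ (assoc K A B B).toLinearMap

/-- `a ⊗ x ↦ a₂ ⊗ (a₁ ⋈ 1) x` for `x ∈ 𝒟`. -/
def leftA' (_ : Pairing HA HB) : A ⊗[K] (A ⊗[K] B) →ₗ[K] A ⊗[K] (A ⊗[K] B) :=
  (assoc K A A B).toLinearMap ∘ₗ HA.cop.T₁.toLinearMap.rTensor B ∘ₗ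
    (assoc K A A B).symm.toLinearMap

/-- `b ⊗ x ↦ b₁ ⊗ (1 ⋈ b₂) x` for `x ∈ 𝒟`. -/
def leftB' : B ⊗[K] (A ⊗[K] B) →ₗ[K] B ⊗[K] (A ⊗[K] B) :=
  P.T.toLinearMap.lTensor B ∘ₗ (assoc K B B A).toLinearMap ∘ₗ
    HB.T₁.toLinearMap.rTensor A ∘ₗ (assoc K B B A).symm.toLinearMap ∘ₗ
    P.T.symm.toLinearMap.lTensor B

/-- `(a ⊗ b) ⊗ x ↦ (a₂ ⋈ b₁) x ⊗ (a₁ ⊗ b₂)` for `x ∈ 𝒟`. -/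
def leftAB : (A ⊗[K] B) ⊗[K] (A ⊗[K] B) →ₗ[K] (A ⊗[K] B) ⊗[K] (A ⊗[K] B) :=
  (assoc K (A ⊗[K] B) A B).toLinearMap ∘ₗ P.leftA.rTensor B ∘ₗ
    (assoc K A (A ⊗[K] B) B).symm.toLinearMap ∘ₗ P.leftB.lTensor A ∘ₗ
    (assoc K A B (A ⊗[K] B)).toLinearMap

/-- `(a ⊗ b) ⊗ x ↦ (a₂ ⊗ b₁) ⊗ (a₁ ⋈ b₂) x` for `x ∈ 𝒟`. -/
def leftAB' : (A ⊗[K] B) ⊗[K] (A ⊗[K] B) →ₗ[K] (A ⊗[K] B) ⊗[K] (A ⊗[K] B) :=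
  (assoc K A B (A ⊗[K] B)).symm.toLinearMap ∘ₗ (leftComm K B A (A ⊗[K] B)).toLinearMap ∘ₗ
    P.leftA'.lTensor B ∘ₗ (leftComm K A B (A ⊗[K] B)).toLinearMap ∘ₗ P.leftB'.lTensor A ∘ₗ
    (assoc K A B (A ⊗[K] B)).toLinearMap

/-- `x ⊗ (a ⊗ b) ↦ x (a₂ ⋈ b₁) ⊗ (a₁ ⊗ b₂)` for `x ∈ 𝒟`. -/
def rightAB : (A ⊗[K] B) ⊗[K] (A ⊗[K] B) →ₗ[K] (A ⊗[K] B) ⊗[K] (A ⊗[K] B) :=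
  (assoc K (A ⊗[K] B) A B).toLinearMap ∘ₗ (rightComm K (A ⊗[K] B) B A).toLinearMap ∘ₗ
    P.rightB.rTensor A ∘ₗ (rightComm K (A ⊗[K] B) A B).toLinearMap ∘ₗ
    P.rightA.rTensor B ∘ₗ (assoc K (A ⊗[K] B) A B).symm.toLinearMap

/-- The Drinfel'd double `𝒟 = A ⋈ B`, with the comultiplication
`Δ(a ⋈ b) = Δᶜᵒᵖ(a)Δ(b) = (a₂ ⋈ b₁) ⊗ (a₁ ⋈ b₂)`. -/
def double : HopfData K (A ⊗[K] B) where
  mul := P.mulD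
  cov₁ := P.leftAB'
  cov₃ := P.leftAB

/-! ### The Heisenberg double `ℋ = A # B`, with underlying space `A ⊗ B` -/

/-- The product `(a # b)(a' # b') = a (b₁ ▶ a') # b₂ b'` of `ℋ`. -/
def mulH : A ⊗[K] B →ₗ[K] A ⊗[K] B →ₗ[K] A ⊗[K] B := twistedMul mA mB P.R.toLinearMap

/-- The adjoint action `a, a' ↦ a₂ a' S⁻¹(a₁)` of `A` on itself. -/
def adA (_ : Pairing HA HB) : A →ₗ[K] A →ₗ[K] A :=
  TensorProduct.curry
    (lift mA ∘ₗ HA.antipode.symm.toLinearMap.lTensor A ∘ₗ HA.copT₃)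

/-- The adjoint action `b, b' ↦ b₁ b' S(b₂)` of `B` on itself. -/
def adB (_ : Pairing HA HB) : B →ₗ[K] B →ₗ[K] B :=
  TensorProduct.curry
    (lift mB ∘ₗ HB.antipode.toLinearMap.lTensor B ∘ₗ HB.T₃)

/-- The action of `𝒟` on `ℋ`:
`(a ⋈ b) · (a' # b') = a₃ (b₁ ▶ a') S⁻¹(a₂) # (b₂ b' S(b₃)) ◀ S⁻¹(a₁)`.  The maps applied are, from the
bottom up: `b ⊗ a' ↦ b₁ ▶ a' ⊗ b₂`; the adjoint action of `b₂` on `b'`;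
`a ⊗ d ↦ d ◀ S⁻¹(a₁) ⊗ a₂` with `d = b₂ b' S(b₃)`; the adjoint action of `a₂` on `b₁ ▶ a'`. -/
def actH : A ⊗[K] B →ₗ[K] A ⊗[K] B →ₗ[K] A ⊗[K] B :=
  TensorProduct.curry <|
    (comm K B A).toLinearMap
      ∘ₗ (lift P.adA).lTensor B
      ∘ₗ (assoc K B A A).toLinearMap
      ∘ₗ (comm K A (B ⊗[K] A)).toLinearMap
      ∘ₗ P.F.toLinearMap.lTensor A
      ∘ₗ (leftComm K A A B).toLinearMap
      ∘ₗ ((lift P.adB).lTensor A ∘ₗ (assoc K A B B).toLinearMap).lTensor A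
      ∘ₗ (P.R.toLinearMap.rTensor B ∘ₗ (assoc K B A B).symm.toLinearMap).lTensor A
      ∘ₗ (assoc K A B (A ⊗[K] B)).toLinearMap

/-- The coaction of `𝒟` on `ℋ`: `Γ(a # b) = (a₂ ⋈ b₁) ⊗ (a₁ # b₂)`. -/
def coactH : Coaction K (A ⊗[K] B) (A ⊗[K] B) where
  L := P.leftAB
  R := P.rightAB

/-! ### The restricted structures on `A` and `B` -/

/-- `(a ⋈ b) · a' = a₂ (b ▶ a') S⁻¹(a₁)`. -/
def actA : A ⊗[K] B →ₗ[K] A →ₗ[K] A :=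
  lift (LinearMap.compl₁₂ (LinearMap.llcomp K A A A) P.adA P.lA)

/-- `(a ⋈ b) · b' = (b₁ b' S(b₂)) ◀ S⁻¹(a)`. -/
def actB : A ⊗[K] B →ₗ[K] B →ₗ[K] B :=
  lift (LinearMap.compl₁₂ (LinearMap.llcomp K B B B) P.rBinv P.adB)

/-- `ρ(a) = Δᶜᵒᵖ₁₃(a) = (a₂ ⋈ 1) ⊗ a₁`. -/
def coactA : Coaction K (A ⊗[K] B) A where
  L := P.leftA
  R := P.rightA

/-- `ρ(b) = Δ₂₃(b) = (1 ⋈ b₁) ⊗ b₂`. -/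
def coactB : Coaction K (A ⊗[K] B) B where
  L := P.leftB
  R := P.rightB

end Pairing

end Heis

end

/-!
Every structure in the statement comes from the single map `x ⊗ v ↦ x₁ · v ⊗ x₂`, the twist
`UMod.tw` of a unital module `V` over a regular multiplier Hopf algebra `X`. Unital modules are
firm (`UMod.firm`), so a twist may be computed on elements `e · v`, which cover the first leg of the
comultiplication; this gives its existence, its bijectivity, its naturality in `V`
(`UMod.IsHom.tw_lTensor`), its compatibility with products in `X` (`UMod.tw_mul`) and the tensor
product of modules (`UMod.diag`), with `UMod.tw_tmul` for the twist of a tensor product. The two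
facts about the adjoint module that carry the proof are that `(x₁ v S(x₂)) x₃ = x v`
(`UMod.lift_mul_tw_ad`), and that the twist is a homomorphism from the tensor product of the adjoint
module and `V` to the one of `V` and the adjoint module (`UMod.isHom_tw_ad`): over a Hopf algebra
these are the braided commutativity of the adjoint module algebra and its Yetter-Drinfel'd
condition.

For a pairing, `R` is the twist of the `B`-module `A`, and `F` and `R⁻¹` are twists of the
`A`-module `B` with the action `b ◀ S⁻¹(a)` (`Pairing.R_symm`). The pairing
`⟨b, a⟩ = ⟨S⁻¹(a), b⟩` of the co-opposites (`Pairing.tilde`) turns `R` and `T` into their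
inverses, so that each statement about `A` yields its mirror image about `B`. The map `T` has the
two hexagon properties, which make `𝒟` an algebra with a non-degenerate product, and likewise `R`
and `ℋ`.

Unital `𝒟`-modules are pairs of an `A`-module and a `B`-module on the same space whose actions
are exchanged by `T` (`Pairing.IsDouble`). This holds if and only if the twist of the `A`-action,
for `Δᶜᵒᵖ`, is a homomorphism of `B`-modules (`Pairing.isDouble_iff_isHom`). In this form tensor
products of such pairs are again such pairs, and the regular module and the modules `A` and `B` of
the theorem are such pairs; `ℋ` is the tensor product of `A` and `B`. The coactions on `A`, `B` and
`ℋ` are the twists of the regular `𝒟`-module for `A`, for `B`, and their composite, so the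
Yetter-Drinfel'd condition says that these twists are homomorphisms for the actions of `A` and of
`B` (`Pairing.isYDCompatible`). For each of `A` and `B`, one of the two homomorphism properties is
`UMod.isHom_tw_ad` and the other is `Pairing.IsDouble.isHom` or its mirror image. Braided
commutativity follows from `(x₁ v S(x₂)) x₃ = x v` and the naturality of the twist, and comodule
properties are tested on slices by the pairing, under which coactions become multiplications in `𝒟`.
-/

open scoped TensorProduct
open TensorProduct (map lift assoc comm leftComm rightComm)

noncomputable section
namespace Heis

variable {K : Type*} [Field K]
variable {X : Type*} [AddCommGroup X] [Module K X]
variable {Y : Type*} [AddCommGroup Y] [Module K Y]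
variable {V : Type*} [AddCommGroup V] [Module K V]
variable {W : Type*} [AddCommGroup W] [Module K W]
variable {V' : Type*} [AddCommGroup V'] [Module K V']
variable {W' : Type*} [AddCommGroup W'] [Module K W']
variable {U : Type*} [AddCommGroup U] [Module K U]
variable {Z : Type*} [AddCommGroup Z] [Module K Z]

variable {A : Type*} [AddCommGroup A] [Module K A] {mA : A →ₗ[K] A →ₗ[K] A}
variable {B : Type*} [AddCommGroup B] [Module K B] {mB : B →ₗ[K] B →ₗ[K] B}

/-! ### Testing elements of tensor products -/

/-- A jointly injective family of linear maps stays so after tensoring, as vector spaces are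
free. -/
lemma lTensor_jointly_injective {ι : Type*} (f : ι → X →ₗ[K] Y)
    (h : ∀ x, (∀ i, f i x = 0) → x = 0) {t : Z ⊗[K] X}
    (ht : ∀ i, (f i).lTensor Z t = 0) : t = 0 := by
  classical
  let b := Module.Free.chooseBasis K Z
  obtain ⟨c, rfl⟩ := (TensorProduct.equivFinsuppOfBasisLeft b).symm.surjective t
  rw [TensorProduct.equivFinsuppOfBasisLeft_symm_apply] at ht ⊢
  have hc : ∀ j, c j = 0 := by
    intro j
    refine h _ fun i => ?_
    have h1 := ht i
    have h2 : (f i).lTensor Z (c.sum fun i n => b i ⊗ₜ[K] n) =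
        (TensorProduct.equivFinsuppOfBasisLeft b).symm (c.mapRange (f i) (map_zero _)) := by
      rw [TensorProduct.equivFinsuppOfBasisLeft_symm_apply, Finsupp.sum_mapRange_index (by simp),
        Finsupp.sum, Finsupp.sum, map_sum]
      simp
    rw [h2] at h1
    have h3 := (LinearEquiv.map_eq_zero_iff _).1 h1
    simpa using DFunLike.congr_fun h3 j
  have : c = 0 := Finsupp.ext hc
  simp [this]

lemma rTensor_jointly_injective {ι : Type*} (f : ι → X →ₗ[K] Y)
    (h : ∀ x, (∀ i, f i x = 0) → x = 0) {t : X ⊗[K] Z}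
    (ht : ∀ i, (f i).rTensor Z t = 0) : t = 0 := by
  have : comm K X Z t = 0 := by
    refine lTensor_jointly_injective f h fun i => ?_
    rw [← LinearMap.comm_comp_rTensor_comp_comm_eq]
    simp [ht i]
  simpa using this

lemma lTensor_ext {ι : Type*} (f : ι → X →ₗ[K] Y)
    (h : ∀ x, (∀ i, f i x = 0) → x = 0) {t t' : Z ⊗[K] X}
    (ht : ∀ i, (f i).lTensor Z t = (f i).lTensor Z t') : t = t' :=
  sub_eq_zero.1 (lTensor_jointly_injective f h fun i => by rw [map_sub, ht, sub_self])

lemma rTensor_ext {ι : Type*} (f : ι → X →ₗ[K] Y)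
    (h : ∀ x, (∀ i, f i x = 0) → x = 0) {t t' : X ⊗[K] Z}
    (ht : ∀ i, (f i).rTensor Z t = (f i).rTensor Z t') : t = t' :=
  sub_eq_zero.1 (rTensor_jointly_injective f h fun i => by rw [map_sub, ht, sub_self])

/-- The slice `z ⊗ x ↦ φ(x) z`. -/
def slR (Z : Type*) [AddCommGroup Z] [Module K Z] (φ : X →ₗ[K] K) : Z ⊗[K] X →ₗ[K] Z :=
  (TensorProduct.rid K Z).toLinearMap ∘ₗ φ.lTensor Z

/-- The slice `x ⊗ z ↦ φ(x) z`. -/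
def slL (Z : Type*) [AddCommGroup Z] [Module K Z] (φ : X →ₗ[K] K) : X ⊗[K] Z →ₗ[K] Z :=
  (TensorProduct.lid K Z).toLinearMap ∘ₗ φ.rTensor Z

@[simp] lemma slR_tmul (φ : X →ₗ[K] K) (z : Z) (x : X) : slR Z φ (z ⊗ₜ x) = φ x • z := by
  simp [slR]

@[simp] lemma slL_tmul (φ : X →ₗ[K] K) (z : Z) (x : X) : slL Z φ (x ⊗ₜ z) = φ x • z := by
  simp [slL]

lemma slR_ext {ι : Type*} (φ : ι → X →ₗ[K] K) (h : ∀ x, (∀ i, φ i x = 0) → x = 0)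
    {t t' : Z ⊗[K] X} (ht : ∀ i, slR Z (φ i) t = slR Z (φ i) t') : t = t' :=
  lTensor_ext φ h fun i => (TensorProduct.rid K Z).injective (ht i)

lemma slL_ext {ι : Type*} (φ : ι → X →ₗ[K] K) (h : ∀ x, (∀ i, φ i x = 0) → x = 0)
    {t t' : X ⊗[K] Z} (ht : ∀ i, slL Z (φ i) t = slL Z (φ i) t') : t = t' :=
  rTensor_ext φ h fun i => (TensorProduct.lid K Z).injective (ht i)

/-! ### Algebras and multiplier Hopf algebras -/

section Algebra

variable {m : X →ₗ[K] X →ₗ[K] X}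

lemma IsAlgebra.lTensor_flip_ext (hm : IsAlgebra m) {t t' : Z ⊗[K] X}
    (ht : ∀ s, (m.flip s).lTensor Z t = (m.flip s).lTensor Z t') : t = t' :=
  lTensor_ext (fun s => m.flip s) (fun x h => hm.nondeg_left x h) ht

lemma IsAlgebra.rTensor_flip_ext (hm : IsAlgebra m) {t t' : X ⊗[K] Z}
    (ht : ∀ s, (m.flip s).rTensor Z t = (m.flip s).rTensor Z t') : t = t' :=
  rTensor_ext (fun s => m.flip s) (fun x h => hm.nondeg_left x h) ht

lemma IsAlgebra.rTensor_mul_ext (hm : IsAlgebra m) {t t' : X ⊗[K] Z}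
    (ht : ∀ s, (m s).rTensor Z t = (m s).rTensor Z t') : t = t' :=
  rTensor_ext (fun s => m s) (fun x h => hm.nondeg_right x h) ht

lemma IsAlgebra.lTensor_mul_ext (hm : IsAlgebra m) {t t' : Z ⊗[K] X}
    (ht : ∀ s, (m s).lTensor Z t = (m s).lTensor Z t') : t = t' :=
  lTensor_ext (fun s => m s) (fun x h => hm.nondeg_right x h) ht

lemma mul₂_tmul_left (a b : X) (u : X ⊗[K] X) :
    mul₂ m (a ⊗ₜ b) u = (m a).rTensor X ((m b).lTensor X u) := by
  induction u using TensorProduct.induction_on with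
  | zero => simp
  | add u u' hu hu' => simp only [map_add, hu, hu']
  | tmul c d => simp

lemma mul₂_tmul_right (a b : X) (u : X ⊗[K] X) :
    mul₂ m u (a ⊗ₜ b) = (m.flip a).rTensor X ((m.flip b).lTensor X u) := by
  induction u using TensorProduct.induction_on with
  | zero => simp
  | add u u' hu hu' => simp only [map_add, LinearMap.add_apply, hu, hu']
  | tmul c d => simp

lemma mul₂_rTensor_flip (hm : IsAlgebra m) (c : X) (t u : X ⊗[K] X) :
    mul₂ m ((m.flip c).rTensor X t) u = mul₂ m t ((m c).rTensor X u) := by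
  induction t using TensorProduct.induction_on with
  | zero => simp
  | add u u' hu hu' => simp only [map_add, LinearMap.add_apply, hu, hu']
  | tmul a b =>
    induction u using TensorProduct.induction_on with
    | zero => simp
    | add u u' hu hu' => simp only [map_add, hu, hu']
    | tmul p q => simp [hm.assoc]

lemma mul₂_lTensor_flip (hm : IsAlgebra m) (c : X) (t u : X ⊗[K] X) :
    mul₂ m ((m.flip c).lTensor X t) u = mul₂ m t ((m c).lTensor X u) := by
  induction t using TensorProduct.induction_on with
  | zero => simp
  | add u u' hu hu' => simp only [map_add, LinearMap.add_apply, hu, hu']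
  | tmul a b =>
    induction u using TensorProduct.induction_on with
    | zero => simp
    | add u u' hu hu' => simp only [map_add, hu, hu']
    | tmul p q => simp [hm.assoc]

lemma mul₂_rTensor_mul (hm : IsAlgebra m) (c : X) (t u : X ⊗[K] X) :
    mul₂ m ((m c).rTensor X t) u = (m c).rTensor X (mul₂ m t u) := by
  induction t using TensorProduct.induction_on with
  | zero => simp
  | add u u' hu hu' => simp only [map_add, LinearMap.add_apply, hu, hu']
  | tmul a b =>
    induction u using TensorProduct.induction_on with
    | zero => simp
    | add u u' hu hu' => simp only [map_add, hu, hu']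
    | tmul p q => simp [hm.assoc]

lemma IsAlgebra.mul₂_assoc (hm : IsAlgebra m) (u v w : X ⊗[K] X) :
    mul₂ m (mul₂ m u v) w = mul₂ m u (mul₂ m v w) := by
  induction u using TensorProduct.induction_on with
  | zero => simp
  | add u u' hu hu' => simp only [map_add, LinearMap.add_apply, hu, hu']
  | tmul a b =>
    induction v using TensorProduct.induction_on with
    | zero => simp
    | add u u' hu hu' => simp only [map_add, LinearMap.add_apply, hu, hu']
    | tmul c d =>
      induction w using TensorProduct.induction_on with
      | zero => simp
      | add u u' hu hu' => simp only [map_add, hu, hu']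
      | tmul e f => simp [hm.assoc]

lemma IsAlgebra.mul₂_ext_left (hm : IsAlgebra m) {u u' : X ⊗[K] X}
    (h : ∀ w, mul₂ m w u = mul₂ m w u') : u = u' := by
  refine hm.lTensor_mul_ext fun b => hm.rTensor_mul_ext fun a => ?_
  rw [← mul₂_tmul_left, ← mul₂_tmul_left, h]

lemma IsAlgebra.mul₂_ext_right (hm : IsAlgebra m) {u u' : X ⊗[K] X}
    (h : ∀ w, mul₂ m u w = mul₂ m u' w) : u = u' := by
  refine hm.lTensor_flip_ext fun b => hm.rTensor_flip_ext fun a => ?_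
  rw [← mul₂_tmul_right, ← mul₂_tmul_right, h]

end Algebra

namespace MultiplierHopfAlgebra

variable {m : X →ₗ[K] X →ₗ[K] X} (H : MultiplierHopfAlgebra m)

lemma L_mul₂ (a : X) (u v : X ⊗[K] X) : H.L a (mul₂ m u v) = mul₂ m (H.L a u) v := by
  have hm := H.isAlgebra
  refine hm.mul₂_ext_left fun w => ?_
  rw [H.multiplier, ← hm.mul₂_assoc, ← H.multiplier, hm.mul₂_assoc]

lemma T₁_mul_left (a b c : X) : H.T₁ (m a b ⊗ₜ c) = H.L a (H.T₁ (b ⊗ₜ c)) := by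
  refine H.isAlgebra.mul₂_ext_right fun u => ?_
  rw [H.T₁_spec, ← L_mul₂, H.T₁_spec, H.L_mul]

lemma T₁_mul_right (a b c : X) :
    H.T₁ (a ⊗ₜ m b c) = (m.flip c).lTensor X (H.T₁ (a ⊗ₜ b)) := by
  refine H.isAlgebra.mul₂_ext_right fun u => ?_
  rw [H.T₁_spec, mul₂_lTensor_flip H.isAlgebra, H.T₁_spec]
  congr 1
  rw [← LinearMap.lTensor_comp_apply]
  congr 2
  ext y
  exact H.isAlgebra.assoc _ _ _

/-- `Δ(a)(p ⊗ q) = (Δ(a)(1 ⊗ q))(p ⊗ 1)`. -/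
lemma L_tmul (a p q : X) : H.L a (p ⊗ₜ q) = (m.flip p).rTensor X (H.T₁ (a ⊗ₜ q)) := by
  refine H.isAlgebra.mul₂_ext_right fun u => ?_
  rw [← L_mul₂, mul₂_rTensor_flip H.isAlgebra, H.T₁_spec, mul₂_tmul_left]
  congr 1
  simp only [← LinearMap.comp_apply, LinearMap.rTensor_comp_lTensor, LinearMap.lTensor_comp_rTensor]

/-- `(y ⊗ 1)(Δ(x)(1 ⊗ z)) = ((y ⊗ 1)Δ(x))(1 ⊗ z)`. -/
lemma rTensor_T₁ (x y z : X) :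
    (m y).rTensor X (H.T₁ (x ⊗ₜ z)) = (m.flip z).lTensor X (H.T₂ (y ⊗ₜ x)) := by
  refine H.isAlgebra.mul₂_ext_right fun u => ?_
  rw [mul₂_rTensor_mul H.isAlgebra, H.T₁_spec, mul₂_lTensor_flip H.isAlgebra, H.T₂_spec]

lemma T₁_symm_mul_right (a b c : X) :
    H.T₁.symm (a ⊗ₜ m b c) = (m.flip c).lTensor X (H.T₁.symm (a ⊗ₜ b)) := by
  rw [LinearEquiv.symm_apply_eq]
  have key : ∀ t, H.T₁ ((m.flip c).lTensor X t) = (m.flip c).lTensor X (H.T₁ t) := by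
    intro t
    induction t using TensorProduct.induction_on with
    | zero => simp
    | add u u' hu hu' => simp only [map_add, hu, hu']
    | tmul p q => exact H.T₁_mul_right _ _ _
  rw [key, LinearEquiv.apply_symm_apply]
  simp

end MultiplierHopfAlgebra

lemma slL_rTensor (f : X →ₗ[K] Y) (φ : Y →ₗ[K] K) (t : X ⊗[K] Z) :
    slL Z φ (f.rTensor Z t) = slL Z (φ ∘ₗ f) t := by
  induction t using TensorProduct.induction_on with
  | zero => simp
  | add u u' hu hu' => simp only [map_add, hu, hu']
  | tmul p q => simp

lemma slR_lTensor (f : X →ₗ[K] Y) (φ : Y →ₗ[K] K) (t : Z ⊗[K] X) :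
    slR Z φ (f.lTensor Z t) = slR Z (φ ∘ₗ f) t := by
  induction t using TensorProduct.induction_on with
  | zero => simp
  | add u u' hu hu' => simp only [map_add, hu, hu']
  | tmul p q => simp

lemma slL_lTensor (f : Z →ₗ[K] W) (φ : X →ₗ[K] K) (t : X ⊗[K] Z) :
    slL W φ (f.lTensor X t) = f (slL Z φ t) := by
  induction t using TensorProduct.induction_on with
  | zero => simp
  | add u u' hu hu' => simp only [map_add, hu, hu']
  | tmul p q => simp

lemma slR_rTensor (f : Z →ₗ[K] W) (φ : X →ₗ[K] K) (t : Z ⊗[K] X) :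
    slR W φ (f.rTensor X t) = f (slR Z φ t) := by
  induction t using TensorProduct.induction_on with
  | zero => simp
  | add u u' hu hu' => simp only [map_add, hu, hu']
  | tmul p q => simp

lemma slR_comm (φ : X →ₗ[K] K) (t : X ⊗[K] Z) : slR Z φ (comm K X Z t) = slL Z φ t := by
  induction t using TensorProduct.induction_on with
  | zero => simp
  | add u u' hu hu' => simp only [map_add, hu, hu']
  | tmul p q => simp

lemma slL_comm (φ : X →ₗ[K] K) (t : Z ⊗[K] X) : slL Z φ (comm K Z X t) = slR Z φ t := by
  induction t using TensorProduct.induction_on with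
  | zero => simp
  | add u u' hu hu' => simp only [map_add, hu, hu']
  | tmul p q => simp

lemma exists_dual_eq_one {x : X} (hx : x ≠ 0) : ∃ φ : X →ₗ[K] K, φ x = 1 := by
  obtain ⟨φ, hφ⟩ := Module.Projective.exists_dual_ne_zero K hx
  exact ⟨(φ x)⁻¹ • φ, by simp [hφ]⟩

/-! ### The counit -/

namespace MultiplierHopfAlgebra

variable {m : X →ₗ[K] X →ₗ[K] X} (H : MultiplierHopfAlgebra m)

/-- Coassociativity in terms of `T₁⁻¹`. -/
lemma coassoc_symm (a q c : X) :
    assoc K X X X (H.T₂.toLinearMap.rTensor X ((assoc K X X X).symm (a ⊗ₜ H.T₁.symm (q ⊗ₜ c)))) =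
      H.T₁.symm.toLinearMap.lTensor X (assoc K X X X (H.T₂ (a ⊗ₜ q) ⊗ₜ c)) := by
  have key : ∀ t, assoc K X X X (H.T₂.toLinearMap.rTensor X ((assoc K X X X).symm (a ⊗ₜ H.T₁ t))) =
      H.T₁.toLinearMap.lTensor X (assoc K X X X (H.T₂.toLinearMap.rTensor X
        ((assoc K X X X).symm (a ⊗ₜ t)))) := by
    intro t
    induction t using TensorProduct.induction_on with
    | zero => simp
    | add u u' hu hu' => simp only [map_add, TensorProduct.tmul_add, hu, hu']
    | tmul p q => simpa using H.coassoc a p q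
  have h1 := key (H.T₁.symm (q ⊗ₜ c))
  rw [LinearEquiv.apply_symm_apply] at h1
  have h2 := congrArg (H.T₁.symm.toLinearMap.lTensor X) h1
  rw [← LinearMap.lTensor_comp_apply] at h2
  simpa using h2.symm

/-- The maps `m ∘ T₁⁻¹` and `m ∘ T₂⁻¹` are of the form `q ⊗ c ↦ ε(q) c` and `p ⊗ q ↦ ε(q) p` with
the same functional `ε`: coassociativity gives `p ⊗ m(T₁⁻¹(q ⊗ c)) = m(T₂⁻¹(p ⊗ q)) ⊗ c`. -/
lemma exists_counit : ∃ ε : X →ₗ[K] K,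
    (∀ t, slL X ε (H.T₁ t) = lift m t) ∧ (∀ t, slR X ε (H.T₂ t) = lift m t) := by
  have key : ∀ p q c, p ⊗ₜ[K] lift m (H.T₁.symm (q ⊗ₜ c)) =
      lift m (H.T₂.symm (p ⊗ₜ q)) ⊗ₜ[K] c := by
    intro p q c
    have h1 : ∀ t, ((lift m ∘ₗ H.T₁.symm.toLinearMap).lTensor X) (assoc K X X X (H.T₂ t ⊗ₜ c)) =
        lift m t ⊗ₜ c := by
      intro t
      induction t using TensorProduct.induction_on with
      | zero => simp
      | add u u' hu hu' => simp only [map_add, TensorProduct.add_tmul, hu, hu']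
      | tmul a q =>
        rw [LinearMap.lTensor_comp_apply, ← coassoc_symm]
        have h2 : ∀ t, (lift m).lTensor X (assoc K X X X (H.T₂.toLinearMap.rTensor X
            ((assoc K X X X).symm (a ⊗ₜ t)))) = (m a).rTensor X (H.T₁ t) := by
          intro t
          induction t using TensorProduct.induction_on with
          | zero => simp
          | add u u' hu hu' => simp only [map_add, TensorProduct.tmul_add, hu, hu']
          | tmul b c =>
            rw [rTensor_T₁]
            simp only [TensorProduct.assoc_symm_tmul, LinearMap.rTensor_tmul, LinearEquiv.coe_coe]
            generalize H.T₂ (a ⊗ₜ b) = z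
            induction z using TensorProduct.induction_on with
            | zero => simp
            | add u u' hu hu' => simp only [map_add, TensorProduct.add_tmul, hu, hu']
            | tmul b c => simp
        rw [h2]
        simp
    have := h1 (H.T₂.symm (p ⊗ₜ q))
    simpa using this
  by_cases hX : ∀ x : X, x = 0
  · refine ⟨0, fun t => ?_, fun t => ?_⟩ <;> exact (hX _).trans (hX _).symm
  push Not at hX
  obtain ⟨x, hx⟩ := hX
  obtain ⟨φ, hφ⟩ := exists_dual_eq_one (K := K) hx
  let ε : X →ₗ[K] K := φ ∘ₗ lift m ∘ₗ H.T₂.symm.toLinearMap ∘ₗ TensorProduct.mk K X X x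
  have hε : ∀ q, ε q = φ (lift m (H.T₂.symm (x ⊗ₜ q))) := fun q => rfl
  have h1 : ∀ q c, lift m (H.T₁.symm (q ⊗ₜ c)) = ε q • c := by
    intro q c
    have := congrArg (slL X φ) (key x q c)
    simpa [hφ, hε] using this
  have h2 : ∀ p q, lift m (H.T₂.symm (p ⊗ₜ q)) = ε q • p := by
    intro p q
    have := congrArg (slR X φ) (key p q x)
    rw [slR_tmul, slR_tmul, hφ, one_smul, h1] at this
    simpa [hφ] using this.symm
  have h1' : ∀ t, lift m (H.T₁.symm t) = slL X ε t := by
    intro t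
    induction t using TensorProduct.induction_on with
    | zero => simp
    | add u u' hu hu' => simp only [map_add, hu, hu']
    | tmul a q => simp [h1]
  have h2' : ∀ t, lift m (H.T₂.symm t) = slR X ε t := by
    intro t
    induction t using TensorProduct.induction_on with
    | zero => simp
    | add u u' hu hu' => simp only [map_add, hu, hu']
    | tmul a q => simp [h2]
  exact ⟨ε, fun t => by rw [← h1']; simp, fun t => by rw [← h2']; simp⟩

end MultiplierHopfAlgebra

namespace RegularMHA

variable {m : X →ₗ[K] X →ₗ[K] X} (H : RegularMHA m)

/-- The co-opposite `(X, Δᶜᵒᵖ)` of a regular multiplier Hopf algebra. -/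
def copReg : RegularMHA m where
  toMultiplierHopfAlgebra := H.cop
  cop := H.toMultiplierHopfAlgebra
  cop_L a u := by simp [H.cop_L]
  cop_R a u := by simp [H.cop_R]

lemma isCounit_counit : H.IsCounit H.counit := by
  refine Classical.epsilon_spec (p := H.IsCounit) ?_
  obtain ⟨ε, h1, h2⟩ := H.exists_counit
  exact ⟨ε, fun a b => ⟨h1 _, h2 _⟩⟩

lemma slL_counit_T₁ (t : X ⊗[K] X) : slL X H.counit (H.T₁ t) = lift m t := by
  induction t using TensorProduct.induction_on with
  | zero => simp
  | add u u' hu hu' => simp only [map_add, hu, hu']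
  | tmul a q => exact (H.isCounit_counit a q).1

lemma slR_counit_T₂ (t : X ⊗[K] X) : slR X H.counit (H.T₂ t) = lift m t := by
  induction t using TensorProduct.induction_on with
  | zero => simp
  | add u u' hu hu' => simp only [map_add, hu, hu']
  | tmul a q => exact (H.isCounit_counit a q).2

lemma mul₂_comm (t u : X ⊗[K] X) :
    mul₂ m (comm K X X t) u = comm K X X (mul₂ m t (comm K X X u)) := by
  induction t using TensorProduct.induction_on with
  | zero => simp
  | add u u' hu hu' => simp only [map_add, LinearMap.add_apply, hu, hu']
  | tmul a b =>
    induction u using TensorProduct.induction_on with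
    | zero => simp
    | add u u' hu hu' => simp only [map_add, hu, hu']
    | tmul p q => simp

lemma comm_lTensor (f : X →ₗ[K] Y) (t : Z ⊗[K] X) :
    comm K Z Y (f.lTensor Z t) = f.rTensor Z (comm K Z X t) := by
  induction t using TensorProduct.induction_on with
  | zero => simp
  | add u u' hu hu' => simp only [map_add, hu, hu']
  | tmul p q => simp

lemma comm_rTensor (f : X →ₗ[K] Y) (t : X ⊗[K] Z) :
    comm K Y Z (f.rTensor Z t) = f.lTensor Z (comm K X Z t) := by
  induction t using TensorProduct.induction_on with
  | zero => simp
  | add u u' hu hu' => simp only [map_add, hu, hu']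
  | tmul p q => simp

lemma T₃_apply (t : X ⊗[K] X) : H.T₃ t = comm K X X (H.cop.T₁ t) := rfl

lemma copT₃_apply (t : X ⊗[K] X) : H.copT₃ t = comm K X X (H.T₁ t) := rfl

lemma copReg_T₃ : H.copReg.T₃ = H.copT₃ := rfl

lemma mul₂_T₃ (a b : X) (u : X ⊗[K] X) :
    mul₂ m (H.T₃ (a ⊗ₜ b)) u = H.L a ((m b).rTensor X u) := by
  rw [T₃_apply, mul₂_comm, H.cop.T₁_spec, H.cop_L]
  simp [comm_lTensor]

lemma T₃_mul_left (a b c : X) : H.T₃ (m a b ⊗ₜ c) = H.L a (H.T₃ (b ⊗ₜ c)) := by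
  rw [T₃_apply, H.cop.T₁_mul_left, H.cop_L]
  simp [T₃_apply]

lemma T₃_mul_right (a b c : X) :
    H.T₃ (a ⊗ₜ m b c) = (m.flip c).rTensor X (H.T₃ (a ⊗ₜ b)) := by
  rw [T₃_apply, H.cop.T₁_mul_right, comm_lTensor]
  rfl

lemma L_tmul' (a p q : X) : H.L a (p ⊗ₜ q) = (m.flip q).lTensor X (H.T₃ (a ⊗ₜ p)) := by
  have := congrArg (comm K X X) (H.cop.L_tmul a q p)
  rw [H.cop_L, comm_rTensor] at this
  simpa [T₃_apply] using this

lemma rTensor_T₃ (x y z : X) :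
    (m y).rTensor X (H.T₃ (x ⊗ₜ z)) = (m.flip z).rTensor X (H.T₂ (y ⊗ₜ x)) := by
  refine H.isAlgebra.mul₂_ext_right fun u => ?_
  rw [mul₂_rTensor_mul H.isAlgebra, mul₂_T₃, mul₂_rTensor_flip H.isAlgebra, H.T₂_spec]

/-- `a₁ b ε(a₂) = a b`. -/
lemma slR_counit_T₃ (t : X ⊗[K] X) : slR X H.counit (H.T₃ t) = lift m t := by
  induction t using TensorProduct.induction_on with
  | zero => simp
  | add u u' hu hu' => simp only [map_add, hu, hu']
  | tmul a b =>
    refine sub_eq_zero.1 (H.isAlgebra.nondeg_right _ fun y => ?_)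
    rw [map_sub, sub_eq_zero, ← slR_rTensor, rTensor_T₃, slR_rTensor, slR_counit_T₂]
    simp [H.isAlgebra.assoc]

lemma T₃_surjective : Function.Surjective H.T₃ :=
  (comm K X X).surjective.comp H.cop.T₁.surjective

lemma counit_copReg : H.copReg.counit = H.counit := by
  ext x
  by_cases hX : ∀ x : X, x = 0
  · simp [hX x]
  push Not at hX
  obtain ⟨y, hy⟩ := hX
  obtain ⟨t, ht⟩ := H.T₃_surjective (y ⊗ₜ x)
  have h1 := H.slR_counit_T₃ t
  have h2 := H.copReg.slL_counit_T₁ t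
  rw [← h1, ← slR_comm] at h2
  change slR X _ (H.T₃ t) = _ at h2
  rw [ht, slR_tmul, slR_tmul] at h2
  exact smul_left_injective K hy h2

lemma exists_counit_eq_one {x : X} (hx : x ≠ 0) : ∃ e, H.counit e = 1 := by
  by_contra! h
  have h0 : H.counit = 0 := by
    ext e
    by_contra he
    exact h ((H.counit e)⁻¹ • e) (by simp_all)
  refine hx (H.isAlgebra.nondeg_left x fun y => ?_)
  have := H.slL_counit_T₁ (x ⊗ₜ y)
  rw [h0] at this
  simpa [slL] using this.symm

/-- The product map `X ⊗ X → X` is onto. -/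
lemma lift_mul_surjective (H : RegularMHA m) : Function.Surjective (lift m) := by
  intro x
  by_cases hx : x = 0
  · exact ⟨0, by simp [hx]⟩
  obtain ⟨e, he⟩ := H.exists_counit_eq_one hx
  refine ⟨H.T₁.symm (e ⊗ₜ x), ?_⟩
  rw [← H.slL_counit_T₁, LinearEquiv.apply_symm_apply, slL_tmul, he, one_smul]

end RegularMHA

/-! ### The antipode -/

namespace RegularMHA

variable {m : X →ₗ[K] X →ₗ[K] X} (H : RegularMHA m)

lemma lift_mul_T₁_symm (q c : X) : lift m (H.T₁.symm (q ⊗ₜ c)) = H.counit q • c := by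
  rw [← H.slL_counit_T₁, LinearEquiv.apply_symm_apply, slL_tmul]

lemma T₁_rTensor_mul (a : X) (t : X ⊗[K] X) : H.T₁ ((m a).rTensor X t) = H.L a (H.T₁ t) := by
  induction t using TensorProduct.induction_on with
  | zero => simp
  | add u u' hu hu' => simp only [map_add, hu, hu']
  | tmul p q => exact H.T₁_mul_left _ _ _

lemma rTensor_flip_T₁ (a b c : X) :
    (m.flip b).rTensor X (H.T₁ (a ⊗ₜ c)) = H.T₁ ((m a).rTensor X (H.T₁.symm (b ⊗ₜ c))) := by
  rw [T₁_rTensor_mul, LinearEquiv.apply_symm_apply, ← H.L_tmul]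

/-- The counit is multiplicative: `m(T₁⁻¹(T₁(t)(b ⊗ 1))) = ε(b) m(t)`. -/
lemma counit_mul (a b : X) : H.counit (m a b) = H.counit a * H.counit b := by
  by_cases hX : ∀ x : X, x = 0
  · simp [hX a]
  push Not at hX
  obtain ⟨c, hc⟩ := hX
  have key : ∀ t, lift m (H.T₁.symm ((m.flip b).rTensor X (H.T₁ t))) =
      H.counit b • lift m t := by
    intro t
    induction t using TensorProduct.induction_on with
    | zero => simp
    | add u u' hu hu' => simp only [map_add, hu, hu', smul_add]
    | tmul p q =>
      rw [rTensor_flip_T₁, LinearEquiv.symm_apply_apply]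
      have : ∀ s, lift m ((m p).rTensor X s) = m p (lift m s) := by
        intro s
        induction s using TensorProduct.induction_on with
        | zero => simp
        | add u u' hu hu' => simp only [map_add, hu, hu']
        | tmul x y => simp [H.isAlgebra.assoc]
      rw [this, lift_mul_T₁_symm]
      simp
  have h := key (H.T₁.symm (a ⊗ₜ c))
  rw [LinearEquiv.apply_symm_apply, LinearMap.rTensor_tmul, LinearMap.flip_apply,
    lift_mul_T₁_symm, lift_mul_T₁_symm, smul_smul, mul_comm] at h
  exact smul_left_injective K hc h

/-- The map `a ⊗ b ↦ S(a) b`. It is defined without the antipode, as `(ε ⊗ ι) ∘ T₁⁻¹`, and the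
antipode is obtained from it. -/
def antipodeMul : X ⊗[K] X →ₗ[K] X := slL X H.counit ∘ₗ H.T₁.symm.toLinearMap

lemma antipodeMul_T₁ (t : X ⊗[K] X) : H.antipodeMul (H.T₁ t) = slL X H.counit t := by
  simp [antipodeMul]

lemma antipodeMul_surjective : Function.Surjective H.antipodeMul := by
  intro x
  by_cases hx : x = 0
  · exact ⟨0, by simp [hx]⟩
  obtain ⟨e, he⟩ := H.exists_counit_eq_one hx
  exact ⟨H.T₁ (e ⊗ₜ x), by rw [antipodeMul_T₁, slL_tmul, he, one_smul]⟩

lemma antipodeMul_mul_right (a b c : X) :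
    H.antipodeMul (a ⊗ₜ m b c) = m (H.antipodeMul (a ⊗ₜ b)) c := by
  simp [antipodeMul, H.T₁_symm_mul_right, slL_lTensor]

/-- `S(ab) c = S(b) S(a) c`. -/
lemma antipodeMul_mul_left (a b c : X) :
    H.antipodeMul (m a b ⊗ₜ c) = H.antipodeMul (b ⊗ₜ H.antipodeMul (a ⊗ₜ c)) := by
  have key : ∀ t, H.antipodeMul ((m.flip b).rTensor X (H.T₁ t)) =
      H.antipodeMul (b ⊗ₜ slL X H.counit t) := by
    intro t
    induction t using TensorProduct.induction_on with
    | zero => simp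
    | add u u' hu hu' => simp only [map_add, hu, hu', TensorProduct.tmul_add]
    | tmul p q =>
      rw [rTensor_flip_T₁, antipodeMul_T₁]
      have : ∀ s, slL X H.counit ((m p).rTensor X s) = H.counit p • slL X H.counit s := by
        intro s
        induction s using TensorProduct.induction_on with
        | zero => simp
        | add u u' hu hu' => simp only [map_add, hu, hu', smul_add]
        | tmul x y => simp [counit_mul, smul_smul]
      rw [this]
      simp [antipodeMul]
  have h := key (H.T₁.symm (a ⊗ₜ c))
  rw [LinearEquiv.apply_symm_apply] at h
  exact h

/-- `S⁻¹(S(a) b) c = S⁻¹(b) a c`. -/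
lemma antipodeMul_copReg_antipodeMul (t : X ⊗[K] X) (c : X) :
    H.copReg.antipodeMul (H.antipodeMul t ⊗ₜ c) =
      m (H.copReg.antipodeMul (comm K X X t)) c := by
  have key : ∀ t, H.copReg.antipodeMul (slL X H.counit t ⊗ₜ c) =
      H.copReg.antipodeMul (comm K X X ((m.flip c).rTensor X (H.T₁ t))) := by
    intro t
    induction t using TensorProduct.induction_on with
    | zero => simp
    | add u u' hu hu' => simp only [map_add, hu, hu', TensorProduct.add_tmul]
    | tmul p q =>
      have h1 : (m.flip c).rTensor X (H.T₁ (p ⊗ₜ q)) = (m.flip q).lTensor X (H.T₃ (p ⊗ₜ c)) := by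
        rw [← H.L_tmul, ← H.L_tmul']
      have h2 : ∀ z, H.copReg.antipodeMul ((m.flip q).rTensor X z) =
          H.copReg.antipodeMul (q ⊗ₜ H.copReg.antipodeMul z) := by
        intro z
        induction z using TensorProduct.induction_on with
        | zero => simp
        | add u u' hu hu' => simp only [map_add, hu, hu', TensorProduct.tmul_add]
        | tmul p q => exact H.copReg.antipodeMul_mul_left _ _ _
      rw [h1, comm_lTensor, h2, T₃_apply]
      have h3 : comm K X X (comm K X X (H.cop.T₁ (p ⊗ₜ c))) = H.copReg.T₁ (p ⊗ₜ c) := by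
        simp [copReg]
      rw [h3, antipodeMul_T₁, counit_copReg]
      simp [← TensorProduct.smul_tmul']
  have h4 : ∀ z, H.copReg.antipodeMul (comm K X X ((m.flip c).rTensor X z)) =
      m (H.copReg.antipodeMul (comm K X X z)) c := by
    intro z
    induction z using TensorProduct.induction_on with
    | zero => simp
    | add u u' hu hu' => simp only [map_add, hu, hu', LinearMap.add_apply]
    | tmul p q => simp [antipodeMul_mul_right]
  rw [← h4]
  have := key (H.T₁.symm t)
  rw [LinearEquiv.apply_symm_apply] at this
  exact this

/-- A linear map `S` with `antipodeMul (a ⊗ b) = S(a) b`. Since `S⁻¹(a) b`, the corresponding map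
for the co-opposite, takes all values, `S` is defined by `S(S⁻¹(a) b) = S(b) a`. -/
lemma exists_antipodeMul_eq : ∃ S : X →ₗ[K] X,
    (∀ a b, H.antipodeMul (a ⊗ₜ b) = m (S a) b) ∧
      ∀ t, S (H.copReg.antipodeMul t) = H.antipodeMul (comm K X X t) := by
  obtain ⟨σ, hσ⟩ := H.copReg.antipodeMul.exists_rightInverse_of_surjective
    (LinearMap.range_eq_top.2 H.copReg.antipodeMul_surjective)
  have h := H.copReg.antipodeMul_copReg_antipodeMul
  have h1 : ∀ a b, H.antipodeMul (a ⊗ₜ b) = m (H.antipodeMul (comm K X X (σ a))) b := by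
    intro a b
    have h2 := h (σ a) b
    rw [show H.copReg.antipodeMul (σ a) = a from LinearMap.congr_fun hσ a] at h2
    exact h2
  refine ⟨H.antipodeMul ∘ₗ (comm K X X).toLinearMap ∘ₗ σ, h1, fun t => ?_⟩
  refine sub_eq_zero.1 (H.isAlgebra.nondeg_left _ fun y => ?_)
  rw [map_sub, LinearMap.sub_apply, sub_eq_zero]
  refine (h1 _ _).symm.trans (h t y)

/-- `b₁ S(b₂) c` with `b₁` covered from the left. -/
lemma lift_antipodeMul_T₂ (a b c : X) :
    (lift m) ((H.antipodeMul).lTensor X (assoc K X X X (H.T₂ (b ⊗ₜ a) ⊗ₜ c))) =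
      H.counit a • m b c := by
  rw [antipodeMul, LinearMap.lTensor_comp_apply, ← H.coassoc_symm]
  have key : ∀ t, lift m ((slL X H.counit).lTensor X (assoc K X X X (H.T₂.toLinearMap.rTensor X
      ((assoc K X X X).symm (b ⊗ₜ t))))) = m b (lift m t) := by
    intro t
    induction t using TensorProduct.induction_on with
    | zero => simp
    | add u u' hu hu' => simp only [map_add, hu, hu', TensorProduct.tmul_add]
    | tmul p q =>
      have h : ∀ z, lift m ((slL X H.counit).lTensor X (assoc K X X X (z ⊗ₜ q))) =
          m (slR X H.counit z) q := by
        intro z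
        induction z using TensorProduct.induction_on with
        | zero => simp
        | add u u' hu hu' => simp only [map_add, hu, hu', TensorProduct.add_tmul,
            LinearMap.add_apply]
        | tmul p q => simp
      simp only [TensorProduct.assoc_symm_tmul, LinearMap.rTensor_tmul, LinearEquiv.coe_coe]
      rw [h, slR_counit_T₂]
      simp [H.isAlgebra.assoc]
  rw [key, lift_mul_T₁_symm, map_smul]

lemma exists_antipode : ∃ S : X ≃ₗ[K] X, (∀ a b, H.antipodeMul (a ⊗ₜ b) = m (S a) b) ∧
    (∀ a b, H.copReg.antipodeMul (a ⊗ₜ b) = m (S.symm a) b) := by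
  obtain ⟨S, h1, h2⟩ := H.exists_antipodeMul_eq
  obtain ⟨S', h1', h2'⟩ := H.copReg.exists_antipodeMul_eq
  change ∀ t, S' (H.antipodeMul t) = _ at h2'
  refine ⟨LinearEquiv.ofLinearMap S S' ?_ ?_, h1, h1'⟩
  · ext x
    obtain ⟨t, rfl⟩ := H.antipodeMul_surjective x
    simp [h2, h2']
  · ext x
    obtain ⟨t, rfl⟩ := H.copReg.antipodeMul_surjective x
    simp [h2, h2']

lemma isAntipode_of_antipodeMul {S : X ≃ₗ[K] X}
    (hS : ∀ a b, H.antipodeMul (a ⊗ₜ b) = m (S a) b) : H.IsAntipode S := by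
  have h1 : ∀ t, lift m (S.toLinearMap.rTensor X t) = H.antipodeMul t := by
    intro t
    induction t using TensorProduct.induction_on with
    | zero => simp
    | add u u' hu hu' => simp only [map_add, hu, hu']
    | tmul p q => simp [hS]
  refine fun a b => ⟨by rw [h1, antipodeMul_T₁, slL_tmul], ?_⟩
  refine sub_eq_zero.1 (H.isAlgebra.nondeg_left _ fun c => ?_)
  rw [map_sub, LinearMap.sub_apply, sub_eq_zero, map_smul, LinearMap.smul_apply,
    ← lift_antipodeMul_T₂]
  generalize H.T₂ (a ⊗ₜ b) = t
  induction t using TensorProduct.induction_on with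
  | zero => simp
  | add u u' hu hu' => simp only [map_add, hu, hu', LinearMap.add_apply, TensorProduct.add_tmul]
  | tmul p q => simp [hS, H.isAlgebra.assoc]

lemma isAntipode_antipode : H.IsAntipode H.antipode := by
  obtain ⟨S, h, -⟩ := H.exists_antipode
  have : Nonempty (X ≃ₗ[K] X) := ⟨LinearEquiv.refl K X⟩
  exact Classical.epsilon_spec (p := H.IsAntipode) ⟨S, H.isAntipode_of_antipodeMul h⟩

lemma antipodeMul_eq (a b : X) : H.antipodeMul (a ⊗ₜ b) = m (H.antipode a) b := by
  have h1 : ∀ t, lift m (H.antipode.toLinearMap.rTensor X (H.T₁ t)) = slL X H.counit t := by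
    intro t
    induction t using TensorProduct.induction_on with
    | zero => simp
    | add u u' hu hu' => simp only [map_add, hu, hu']
    | tmul p q => simpa using (H.isAntipode_antipode p q).1
  have h2 := h1 (H.T₁.symm (a ⊗ₜ b))
  rw [LinearEquiv.apply_symm_apply] at h2
  exact h2.symm

/-- The antipode of the co-opposite is the inverse of the antipode. -/
lemma antipode_copReg : H.copReg.antipode = H.antipode.symm := by
  obtain ⟨S, h1, h2⟩ := H.exists_antipode
  have e1 : H.antipode = S := by
    ext a
    refine sub_eq_zero.1 (H.isAlgebra.nondeg_left _ fun c => ?_)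
    rw [map_sub, LinearMap.sub_apply, sub_eq_zero, ← antipodeMul_eq, h1]
  have e2 : H.copReg.antipode = S.symm := by
    ext a
    refine sub_eq_zero.1 (H.isAlgebra.nondeg_left _ fun c => ?_)
    rw [map_sub, LinearMap.sub_apply, sub_eq_zero, ← antipodeMul_eq, h2]
  rw [e1, e2]

lemma antipode_mul (a b : X) : H.antipode (m a b) = m (H.antipode b) (H.antipode a) := by
  refine sub_eq_zero.1 (H.isAlgebra.nondeg_left _ fun c => ?_)
  rw [map_sub, LinearMap.sub_apply, sub_eq_zero, ← antipodeMul_eq, antipodeMul_mul_left,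
    antipodeMul_eq, antipodeMul_eq, H.isAlgebra.assoc]

lemma antipode_symm_mul (a b : X) :
    H.antipode.symm (m a b) = m (H.antipode.symm b) (H.antipode.symm a) := by
  rw [← antipode_copReg]
  exact H.copReg.antipode_mul a b

end RegularMHA

/-! ### Unital modules -/

/-- A unital left module over the (non-unital) algebra `(X, m)`: every element is a sum of elements
`x · v`. -/
structure UMod (m : X →ₗ[K] X →ₗ[K] X) (V : Type*) [AddCommGroup V] [Module K V] where
  act : X →ₗ[K] V →ₗ[K] V
  mul_act : ∀ x y v, act (m x y) v = act x (act y v)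
  surj : Function.Surjective (lift act)

namespace UMod

variable {m : X →ₗ[K] X →ₗ[K] X}

lemma hom_ext (M : UMod m V) {f g : V →ₗ[K] Z} (h : ∀ x v, f (M.act x v) = g (M.act x v)) (v : V) :
    f v = g v := by
  obtain ⟨t, rfl⟩ := M.surj v
  induction t using TensorProduct.induction_on with
  | zero => simp
  | add u u' hu hu' => simp only [map_add, hu, hu']
  | tmul p q => simpa using h p q

/-- Unital modules over a multiplier Hopf algebra are firm: `X ⊗_X V → V` is injective. The map `f`
is any balanced map. If `∑ xᵢ vᵢ = 0`, then `∑ Δ(b)(1 ⊗ xᵢ) ⊗ vᵢ` vanishes in `X ⊗ (X ⊗_X V)`, and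
applying `T₁⁻¹` to it gives `b ⊗ ∑ xᵢ ⊗ vᵢ`. -/
lemma firm (H : MultiplierHopfAlgebra m) (M : UMod m V) (f : X ⊗[K] V →ₗ[K] Z)
    (hf : ∀ p r v, f (m p r ⊗ₜ v) = f (p ⊗ₜ M.act r v)) {t : X ⊗[K] V}
    (ht : lift M.act t = 0) : f t = 0 := by
  let N : Submodule K (X ⊗[K] V) :=
    Submodule.span K {z | ∃ p r v, z = m p r ⊗ₜ v - p ⊗ₜ M.act r v}
  have hN : N ≤ LinearMap.ker f := by
    refine Submodule.span_le.2 ?_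
    rintro _ ⟨p, r, v, rfl⟩
    simp [hf]
  suffices h : t ∈ N from hN h
  have hrel : ∀ p r v, N.mkQ (m p r ⊗ₜ v) = N.mkQ (p ⊗ₜ M.act r v) := by
    intro p r v
    rw [← sub_eq_zero, ← map_sub, N.mkQ_apply, Submodule.Quotient.mk_eq_zero]
    exact Submodule.subset_span ⟨p, r, v, rfl⟩
  by_cases hX : ∀ x : X, x = 0
  · have : t = 0 := by
      induction t using TensorProduct.induction_on with
      | zero => rfl
      | add u u' hu hu' => exact Subsingleton.elim (h := ⟨fun a b => by
          have : Subsingleton X := ⟨fun a b => (hX a).trans (hX b).symm⟩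
          exact Subsingleton.elim a b⟩) _ _
      | tmul p q => rw [hX p, TensorProduct.zero_tmul]
    rw [this]
    exact N.zero_mem
  push Not at hX
  obtain ⟨b, hb⟩ := hX
  -- `(m q ⊗ ι) t` is trivial in the balanced tensor product
  have h1 : ∀ q, N.mkQ ((m q).rTensor V t) = 0 := by
    intro q
    have : ∀ t, N.mkQ ((m q).rTensor V t) = N.mkQ (q ⊗ₜ lift M.act t) := by
      intro t
      induction t using TensorProduct.induction_on with
      | zero => simp
      | add u u' hu hu' => simp only [map_add, TensorProduct.tmul_add, hu, hu']
      | tmul p v => simpa using hrel q p v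
    rw [this, ht, TensorProduct.tmul_zero, map_zero]
  -- hence so is `T₁ (b ⊗ -)` applied to `t`
  let Θ : X ⊗[K] (X ⊗[K] V) →ₗ[K] X ⊗[K] (X ⊗[K] V) :=
    (assoc K X X V).toLinearMap ∘ₗ H.T₁.toLinearMap.rTensor V ∘ₗ (assoc K X X V).symm.toLinearMap
  have h2 : N.mkQ.lTensor X (Θ (b ⊗ₜ t)) = 0 := by
    refine rTensor_jointly_injective (fun c => m c) (fun x h => H.isAlgebra.nondeg_right x h)
      fun c => ?_
    have h3 : ∀ t, (m c).rTensor _ (N.mkQ.lTensor X (Θ (b ⊗ₜ t))) =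
        N.mkQ.lTensor X ((lift (LinearMap.rTensorHom V ∘ₗ m)).lTensor X
          (assoc K X X (X ⊗[K] V) (H.T₂ (c ⊗ₜ b) ⊗ₜ t))) := by
      intro t
      induction t using TensorProduct.induction_on with
      | zero => simp
      | add u u' hu hu' => simp only [map_add, TensorProduct.tmul_add, hu, hu']
      | tmul p v =>
        have e1 : ∀ z : X ⊗[K] X, (m c).rTensor _ (N.mkQ.lTensor X (assoc K X X V (z ⊗ₜ v))) =
            N.mkQ.lTensor X (assoc K X X V ((m c).rTensor X z ⊗ₜ v)) := by
          intro z
          induction z using TensorProduct.induction_on with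
          | zero => simp
          | add u u' hu hu' => simp only [map_add, TensorProduct.add_tmul, hu, hu']
          | tmul p v => simp
        simp only [Θ, LinearMap.comp_apply, LinearEquiv.coe_coe, TensorProduct.assoc_symm_tmul,
          LinearMap.rTensor_tmul]
        rw [e1, H.rTensor_T₁]
        generalize H.T₂ (c ⊗ₜ b) = z
        induction z using TensorProduct.induction_on with
        | zero => simp
        | add u u' hu hu' => simp only [map_add, TensorProduct.add_tmul, hu, hu']
        | tmul p v => simp
    rw [h3]
    generalize H.T₂ (c ⊗ₜ b) = z
    induction z using TensorProduct.induction_on with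
    | zero => simp
    | add u u' hu hu' => simp only [map_add, TensorProduct.add_tmul, hu, hu', add_zero]
    | tmul p q => simp [-Submodule.mkQ_apply, h1]
  -- and `T₁⁻¹` descends to the balanced tensor product
  let ν : X ⊗[K] V →ₗ[K] (X →ₗ[K] X ⊗[K] ((X ⊗[K] V) ⧸ N)) :=
    LinearMap.flip (TensorProduct.curry (N.mkQ.lTensor X ∘ₗ (assoc K X X V).toLinearMap ∘ₗ
      H.T₁.symm.toLinearMap.rTensor V ∘ₗ (assoc K X X V).symm.toLinearMap))
  have hν : N ≤ LinearMap.ker ν := by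
    refine Submodule.span_le.2 ?_
    rintro _ ⟨p, r, v, rfl⟩
    ext u
    simp only [map_sub, LinearMap.sub_apply, LinearMap.zero_apply, sub_eq_zero]
    simp only [ν, LinearMap.flip_apply, TensorProduct.curry_apply, LinearMap.comp_apply,
      LinearEquiv.coe_coe, TensorProduct.assoc_symm_tmul, LinearMap.rTensor_tmul,
      H.T₁_symm_mul_right]
    generalize H.T₁.symm (u ⊗ₜ p) = z
    induction z using TensorProduct.induction_on with
    | zero => simp
    | add u u' hu hu' => simp only [map_add, TensorProduct.add_tmul, hu, hu']
    | tmul p q => simp [-Submodule.mkQ_apply, hrel]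
  have h4 : ∀ w, lift (N.liftQ ν hν).flip (N.mkQ.lTensor X w) =
      N.mkQ.lTensor X ((assoc K X X V) (H.T₁.symm.toLinearMap.rTensor V ((assoc K X X V).symm w))) := by
    intro w
    induction w using TensorProduct.induction_on with
    | zero => simp
    | add u u' hu hu' => simp only [map_add, hu, hu']
    | tmul p q => simp [ν]
  have h5 := h4 (Θ (b ⊗ₜ t))
  rw [h2, map_zero] at h5
  simp only [Θ, LinearMap.comp_apply, LinearEquiv.coe_coe, LinearEquiv.symm_apply_apply,
    ← LinearMap.rTensor_comp_apply] at h5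
  simp only [LinearEquiv.symm_comp, LinearMap.rTensor_id, LinearMap.id_apply,
    LinearEquiv.apply_symm_apply, LinearMap.lTensor_tmul] at h5
  obtain ⟨φ, hφ⟩ := exists_dual_eq_one (K := K) hb
  have h6 := congrArg (slL _ φ) h5
  rw [map_zero, slL_tmul, hφ, one_smul] at h6
  rwa [N.mkQ_apply, eq_comm, Submodule.Quotient.mk_eq_zero] at h6

/-- A balanced map on `X ⊗ V` factors through the action. -/
lemma exists_desc (H : MultiplierHopfAlgebra m) (M : UMod m V) (f : X ⊗[K] V →ₗ[K] Z)
    (hf : ∀ p r v, f (m p r ⊗ₜ v) = f (p ⊗ₜ M.act r v)) :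
    ∃ g : V →ₗ[K] Z, ∀ x v, g (M.act x v) = f (x ⊗ₜ v) := by
  obtain ⟨σ, hσ⟩ := (lift M.act).exists_rightInverse_of_surjective (LinearMap.range_eq_top.2 M.surj)
  refine ⟨f ∘ₗ σ, fun x v => ?_⟩
  rw [LinearMap.comp_apply, ← sub_eq_zero, ← map_sub]
  refine firm H M f hf ?_
  rw [map_sub, show lift M.act (σ (M.act x v)) = M.act x v from LinearMap.congr_fun hσ _]
  simp

/-! ### The twist maps -/

/-- `T₃` as a linear bijection. -/
def _root_.Heis.RegularMHA.T₃Equiv (H : RegularMHA m) : X ⊗[K] X ≃ₗ[K] X ⊗[K] X :=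
  H.cop.T₁ ≪≫ₗ comm K X X

lemma T₃_symm_mul_right (H : RegularMHA m) (p q r : X) :
    H.T₃Equiv.symm (m p r ⊗ₜ q) = (m.flip r).lTensor X (H.T₃Equiv.symm (p ⊗ₜ q)) := by
  simpa [RegularMHA.T₃Equiv] using H.cop.T₁_symm_mul_right q p r

/-- The twist map and its inverse are balanced in the covering element, hence descend from `X ⊗ V`
to `V`. -/
lemma exists_isTwist (H : RegularMHA m) (M : UMod m V) :
    ∃ G : X ⊗[K] V ≃ₗ[K] V ⊗[K] X, IsTwist H.T₃ M.act G := by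
  -- `e ⊗ v ↦ (x ↦ x₁ e v ⊗ x₂)`
  let f : X ⊗[K] V →ₗ[K] (X →ₗ[K] V ⊗[K] X) :=
    lift (LinearMap.mk₂ K (fun e v => (M.act.flip v).rTensor X ∘ₗ H.T₃ ∘ₗ
        (TensorProduct.mk K X X).flip e)
      (fun e e' v => by ext; simp)
      (fun c e v => by ext; simp)
      (fun e v v' => by ext; simp [LinearMap.rTensor_add])
      (fun c e v => by ext; simp [LinearMap.rTensor_smul]))
  have hf : ∀ e v x, f (e ⊗ₜ v) x = (M.act.flip v).rTensor X (H.T₃ (x ⊗ₜ e)) := fun _ _ _ => rfl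
  obtain ⟨g, hg⟩ := M.exists_desc H.toMultiplierHopfAlgebra f (by
    intro p r v
    ext x
    rw [hf, hf, H.T₃_mul_right, ← LinearMap.rTensor_comp_apply]
    congr 2
    ext y
    simp [M.mul_act])
  let f' : X ⊗[K] V →ₗ[K] (X →ₗ[K] X ⊗[K] V) :=
    lift (LinearMap.mk₂ K (fun e v => (M.act.flip v).lTensor X ∘ₗ H.T₃Equiv.symm.toLinearMap ∘ₗ
        TensorProduct.mk K X X e)
      (fun e e' v => by ext; simp)
      (fun c e v => by ext; simp)
      (fun e v v' => by ext; simp [LinearMap.lTensor_add])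
      (fun c e v => by ext; simp [LinearMap.lTensor_smul]))
  have hf' : ∀ e v x, f' (e ⊗ₜ v) x = (M.act.flip v).lTensor X (H.T₃Equiv.symm (e ⊗ₜ x)) :=
    fun _ _ _ => rfl
  obtain ⟨g', hg'⟩ := M.exists_desc H.toMultiplierHopfAlgebra f' (by
    intro p r v
    ext x
    rw [hf', hf', T₃_symm_mul_right, ← LinearMap.lTensor_comp_apply]
    congr 2
    ext y
    simp [M.mul_act])
  have hT : ∀ t, H.T₃ t = H.T₃Equiv t := fun _ => rfl
  refine ⟨LinearEquiv.ofLinearMap (lift g.flip) (lift g') ?_ ?_, ?_⟩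
  · refine TensorProduct.ext' fun v x => ?_
    refine M.hom_ext (f := lift g.flip ∘ₗ lift g' ∘ₗ (TensorProduct.mk K V X).flip x)
      (g := (TensorProduct.mk K V X).flip x) (fun e v => ?_) v
    simp only [LinearMap.comp_apply, LinearMap.flip_apply, TensorProduct.mk_apply, lift.tmul, hg',
      hf']
    have : ∀ t, lift g.flip ((M.act.flip v).lTensor X t) = (M.act.flip v).rTensor X (H.T₃ t) := by
      intro t
      induction t using TensorProduct.induction_on with
      | zero => simp
      | add u u' hu hu' => simp only [map_add, hu, hu']
      | tmul p q => simp [hg, hf]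
    rw [this, hT, LinearEquiv.apply_symm_apply]
    simp
  · refine TensorProduct.ext' fun x v => ?_
    refine M.hom_ext (f := lift g' ∘ₗ lift g.flip ∘ₗ TensorProduct.mk K X V x)
      (g := TensorProduct.mk K X V x) (fun e v => ?_) v
    simp only [LinearMap.comp_apply, LinearMap.flip_apply, TensorProduct.mk_apply, lift.tmul, hg,
      hf]
    have : ∀ t, lift g' ((M.act.flip v).rTensor X t) =
        (M.act.flip v).lTensor X (H.T₃Equiv.symm t) := by
      intro t
      induction t using TensorProduct.induction_on with
      | zero => simp
      | add u u' hu hu' => simp only [map_add, hu, hu']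
      | tmul p q => simp [hg', hf']
    rw [this, hT, LinearEquiv.symm_apply_apply]
    simp
  · intro x e v
    simp [hg, hf]

/-- The twist `x ⊗ v ↦ x₁ v ⊗ x₂` of a unital module. -/
def tw (H : RegularMHA m) (M : UMod m V) : X ⊗[K] V ≃ₗ[K] V ⊗[K] X := twist H.T₃ M.act

lemma isTwist_tw (H : RegularMHA m) (M : UMod m V) : IsTwist H.T₃ M.act (M.tw H) := by
  have : Nonempty (X ⊗[K] V ≃ₗ[K] V ⊗[K] X) := ⟨comm K X V⟩
  exact Classical.epsilon_spec (p := IsTwist H.T₃ M.act) (M.exists_isTwist H)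

lemma tw_act (H : RegularMHA m) (M : UMod m V) (x e : X) (v : V) :
    M.tw H (x ⊗ₜ M.act e v) = (M.act.flip v).rTensor X (H.T₃ (x ⊗ₜ e)) :=
  M.isTwist_tw H x e v

/-- The twist map is determined by its values on covered elements. -/
lemma eq_tw (H : RegularMHA m) (M : UMod m V) {G : X ⊗[K] V →ₗ[K] V ⊗[K] X}
    (hG : ∀ x e v, G (x ⊗ₜ M.act e v) = (M.act.flip v).rTensor X (H.T₃ (x ⊗ₜ e))) :
    G = (M.tw H).toLinearMap := by
  refine TensorProduct.ext' fun x v => ?_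
  refine M.hom_ext (f := G ∘ₗ TensorProduct.mk K X V x)
    (g := (M.tw H).toLinearMap ∘ₗ TensorProduct.mk K X V x) (fun e v => ?_) v
  simp [hG, tw_act]

/-! ### Tensor products of modules -/

/-- The action of `x` on `V ⊗ W` through `Δ(x)`. -/
def diagAct (H : RegularMHA m) (M : UMod m V) (N : UMod m W) :
    X →ₗ[K] V ⊗[K] W →ₗ[K] V ⊗[K] W :=
  TensorProduct.curry ((lift N.act).lTensor V ∘ₗ (assoc K V X W).toLinearMap ∘ₗ
    (M.tw H).toLinearMap.rTensor W ∘ₗ (assoc K X V W).symm.toLinearMap)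

lemma diagAct_tmul (H : RegularMHA m) (M : UMod m V) (N : UMod m W) (x : X) (v : V) (w : W) :
    diagAct H M N x (v ⊗ₜ w) = (N.act.flip w).lTensor V (M.tw H (x ⊗ₜ v)) := by
  simp only [diagAct, TensorProduct.curry_apply, LinearMap.comp_apply, LinearEquiv.coe_coe,
    TensorProduct.assoc_symm_tmul, LinearMap.rTensor_tmul]
  generalize M.tw H (x ⊗ₜ v) = z
  induction z using TensorProduct.induction_on with
  | zero => simp
  | add u u' hu hu' => simp only [map_add, TensorProduct.add_tmul, hu, hu']
  | tmul p v => simp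

lemma diagAct_act (H : RegularMHA m) (M : UMod m V) (N : UMod m W) (x e f : X) (v : V) (w : W) :
    diagAct H M N x (M.act e v ⊗ₜ N.act f w) =
      map (M.act.flip v) (N.act.flip w) (H.L x (e ⊗ₜ f)) := by
  rw [diagAct_tmul, tw_act, H.L_tmul']
  generalize H.T₃ (x ⊗ₜ e) = z
  induction z using TensorProduct.induction_on with
  | zero => simp
  | add u u' hu hu' => simp only [map_add, hu, hu']
  | tmul p q => simp [N.mul_act]

lemma diagAct_map (H : RegularMHA m) (M : UMod m V) (N : UMod m W) (x : X) (v : V) (w : W)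
    (t : X ⊗[K] X) : diagAct H M N x (map (M.act.flip v) (N.act.flip w) t) =
      map (M.act.flip v) (N.act.flip w) (H.L x t) := by
  induction t using TensorProduct.induction_on with
  | zero => simp
  | add u u' hu hu' => simp only [map_add, hu, hu']
  | tmul p q => simpa using diagAct_act H M N x p q v w

lemma act_induction (M : UMod m V) {p : V → Prop} (hadd : ∀ v v', p v → p v' → p (v + v'))
    (hact : ∀ x v, p (M.act x v)) (v : V) : p v := by
  obtain ⟨t, rfl⟩ := M.surj v
  induction t using TensorProduct.induction_on with
  | zero => simpa using hact 0 0
  | add u u' hu hu' => rw [map_add]; exact hadd _ _ hu hu'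
  | tmul p q => simpa using hact p q

lemma hom_ext₂ (M : UMod m V) (N : UMod m W) {f g : V ⊗[K] W →ₗ[K] Z}
    (h : ∀ x v y w, f (M.act x v ⊗ₜ N.act y w) = g (M.act x v ⊗ₜ N.act y w)) : f = g := by
  refine TensorProduct.ext' fun v w => ?_
  refine M.hom_ext (f := f ∘ₗ (TensorProduct.mk K V W).flip w)
    (g := g ∘ₗ (TensorProduct.mk K V W).flip w) (fun e v => ?_) v
  exact N.hom_ext (f := f ∘ₗ TensorProduct.mk K V W _) (g := g ∘ₗ TensorProduct.mk K V W _)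
    (fun e w => h _ _ _ _) w

/-- `x₁ v ⊗ x₂ (f w) = (T₁ (x ⊗ f)) (v ⊗ w)`. -/
lemma diagAct_tmul_act (H : RegularMHA m) (M : UMod m V) (N : UMod m W) (x f : X) (v : V) (w : W) :
    diagAct H M N x (v ⊗ₜ N.act f w) = map (M.act.flip v) (N.act.flip w) (H.T₁ (x ⊗ₜ f)) := by
  refine M.act_induction (p := fun v => diagAct H M N x (v ⊗ₜ N.act f w) =
    map (M.act.flip v) (N.act.flip w) (H.T₁ (x ⊗ₜ f))) (fun v v' h h' => ?_) (fun e v => ?_) v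
  · rw [TensorProduct.add_tmul, map_add, h, h', map_add, TensorProduct.map_add_left,
      LinearMap.add_apply]
  · rw [diagAct_act, H.L_tmul]
    generalize H.T₁ (x ⊗ₜ f) = z
    induction z using TensorProduct.induction_on with
    | zero => simp
    | add u u' hu hu' => simp only [map_add, hu, hu']
    | tmul p q => simp [M.mul_act]

lemma map_flip_comm (M : UMod m V) (N : UMod m W) (v : V) (w : W) (t : X ⊗[K] X) :
    map (M.act.flip v) (N.act.flip w) (comm K X X t) =
      comm K W V (map (N.act.flip w) (M.act.flip v) t) := by
  induction t using TensorProduct.induction_on with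
  | zero => simp
  | add u u' hu hu' => simp only [map_add, hu, hu']
  | tmul p q => simp

lemma diagAct_copReg (H : RegularMHA m) (M : UMod m V) (N : UMod m W) (x : X) (t : V ⊗[K] W) :
    diagAct H.copReg N M x (comm K V W t) = comm K V W (diagAct H M N x t) := by
  refine LinearMap.congr_fun (f := diagAct H.copReg N M x ∘ₗ (comm K V W).toLinearMap)
    (g := (comm K V W).toLinearMap ∘ₗ diagAct H M N x) (hom_ext₂ M N fun e v f w => ?_) t
  simp only [LinearMap.comp_apply, LinearEquiv.coe_coe, TensorProduct.comm_tmul, diagAct_act]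
  change map _ _ (H.cop.L x _) = _
  rw [H.cop_L, map_flip_comm, TensorProduct.comm_tmul]

/-- The tensor product of two unital modules, with the action `x · (v ⊗ w) = x₁ v ⊗ x₂ w`. -/
def diag (H : RegularMHA m) (M : UMod m V) (N : UMod m W) : UMod m (V ⊗[K] W) where
  act := diagAct H M N
  mul_act x y t := by
    refine LinearMap.congr_fun (f := diagAct H M N (m x y))
      (g := diagAct H M N x ∘ₗ diagAct H M N y) (hom_ext₂ M N fun e v f w => ?_) t
    rw [LinearMap.comp_apply, diagAct_act, diagAct_act, diagAct_map, H.L_mul]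
  surj := by
    have h : ∀ (t : X ⊗[K] X) v w, map (M.act.flip v) (N.act.flip w) t ∈
        LinearMap.range (lift (diagAct H M N)) := by
      intro t v w
      obtain ⟨t, rfl⟩ := H.T₁.surjective t
      induction t using TensorProduct.induction_on with
      | zero => simp
      | add u u' hu hu' => simp only [map_add]; exact add_mem hu hu'
      | tmul p q => exact ⟨p ⊗ₜ (v ⊗ₜ N.act q w), by simp [diagAct_tmul_act]⟩
    refine LinearMap.range_eq_top.1 (top_le_iff.1 fun z _ => ?_)
    induction z using TensorProduct.induction_on with
    | zero => exact zero_mem _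
    | add u u' hu hu' => exact add_mem (hu trivial) (hu' trivial)
    | tmul v w =>
      refine M.act_induction (p := fun v => v ⊗ₜ w ∈ LinearMap.range (lift (diagAct H M N)))
        (fun v v' h h' => ?_) (fun e v => ?_) v
      · rw [TensorProduct.add_tmul]; exact add_mem h h'
      refine N.act_induction (p := fun w => M.act e v ⊗ₜ w ∈ LinearMap.range (lift (diagAct H M N)))
        (fun v v' h h' => ?_) (fun f w => ?_) w
      · rw [TensorProduct.tmul_add]; exact add_mem h h'
      · simpa using h (e ⊗ₜ f) v w

lemma diag_act (H : RegularMHA m) (M : UMod m V) (N : UMod m W) (x : X) (v : V) (w : W) :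
    (diag H M N).act x (v ⊗ₜ w) = (N.act.flip w).lTensor V (M.tw H (x ⊗ₜ v)) :=
  diagAct_tmul H M N x v w

lemma diag_act_comm (H : RegularMHA m) (M : UMod m V) (N : UMod m W) (x : X) (t : V ⊗[K] W) :
    (diag H.copReg N M).act x (comm K V W t) = comm K V W ((diag H M N).act x t) :=
  diagAct_copReg H M N x t

/-- The regular module: `X` with the left multiplication. -/
def reg (H : RegularMHA m) : UMod m X where
  act := m
  mul_act := H.isAlgebra.assoc
  surj := H.lift_mul_surjective

@[simp] lemma reg_act (H : RegularMHA m) : (reg H).act = m := rfl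

lemma tw_reg (H : RegularMHA m) (t : X ⊗[K] X) : (reg H).tw H t = H.T₃ t := by
  refine (LinearMap.congr_fun ((reg H).eq_tw H (G := H.T₃) fun x e v => ?_) t).symm
  exact H.T₃_mul_right x e v

/-- `x ⊗ w ↦ x₁ ⊗ x₂ w`. -/
def tw' (H : RegularMHA m) (N : UMod m W) : X ⊗[K] W ≃ₗ[K] X ⊗[K] W :=
  N.tw H.copReg ≪≫ₗ comm K W X

lemma _root_.Heis.RegularMHA.comm_copReg_T₃ (H : RegularMHA m) (t : X ⊗[K] X) :
    comm K X X (H.copReg.T₃ t) = H.T₁ t := by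
  rw [RegularMHA.copReg_T₃, H.copT₃_apply, TensorProduct.comm_comm]

lemma tw'_apply (H : RegularMHA m) (N : UMod m W) (t : X ⊗[K] W) :
    N.tw' H t = comm K W X (N.tw H.copReg t) := rfl

lemma diag_act' (H : RegularMHA m) (M : UMod m V) (N : UMod m W) (x : X) (v : V) (w : W) :
    (diag H M N).act x (v ⊗ₜ w) = (M.act.flip v).rTensor W (N.tw' H (x ⊗ₜ w)) := by
  have h := diag_act_comm H M N x (v ⊗ₜ w)
  rw [TensorProduct.comm_tmul, diag_act] at h
  rw [← (comm K V W).injective.eq_iff, ← h, RegularMHA.comm_rTensor, tw'_apply,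
    TensorProduct.comm_comm]

lemma tw'_reg (H : RegularMHA m) (t : X ⊗[K] X) : (reg H).tw' H t = H.T₁ t := by
  rw [tw'_apply]
  exact (congrArg (comm K X X) (tw_reg H.copReg t)).trans (H.comm_copReg_T₃ t)

/-- `x₁ v ⊗ x₂ s` for `s ∈ X`. -/
lemma lTensor_flip_tw (H : RegularMHA m) (M : UMod m V) (x s : X) (v : V) :
    (m.flip s).lTensor V (M.tw H (x ⊗ₜ v)) = (diag H M (reg H)).act x (v ⊗ₜ s) :=
  (diag_act H M (reg H) x v s).symm

lemma rTensor_flip_tw' (H : RegularMHA m) (N : UMod m W) (x s : X) (w : W) :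
    (m.flip s).rTensor W (N.tw' H (x ⊗ₜ w)) = (diag H (reg H) N).act x (s ⊗ₜ w) :=
  (diag_act' H (reg H) N x s w).symm

end UMod

lemma lTensor_rTensor_comm (g : V →ₗ[K] V') (f : W →ₗ[K] W') (t : W ⊗[K] V) :
    g.lTensor W' (f.rTensor V t) = f.rTensor V' (g.lTensor W t) := by
  rw [← LinearMap.comp_apply, ← LinearMap.comp_apply, LinearMap.lTensor_comp_rTensor,
    LinearMap.rTensor_comp_lTensor]

namespace UMod

variable {m : X →ₗ[K] X →ₗ[K] X}

/-! ### Module homomorphisms -/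

/-- Homomorphisms of unital modules. -/
def IsHom (M : UMod m V) (N : UMod m W) (f : V →ₗ[K] W) : Prop :=
  ∀ x v, f (M.act x v) = N.act x (f v)

lemma IsHom.comp {M : UMod m V} {N : UMod m W} {N' : UMod m Z} {g : W →ₗ[K] Z} {f : V →ₗ[K] W}
    (hg : IsHom N N' g) (hf : IsHom M N f) : IsHom M N' (g ∘ₗ f) := fun x v => by
  rw [LinearMap.comp_apply, hf, hg, LinearMap.comp_apply]

lemma IsHom.symm {M : UMod m V} {N : UMod m W} {e : V ≃ₗ[K] W} (h : IsHom M N e.toLinearMap) :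
    IsHom N M e.symm.toLinearMap := fun x w => by
  have h' : ∀ v, e (M.act x v) = N.act x (e v) := h x
  simp only [LinearEquiv.coe_coe]
  rw [LinearEquiv.symm_apply_eq, h', LinearEquiv.apply_symm_apply]

lemma isHom_flip_act (H : RegularMHA m) (M : UMod m V) (v : V) :
    IsHom (reg H) M (M.act.flip v) := fun x e => M.mul_act x e v

/-- Twist maps are natural. -/
lemma IsHom.tw_lTensor {H : RegularMHA m} {M : UMod m V} {N : UMod m W} {f : V →ₗ[K] W}
    (hf : IsHom M N f) (t : X ⊗[K] V) : N.tw H (f.lTensor X t) = f.rTensor X (M.tw H t) := by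
  induction t using TensorProduct.induction_on with
  | zero => simp
  | add u u' hu hu' => simp only [map_add, hu, hu']
  | tmul x v =>
    refine M.act_induction (p := fun v => N.tw H (f.lTensor X (x ⊗ₜ v)) =
      f.rTensor X (M.tw H (x ⊗ₜ v))) (fun v v' h h' => ?_) (fun e v => ?_) v
    · simp only [TensorProduct.tmul_add, map_add, h, h']
    · rw [LinearMap.lTensor_tmul, hf, tw_act, tw_act, ← LinearMap.rTensor_comp_apply]
      congr 2
      ext x
      exact (hf x v).symm

lemma IsHom.tw'_lTensor {H : RegularMHA m} {M : UMod m V} {N : UMod m W} {f : V →ₗ[K] W}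
    (hf : IsHom M N f) (t : X ⊗[K] V) : N.tw' H (f.lTensor X t) = f.lTensor X (M.tw' H t) := by
  rw [tw'_apply, hf.tw_lTensor, tw'_apply, RegularMHA.comm_rTensor]

lemma IsHom.rTensor (H : RegularMHA m) {M : UMod m V} {N : UMod m W} {f : V →ₗ[K] W}
    (hf : IsHom M N f) (M' : UMod m V') :
    IsHom (diag H M M') (diag H N M') (f.rTensor V') := by
  intro x t
  induction t using TensorProduct.induction_on with
  | zero => simp
  | add u u' hu hu' => simp only [map_add, hu, hu']
  | tmul v w =>
    rw [LinearMap.rTensor_tmul, diag_act, diag_act, ← LinearMap.lTensor_tmul, hf.tw_lTensor,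
      lTensor_rTensor_comm]

lemma IsHom.lTensor (H : RegularMHA m) {M : UMod m V} {N : UMod m W} {f : V →ₗ[K] W}
    (hf : IsHom M N f) (M' : UMod m V') :
    IsHom (diag H M' M) (diag H M' N) (f.lTensor V') := by
  intro x t
  induction t using TensorProduct.induction_on with
  | zero => simp
  | add u u' hu hu' => simp only [map_add, hu, hu']
  | tmul v w =>
    rw [LinearMap.lTensor_tmul, diag_act, diag_act, ← LinearMap.lTensor_comp_apply]
    congr 2
    ext x
    exact hf x w

lemma IsHom.map (H : RegularMHA m) {M : UMod m V} {N : UMod m W} {M' : UMod m V'} {N' : UMod m W'}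
    {f : V →ₗ[K] W} {g : V' →ₗ[K] W'} (hf : IsHom M N f) (hg : IsHom M' N' g) :
    IsHom (diag H M M') (diag H N N') (map f g) := by
  rw [← LinearMap.lTensor_comp_rTensor]
  exact (hg.lTensor H N).comp (hf.rTensor H M')

lemma hom_ext₃ (M : UMod m V) (N : UMod m W) (N' : UMod m U) {f g : (V ⊗[K] W) ⊗[K] U →ₗ[K] Z}
    (h : ∀ x v y w z u, f ((M.act x v ⊗ₜ N.act y w) ⊗ₜ N'.act z u) =
      g ((M.act x v ⊗ₜ N.act y w) ⊗ₜ N'.act z u)) : f = g := by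
  refine TensorProduct.ext' fun t u => ?_
  refine LinearMap.congr_fun (f := f ∘ₗ (TensorProduct.mk K (V ⊗[K] W) U).flip u)
    (g := g ∘ₗ (TensorProduct.mk K (V ⊗[K] W) U).flip u) (hom_ext₂ M N fun e v k w => ?_) t
  exact N'.hom_ext (f := f ∘ₗ TensorProduct.mk K _ U _) (g := g ∘ₗ TensorProduct.mk K _ U _)
    (fun e w => h _ _ _ _ _ _) u

lemma diag_reg_reg (H : RegularMHA m) (x : X) (t : X ⊗[K] X) :
    (diag H (reg H) (reg H)).act x t = H.L x t := by
  induction t using TensorProduct.induction_on with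
  | zero => simp
  | add u u' hu hu' => simp only [map_add, hu, hu']
  | tmul p q => rw [diag_act, tw_reg, H.L_tmul']; rfl

/-- `(Δ ⊗ ι)Δ(x)` and `(ι ⊗ Δ)Δ(x)` act in the same way on `X ⊗ X ⊗ X`. -/
lemma assoc_diag_reg (H : RegularMHA m) (x e f g : X) :
    assoc K X X X ((diag H (diag H (reg H) (reg H)) (reg H)).act x ((e ⊗ₜ f) ⊗ₜ g)) =
      (diag H (reg H) (diag H (reg H) (reg H))).act x (e ⊗ₜ (f ⊗ₜ g)) := by
  refine H.isAlgebra.rTensor_mul_ext fun y => ?_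
  rw [diag_act', tw'_reg, diag_act, tw_reg]
  have h1 : ∀ z : X ⊗[K] X, (m y).rTensor (X ⊗[K] X) (assoc K X X X
      (((diag H (reg H) (reg H)).act.flip (e ⊗ₜ f)).rTensor X z)) =
      map (m.flip e) ((m.flip f).rTensor X)
        (assoc K X X X (H.T₂.toLinearMap.rTensor X ((assoc K X X X).symm (y ⊗ₜ z)))) := by
    intro z
    induction z using TensorProduct.induction_on with
    | zero => simp
    | add u u' hu hu' => simp only [map_add, TensorProduct.tmul_add, hu, hu']
    | tmul p q =>
      simp only [LinearMap.rTensor_tmul, LinearMap.flip_apply, diag_reg_reg,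
        TensorProduct.assoc_symm_tmul, LinearEquiv.coe_coe]
      rw [H.L_tmul]
      have h2 : ∀ u : X ⊗[K] X, (m y).rTensor (X ⊗[K] X) (assoc K X X X
          ((m.flip e).rTensor X u ⊗ₜ q)) = (m.flip e).rTensor (X ⊗[K] X) (assoc K X X X
          ((m y).rTensor X u ⊗ₜ q)) := by
        intro u
        induction u using TensorProduct.induction_on with
        | zero => simp
        | add u u' hu hu' => simp only [map_add, TensorProduct.add_tmul, hu, hu']
        | tmul r s => simp [H.isAlgebra.assoc]
      rw [h2, H.rTensor_T₁]
      generalize H.T₂ (y ⊗ₜ p) = u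
      induction u using TensorProduct.induction_on with
      | zero => simp
      | add u u' hu hu' => simp only [map_add, TensorProduct.add_tmul, hu, hu']
      | tmul r s => simp
  have h3 : ∀ u : X ⊗[K] X, (m y).rTensor (X ⊗[K] X)
      (((diag H (reg H) (reg H)).act.flip (f ⊗ₜ g)).lTensor X u) =
      ((diag H (reg H) (reg H)).act.flip (f ⊗ₜ g)).lTensor X ((m y).rTensor X u) := by
    intro u
    induction u using TensorProduct.induction_on with
    | zero => simp
    | add u u' hu hu' => simp only [map_add, hu, hu']
    | tmul r s => simp
  rw [h1, H.coassoc, h3, H.rTensor_T₃]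
  generalize H.T₂ (y ⊗ₜ x) = u
  induction u using TensorProduct.induction_on with
  | zero => simp
  | add u u' hu hu' => simp only [map_add, TensorProduct.add_tmul, hu, hu']
  | tmul r s => simp [diag_reg_reg, H.L_tmul]

/-- Tensor products of modules are associative, since each module is covered by the regular one
through the maps `x ↦ x v`. -/
lemma isHom_assoc (H : RegularMHA m) (M : UMod m V) (N : UMod m W) (N' : UMod m U) :
    IsHom (diag H (diag H M N) N') (diag H M (diag H N N')) (assoc K V W U).toLinearMap := by
  intro x t
  refine LinearMap.congr_fun
    (f := (assoc K V W U).toLinearMap ∘ₗ (diag H (diag H M N) N').act x)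
    (g := (diag H M (diag H N N')).act x ∘ₗ (assoc K V W U).toLinearMap)
    (hom_ext₃ M N N' fun e v f w g u => ?_) t
  have hv := isHom_flip_act H M v
  have hw := isHom_flip_act H N w
  have hu := isHom_flip_act H N' u
  have h1 : (M.act e v ⊗ₜ N.act f w) ⊗ₜ[K] N'.act g u =
      map (map (M.act.flip v) (N.act.flip w)) (N'.act.flip u) ((e ⊗ₜ f) ⊗ₜ g) := rfl
  have h2 : ∀ t, assoc K V W U (map (map (M.act.flip v) (N.act.flip w)) (N'.act.flip u) t) =
      map (M.act.flip v) (map (N.act.flip w) (N'.act.flip u)) (assoc K X X X t) := fun t =>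
    (LinearMap.congr_fun (TensorProduct.map_map_comp_assoc_eq _ _ _) t).symm
  simp only [LinearMap.comp_apply, LinearEquiv.coe_coe]
  rw [h1, ← ((hv.map H hw).map H hu), h2, h2, assoc_diag_reg, hv.map H (hw.map H hu),
    TensorProduct.assoc_tmul]

end UMod

namespace UMod

variable {m : X →ₗ[K] X →ₗ[K] X}

/-! ### Identities for the twist maps -/

/-- `x₁ y₁ v ⊗ x₂ y₂`. -/
lemma tw_mul (H : RegularMHA m) (M : UMod m V) (x y : X) (v : V) :
    M.tw H (m x y ⊗ₜ v) = (lift m).lTensor V (assoc K V X X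
      (((M.tw H).toLinearMap ∘ₗ TensorProduct.mk K X V x).rTensor X (M.tw H (y ⊗ₜ v)))) := by
  refine H.isAlgebra.lTensor_flip_ext fun s => ?_
  rw [lTensor_flip_tw, UMod.mul_act, ← lTensor_flip_tw]
  generalize M.tw H (y ⊗ₜ v) = z
  induction z using TensorProduct.induction_on with
  | zero => simp
  | add u u' hu hu' => simp only [map_add, hu, hu']
  | tmul p q =>
    simp only [LinearMap.lTensor_tmul, LinearMap.flip_apply, ← lTensor_flip_tw,
      LinearMap.rTensor_tmul, LinearMap.comp_apply, TensorProduct.mk_apply, LinearEquiv.coe_coe]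
    generalize M.tw H (x ⊗ₜ p) = z
    induction z using TensorProduct.induction_on with
    | zero => simp
    | add u u' hu hu' => simp only [map_add, TensorProduct.add_tmul, hu, hu']
    | tmul r s => simp [H.isAlgebra.assoc]

/-- `x₁ v ⊗ x₂ w ⊗ x₃`. -/
lemma tw_tmul (H : RegularMHA m) (M : UMod m V) (N : UMod m W) (x : X) (v : V) (w : W) :
    (diag H M N).tw H (x ⊗ₜ (v ⊗ₜ w)) = (assoc K V W X).symm
      ((N.tw H).toLinearMap.lTensor V (assoc K V X W (M.tw H (x ⊗ₜ v) ⊗ₜ w))) := by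
  refine H.isAlgebra.lTensor_flip_ext fun s => ?_
  rw [lTensor_flip_tw, ← (assoc K V W X).injective.eq_iff]
  refine (isHom_assoc H M N (reg H) x _).trans ?_
  rw [LinearEquiv.coe_coe, TensorProduct.assoc_tmul, diag_act]
  generalize M.tw H (x ⊗ₜ v) = z
  induction z using TensorProduct.induction_on with
  | zero => simp
  | add u u' hu hu' => simp only [map_add, TensorProduct.add_tmul, hu, hu']
  | tmul p q =>
    simp only [LinearMap.lTensor_tmul, LinearMap.flip_apply, ← lTensor_flip_tw,
      TensorProduct.assoc_tmul, LinearEquiv.coe_coe]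
    generalize N.tw H (q ⊗ₜ w) = z
    induction z using TensorProduct.induction_on with
    | zero => simp
    | add u u' hu hu' => simp only [map_add, TensorProduct.tmul_add, hu, hu']
    | tmul r s => simp

/-- `x₁ v ⊗ x₂ ⊗ x₃ w`. -/
lemma tw_tw' (H : RegularMHA m) (M : UMod m V) (N : UMod m W) (x : X) (v : V) (w : W) :
    assoc K V X W (((M.tw H).toLinearMap ∘ₗ (TensorProduct.mk K X V).flip v).rTensor W
      (N.tw' H (x ⊗ₜ w))) =
    ((N.tw' H).toLinearMap ∘ₗ (TensorProduct.mk K X W).flip w).lTensor V (M.tw H (x ⊗ₜ v)) := by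
  have h := isHom_assoc H M (reg H) N x
  have h1 : ∀ (s : X) (t : V ⊗[K] (X ⊗[K] W)), ((m.flip s).rTensor W).lTensor V t =
    assoc K V X W (((m.flip s).lTensor V).rTensor W ((assoc K V X W).symm t)) := by
    intro s t
    obtain ⟨t, rfl⟩ := (assoc K V X W).surjective t
    rw [LinearEquiv.symm_apply_apply]
    exact ((LinearMap.congr_fun (TensorProduct.map_map_comp_assoc_eq LinearMap.id (m.flip s)
      LinearMap.id) t))
  refine lTensor_ext (fun s => (m.flip s).rTensor W)
    (fun t ht => H.isAlgebra.rTensor_flip_ext (t' := 0) (by simpa using ht)) fun s => ?_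
  rw [← LinearMap.lTensor_comp_apply, h1, LinearEquiv.symm_apply_apply,
    ← LinearMap.rTensor_comp_apply]
  have h2 : (m.flip s).lTensor V ∘ₗ (M.tw H).toLinearMap ∘ₗ (TensorProduct.mk K X V).flip v =
      (diag H M (reg H)).act.flip (v ⊗ₜ s) := by
    ext x
    exact lTensor_flip_tw H M x s v
  have h3 : (m.flip s).rTensor W ∘ₗ (N.tw' H).toLinearMap ∘ₗ (TensorProduct.mk K X W).flip w =
      (diag H (reg H) N).act.flip (s ⊗ₜ w) := by
    ext x
    exact rTensor_flip_tw' H N x s w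
  rw [h2, h3, ← diag_act', ← diag_act]
  exact h _

end UMod

/-! ### The adjoint module -/

lemma rTensor_lift_assoc_symm (f : X →ₗ[K] Y →ₗ[K] V) (a : X) (u : Y ⊗[K] W) :
    (lift f).rTensor W ((assoc K X Y W).symm (a ⊗ₜ u)) = (f a).rTensor W u := by
  induction u using TensorProduct.induction_on with
  | zero => simp
  | add u u' hu hu' => simp only [map_add, TensorProduct.tmul_add, hu, hu']
  | tmul p q => simp

section Adjoint

variable {m : X →ₗ[K] X →ₗ[K] X}

namespace RegularMHA

/-- The adjoint action `x, v ↦ x₁ v S(x₂)`. -/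
def adAct (H : RegularMHA m) : X →ₗ[K] X →ₗ[K] X :=
  TensorProduct.curry (lift m ∘ₗ H.antipode.toLinearMap.lTensor X ∘ₗ H.T₃)

lemma adAct_apply (H : RegularMHA m) (x v : X) :
    H.adAct x v = lift m (H.antipode.toLinearMap.lTensor X (H.T₃ (x ⊗ₜ v))) := rfl

/-- `(x₁ v S(x₂)) x₃ s = x v s`. -/
lemma lift_mul_adAct_T₁ (H : RegularMHA m) (x s v : X) :
    lift m ((H.adAct.flip v).rTensor X (H.T₁ (x ⊗ₜ s))) = m (m x v) s := by
  have h := UMod.tw_tw' H (UMod.reg H) (UMod.reg H) x v s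
  rw [UMod.tw'_reg, UMod.tw_reg] at h
  have h1 : ∀ z : X ⊗[K] X, lift m ((H.adAct.flip v).rTensor X z) =
      lift m (H.antipodeMul.lTensor X (assoc K X X X
        ((((UMod.reg H).tw H).toLinearMap ∘ₗ (TensorProduct.mk K X X).flip v).rTensor X z))) := by
    intro z
    induction z using TensorProduct.induction_on with
    | zero => simp
    | add u u' hu hu' => simp only [map_add, hu, hu']
    | tmul p q =>
      simp only [LinearMap.rTensor_tmul, LinearMap.flip_apply, lift.tmul, adAct_apply,
        LinearMap.comp_apply, LinearEquiv.coe_coe, TensorProduct.mk_apply, UMod.tw_reg]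
      generalize H.T₃ (p ⊗ₜ v) = u
      induction u using TensorProduct.induction_on with
      | zero => simp
      | add u u' hu hu' => simp only [map_add, TensorProduct.add_tmul, LinearMap.add_apply, hu, hu']
      | tmul r t => simp [H.antipodeMul_eq, H.isAlgebra.assoc]
  rw [h1, h]
  have h2 : ∀ z : X ⊗[K] X, lift m (H.antipodeMul.lTensor X
      ((((UMod.reg H).tw' H).toLinearMap ∘ₗ (TensorProduct.mk K X X).flip s).lTensor X z)) =
      m (slR X H.counit z) s := by
    intro z
    induction z using TensorProduct.induction_on with
    | zero => simp
    | add u u' hu hu' => simp only [map_add, LinearMap.add_apply, hu, hu']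
    | tmul p q => simp [UMod.tw'_reg, H.antipodeMul_T₁]
  rw [h2, H.slR_counit_T₃, lift.tmul]

lemma adAct_mul (H : RegularMHA m) (a b v : X) : H.adAct (m a b) v = H.adAct a (H.adAct b v) := by
  have h1 : ∀ x t, lift m ((H.adAct.flip v).rTensor X (H.L x t)) =
      m x (lift m ((H.adAct.flip v).rTensor X t)) := by
    intro x t
    obtain ⟨t, rfl⟩ := H.T₁.surjective t
    induction t using TensorProduct.induction_on with
    | zero => simp
    | add u u' hu hu' => simp only [map_add, hu, hu']
    | tmul p q =>
      rw [← H.T₁_mul_left, lift_mul_adAct_T₁, lift_mul_adAct_T₁]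
      simp only [H.isAlgebra.assoc]
  have h2 : ∀ t, lift m ((H.adAct.flip v).rTensor X ((m.flip b).rTensor X t)) =
      lift m ((H.adAct.flip (H.adAct b v)).rTensor X t) := by
    intro t
    obtain ⟨t, rfl⟩ := H.T₁.surjective t
    induction t using TensorProduct.induction_on with
    | zero => simp
    | add u u' hu hu' => simp only [map_add, hu, hu']
    | tmul p q =>
      rw [← H.L_tmul, h1, lift_mul_adAct_T₁]
      simp [H.isAlgebra.assoc]
  rw [← sub_eq_zero]
  refine H.isAlgebra.nondeg_left _ fun q => ?_
  rw [map_sub, LinearMap.sub_apply, sub_eq_zero]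
  simpa using h2 (a ⊗ₜ q)

end RegularMHA

namespace UMod

/-- The adjoint module: `X` with the action `x, v ↦ x₁ v S(x₂)`. -/
def ad (H : RegularMHA m) : UMod m X where
  act := H.adAct
  mul_act := H.adAct_mul
  surj := by
    have h : (⇑(lift H.adAct) : X ⊗[K] X → X) =
        ⇑(lift m) ∘ ⇑(H.antipode.lTensor X) ∘ ⇑H.T₃ := by
      funext t
      induction t using TensorProduct.induction_on with
      | zero => simp
      | add u u' hu hu' => rw [map_add, hu, hu']; simp
      | tmul p q => rfl
    rw [h]
    exact H.lift_mul_surjective.comp ((LinearEquiv.surjective _).comp H.T₃_surjective)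

/-- `(x₁ v S(x₂)) · (x₃ · n) = x · (v · n)`. -/
lemma isHom_lift_act_ad (H : RegularMHA m) (N : UMod m V) :
    IsHom (diag H (ad H) N) N (lift N.act) := by
  intro x t
  induction t using TensorProduct.induction_on with
  | zero => simp
  | add u u' hu hu' => simp only [map_add, hu, hu']
  | tmul v n =>
    refine N.act_induction (p := fun n => lift N.act ((diag H (ad H) N).act x (v ⊗ₜ n)) =
      N.act x (lift N.act (v ⊗ₜ n))) (fun v v' h h' => ?_) (fun s n => ?_) n
    · simp only [TensorProduct.tmul_add, map_add, h, h']
    have h := (isHom_flip_act H N n).lTensor H (ad H) x (v ⊗ₜ s)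
    rw [LinearMap.lTensor_tmul, LinearMap.flip_apply] at h
    rw [← h]
    have h2 : ∀ z : X ⊗[K] X, lift N.act ((N.act.flip n).lTensor X z) = N.act (lift m z) n := by
      intro z
      induction z using TensorProduct.induction_on with
      | zero => simp
      | add u u' hu hu' => simp only [map_add, LinearMap.add_apply, hu, hu']
      | tmul r t => simp [N.mul_act]
    rw [h2, diag_act', tw'_reg]
    refine (congrArg (fun y => N.act y n) (H.lift_mul_adAct_T₁ x s v)).trans ?_
    simp [N.mul_act]

/-- A map with values in `N ⊗ X` is a homomorphism for the adjoint action on `X` if it is one for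
the regular action after multiplication by elements of `X`. -/
lemma isHom_diag_ad (H : RegularMHA m) (M : UMod m V) (N : UMod m W) {f : V →ₗ[K] W ⊗[K] X}
    (hf : IsHom (diag H M (reg H)) (diag H N (reg H))
      ((lift m).lTensor W ∘ₗ (assoc K W X X).toLinearMap ∘ₗ f.rTensor X)) :
    IsHom M (diag H N (ad H)) f := by
  intro x v
  have h1 : IsHom (diag H (diag H N (ad H)) (reg H)) (diag H N (reg H))
      ((lift m).lTensor W ∘ₗ (assoc K W X X).toLinearMap) :=
    ((isHom_lift_act_ad H (reg H)).lTensor H N).comp (isHom_assoc H N (ad H) (reg H))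
  have h2 : ∀ y s, (m.flip s).lTensor W y =
      ((lift m).lTensor W ∘ₗ (assoc K W X X).toLinearMap) (y ⊗ₜ s) := by
    intro y s
    induction y using TensorProduct.induction_on with
    | zero => simp
    | add u u' hu hu' => simp only [map_add, TensorProduct.add_tmul, hu, hu']
    | tmul r t => simp
  have h3 : ∀ t : X ⊗[K] X,
      ((lift m).lTensor W ∘ₗ (assoc K W X X).toLinearMap) ((f ∘ₗ M.act.flip v).rTensor X t) =
      ((lift m).lTensor W ∘ₗ (assoc K W X X).toLinearMap)
        (((diag H N (ad H)).act.flip (f v)).rTensor X t) := by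
    intro t
    obtain ⟨t, rfl⟩ := H.T₁.surjective t
    induction t using TensorProduct.induction_on with
    | zero => simp
    | add u u' hu hu' => simp only [map_add, hu, hu']
    | tmul y s =>
      have h4 := hf y (v ⊗ₜ s)
      have h5 := h1 y (f v ⊗ₜ s)
      rw [diag_act', tw'_reg] at h4 h5
      rw [h5, LinearMap.rTensor_comp_apply]
      exact h4
  refine H.isAlgebra.lTensor_flip_ext fun s => ?_
  rw [h2, h2]
  simpa using h3 (x ⊗ₜ s)

/-- The twist map `u ⊗ v ↦ u₁ v ⊗ u₂` is a module homomorphism for the adjoint action. -/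
lemma isHom_tw_ad (H : RegularMHA m) (M : UMod m V) :
    IsHom (diag H (ad H) M) (diag H M (ad H)) (M.tw H).toLinearMap := by
  refine isHom_diag_ad H _ _ ?_
  have h := (isHom_lift_act_ad H (diag H M (reg H))).comp (isHom_assoc H (ad H) M (reg H))
  convert h using 1
  refine TensorProduct.ext_threefold fun u v s => ?_
  simp only [LinearMap.comp_apply, LinearEquiv.coe_coe, LinearMap.rTensor_tmul,
    TensorProduct.assoc_tmul, lift.tmul, ← lTensor_flip_tw]
  generalize M.tw H (u ⊗ₜ v) = z
  induction z using TensorProduct.induction_on with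
  | zero => simp
  | add u u' hu hu' => simp only [map_add, TensorProduct.add_tmul, hu, hu']
  | tmul r t => simp

/-- A map to `X` is a homomorphism for the adjoint action if it is one for the regular action after
multiplication by elements of `X`. -/
lemma isHom_of_lift_mul (H : RegularMHA m) (M : UMod m V) {f : V →ₗ[K] X}
    (hf : IsHom (diag H M (reg H)) (reg H) (lift m ∘ₗ f.rTensor X)) : IsHom M (ad H) f := by
  intro x v
  have h3 : ∀ t : X ⊗[K] X, lift m ((f ∘ₗ M.act.flip v).rTensor X t) =
      lift m (((ad H).act.flip (f v)).rTensor X t) := by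
    intro t
    obtain ⟨t, rfl⟩ := H.T₁.surjective t
    induction t using TensorProduct.induction_on with
    | zero => simp
    | add u u' hu hu' => simp only [map_add, hu, hu']
    | tmul y s =>
      have h4 := hf y (v ⊗ₜ s)
      have h5 := isHom_lift_act_ad H (reg H) y (f v ⊗ₜ s)
      rw [diag_act', tw'_reg] at h4 h5
      rw [LinearMap.rTensor_comp_apply]
      exact h4.trans h5.symm
  rw [← sub_eq_zero]
  refine H.isAlgebra.nondeg_left _ fun q => ?_
  rw [map_sub, LinearMap.sub_apply, sub_eq_zero]
  simpa using h3 (x ⊗ₜ q)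

/-- The adjoint module is a module algebra. -/
lemma isHom_lift_mul_ad (H : RegularMHA m) : IsHom (diag H (ad H) (ad H)) (ad H) (lift m) := by
  refine isHom_of_lift_mul H _ ?_
  have h := (isHom_lift_act_ad H (reg H)).comp (((isHom_lift_act_ad H (reg H)).lTensor H (ad H)).comp
    (isHom_assoc H (ad H) (ad H) (reg H)))
  convert h using 1
  refine TensorProduct.ext_threefold fun u v s => ?_
  simp [H.isAlgebra.assoc]

/-- `(x₁ v S(x₂)) x₃ ⊗ x₄ = x₁ v ⊗ x₂`. -/
lemma T₂_tw_ad (H : RegularMHA m) (t : X ⊗[K] X) : H.T₂ ((ad H).tw H t) = H.T₃ t := by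
  induction t using TensorProduct.induction_on with
  | zero => simp
  | add u u' hu hu' => simp only [map_add, hu, hu']
  | tmul x v =>
    refine H.isAlgebra.mul₂_ext_right fun w => ?_
    rw [H.mul₂_T₃]
    have h := ((isHom_lift_act_ad H (reg H)).rTensor H (reg H)).comp
      (isHom_assoc H (ad H) (reg H) (reg H)).symm x (v ⊗ₜ w)
    rw [diag_reg_reg, diag_act] at h
    simp only [LinearMap.comp_apply, LinearEquiv.coe_coe, reg_act] at h
    rw [rTensor_lift_assoc_symm] at h
    rw [← h]
    generalize (ad H).tw H (x ⊗ₜ v) = z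
    induction z using TensorProduct.induction_on with
    | zero => simp
    | add u u' hu hu' => simp only [map_add, LinearMap.add_apply, hu, hu']
    | tmul a b =>
      rw [H.T₂_spec, LinearMap.lTensor_tmul, LinearMap.flip_apply, diag_reg_reg,
        rTensor_lift_assoc_symm]

end UMod

end Adjoint

/-! ### The modules defined by a pairing -/

namespace Pairing

variable {HA : RegularMHA mA} {HB : RegularMHA mB}

/-- The pairing `⟨b, a⟩ = ⟨a, b⟩` of `B` and `A`. -/
def flip (P : Pairing HA HB) : Pairing HB HA where
  form := P.form.flip
  nondeg_left := P.nondeg_right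
  nondeg_right := P.nondeg_left
  lA := P.lB
  rA := P.rB
  lB := P.lA
  rB := P.rA
  lA_spec := P.lB_spec
  rA_spec := P.rB_spec
  lB_spec := P.lA_spec
  rB_spec := P.rA_spec
  form_mul_left b b' a := P.form_mul_right a b b'
  form_mul_right b a a' := P.form_mul_left a a' b

lemma ext_form (P : Pairing HA HB) {a a' : A} (h : ∀ b, P.form a b = P.form a' b) : a = a' := by
  rw [← sub_eq_zero]
  refine P.nondeg_left _ fun b => ?_
  rw [map_sub, LinearMap.sub_apply, h, sub_self]

lemma slR_form_ext (P : Pairing HA HB) {t t' : V ⊗[K] A}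
    (h : ∀ b, slR V (P.form.flip b) t = slR V (P.form.flip b) t') : t = t' :=
  slR_ext (fun b => P.form.flip b) P.nondeg_left h

lemma slL_form_ext (P : Pairing HA HB) {t t' : A ⊗[K] V}
    (h : ∀ b, slL V (P.form.flip b) t = slL V (P.form.flip b) t') : t = t' :=
  slL_ext (fun b => P.form.flip b) P.nondeg_left h

lemma mul_lA (P : Pairing HA HB) (b : B) (a x : A) :
    mA (P.lA b a) x = slR A (P.form.flip b) (HA.T₃ (a ⊗ₜ x)) := P.lA_spec b a x

lemma mul_rA (P : Pairing HA HB) (a : A) (b : B) (x : A) :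
    mA (P.rA a b) x = slL A (P.form.flip b) (HA.T₁ (a ⊗ₜ x)) := P.rA_spec a b x

lemma form_lA (P : Pairing HA HB) (a : A) (b c : B) :
    P.form (P.lA b a) c = P.form a (mB c b) := (P.form_mul_right a c b).1.symm

lemma form_rA (P : Pairing HA HB) (a : A) (b c : B) :
    P.form (P.rA a b) c = P.form a (mB b c) := (P.form_mul_right a b c).2.symm

lemma form_lB (P : Pairing HA HB) (a x : A) (b : B) :
    P.form a (P.lB x b) = P.form (mA a x) b := (P.form_mul_left a x b).1.symm

lemma form_rB (P : Pairing HA HB) (a x : A) (b : B) :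
    P.form a (P.rB b x) = P.form (mA x a) b := (P.form_mul_left x a b).2.symm

/-- `⟨a₂ x, b⟩ a₁ = (x ▶ b) ▶ a`. -/
lemma slR_T₁ (P : Pairing HA HB) (a x : A) (b : B) :
    slR A (P.form.flip b) (HA.T₁ (a ⊗ₜ x)) = P.lA (P.lB x b) a := by
  rw [← sub_eq_zero]
  refine HA.isAlgebra.nondeg_left _ fun y => ?_
  rw [map_sub, LinearMap.sub_apply, sub_eq_zero, mul_lA]
  have h := congrArg (slR A (P.form.flip b)) ((HA.L_tmul a y x).symm.trans (HA.L_tmul' a y x))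
  rw [slR_rTensor, slR_lTensor] at h
  refine h.trans ?_
  congr 2
  ext q
  simp [form_lB]

/-- `⟨a₁ x, b⟩ a₂ = a ◀ (x ▶ b)`. -/
lemma slL_T₃ (P : Pairing HA HB) (a x : A) (b : B) :
    slL A (P.form.flip b) (HA.T₃ (a ⊗ₜ x)) = P.rA a (P.lB x b) := by
  rw [← sub_eq_zero]
  refine HA.isAlgebra.nondeg_left _ fun y => ?_
  rw [map_sub, LinearMap.sub_apply, sub_eq_zero, mul_rA]
  have h := congrArg (slL A (P.form.flip b)) ((HA.L_tmul' a x y).symm.trans (HA.L_tmul a x y))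
  rw [slL_rTensor, slL_lTensor] at h
  refine h.trans ?_
  congr 2
  ext q
  simp [form_lB]

lemma exists_form_eq_one (P : Pairing HA HB) {a : A} (ha : a ≠ 0) : ∃ b, P.form a b = 1 := by
  by_contra h
  push Not at h
  refine ha (P.nondeg_left a fun b => ?_)
  by_contra hb
  exact h ((P.form a b)⁻¹ • b) (by simp [hb])

/-- The elements `b ▶ a` span `A`, since the elements `⟨a₂ x, b⟩ a₁` do by the surjectivity of
`T₁`. -/
lemma lift_lA_surjective (P : Pairing HA HB) : Function.Surjective (lift P.lA) := by
  intro a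
  by_cases ha : a = 0
  · exact ⟨0, by simp [ha]⟩
  obtain ⟨b, hb⟩ := P.exists_form_eq_one ha
  have h : ∀ t, slR A (P.form.flip b) (HA.T₁ t) ∈ LinearMap.range (lift P.lA) := by
    intro t
    induction t using TensorProduct.induction_on with
    | zero => simp
    | add u u' hu hu' => simp only [map_add]; exact add_mem hu hu'
    | tmul p q => exact ⟨P.lB q b ⊗ₜ p, by simp [slR_T₁]⟩
  simpa [hb] using h (HA.T₁.symm (a ⊗ₜ a))

lemma lift_rA_surjective (P : Pairing HA HB) : Function.Surjective (lift P.rA) := by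
  intro a
  by_cases ha : a = 0
  · exact ⟨0, by simp [ha]⟩
  obtain ⟨b, hb⟩ := P.exists_form_eq_one ha
  have h : ∀ t, slL A (P.form.flip b) (HA.T₃ t) ∈ LinearMap.range (lift P.rA) := by
    intro t
    induction t using TensorProduct.induction_on with
    | zero => simp
    | add u u' hu hu' => simp only [map_add]; exact add_mem hu hu'
    | tmul p q => exact ⟨p ⊗ₜ P.lB q b, by simp [slL_T₃]⟩
  obtain ⟨t, ht⟩ := HA.T₃_surjective (a ⊗ₜ a)
  simpa [hb, ht] using h t

lemma lA_mul (P : Pairing HA HB) (b b' : B) (a : A) : P.lA (mB b b') a = P.lA b (P.lA b' a) :=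
  P.ext_form fun c => by simp only [form_lA, HB.isAlgebra.assoc]

lemma rA_mul (P : Pairing HA HB) (b b' : B) (a : A) : P.rA a (mB b b') = P.rA (P.rA a b) b' :=
  P.ext_form fun c => by simp only [form_rA, HB.isAlgebra.assoc]

lemma lA_rA (P : Pairing HA HB) (b b' : B) (a : A) : P.lA b (P.rA a b') = P.rA (P.lA b a) b' :=
  P.ext_form fun c => by simp only [form_rA, form_lA, HB.isAlgebra.assoc]

/-- The `B`-module `A` with the action `b ▶ a`. -/
def leftMod (P : Pairing HA HB) : UMod mB A where
  act := P.lA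
  mul_act := P.lA_mul
  surj := P.lift_lA_surjective

/-- The `B`-module `A` with the action `a ◀ S⁻¹(b)`. -/
def rightMod (P : Pairing HA HB) : UMod mB A where
  act := P.rAinv
  mul_act x y a := by simp [rAinv, HB.antipode_symm_mul, rA_mul]
  surj := by
    have h : (⇑(lift P.rAinv) : B ⊗[K] A → A) =
        ⇑(lift P.rA) ∘ ⇑(comm K B A) ∘ ⇑(HB.antipode.symm.rTensor A) := by
      funext t
      induction t using TensorProduct.induction_on with
      | zero => simp
      | add u u' hu hu' => rw [map_add, hu, hu']; simp
      | tmul p q => simp [rAinv]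
    rw [h]
    exact P.lift_rA_surjective.comp ((LinearEquiv.surjective _).comp (LinearEquiv.surjective _))

@[simp] lemma leftMod_act (P : Pairing HA HB) : P.leftMod.act = P.lA := rfl

@[simp] lemma rightMod_act (P : Pairing HA HB) : P.rightMod.act = P.rAinv := rfl

lemma rAinv_apply (P : Pairing HA HB) (b : B) (a : A) :
    P.rAinv b a = P.rA a (HB.antipode.symm b) := rfl

lemma R_eq (P : Pairing HA HB) : P.R = P.leftMod.tw HB := rfl

lemma R'_eq (P : Pairing HA HB) : P.R' = P.rightMod.tw HB.copReg := rfl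

lemma F_eq (P : Pairing HA HB) : P.F = P.flip.rightMod.tw HA := rfl

theorem wellDefined (P : Pairing HA HB) : P.WellDefined where
  counitA := HA.isCounit_counit
  counitB := HB.isCounit_counit
  antipodeA := HA.isAntipode_antipode
  antipodeB := HB.isAntipode_antipode
  R := P.leftMod.isTwist_tw HB
  R' := P.rightMod.isTwist_tw HB.copReg
  F := P.flip.rightMod.isTwist_tw HA

/-- `⟨a₂, b⟩ a₁ v = (b ▶ a) v`. -/
lemma slR_tw (P : Pairing HA HB) (M : UMod mA V) (a : A) (b : B) (v : V) :
    slR V (P.form.flip b) (M.tw HA (a ⊗ₜ v)) = M.act (P.lA b a) v := by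
  refine M.act_induction (p := fun v => slR V (P.form.flip b) (M.tw HA (a ⊗ₜ v)) =
    M.act (P.lA b a) v) (fun v v' h h' => ?_) (fun e v => ?_) v
  · simp only [TensorProduct.tmul_add, map_add, h, h']
  · rw [UMod.tw_act, slR_rTensor, ← mul_lA, LinearMap.flip_apply, M.mul_act]

/-- `⟨a₁, b⟩ a₂ v = (a ◀ b) v`. -/
lemma slR_tw_copReg (P : Pairing HA HB) (M : UMod mA V) (a : A) (b : B) (v : V) :
    slR V (P.form.flip b) (M.tw HA.copReg (a ⊗ₜ v)) = M.act (P.rA a b) v := by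
  refine M.act_induction (p := fun v => slR V (P.form.flip b) (M.tw HA.copReg (a ⊗ₜ v)) =
    M.act (P.rA a b) v) (fun v v' h h' => ?_) (fun e v => ?_) v
  · simp only [TensorProduct.tmul_add, map_add, h, h']
  · rw [UMod.tw_act, slR_rTensor, RegularMHA.copReg_T₃, HA.copT₃_apply, slR_comm, ← mul_rA,
      LinearMap.flip_apply, M.mul_act]

/-- `(c ◀ (b₁ ▶ a)) b₂ = (c b) ◀ a`. -/
lemma lift_mul_rB_R (P : Pairing HA HB) (a : A) (b c : B) :
    lift (mB ∘ₗ P.rB c) (P.R (b ⊗ₜ a)) = P.rB (mB c b) a := by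
  refine P.leftMod.act_induction (p := fun a => lift (mB ∘ₗ P.rB c) (P.R (b ⊗ₜ a)) =
    P.rB (mB c b) a) (fun v v' h h' => ?_) (fun e a => ?_) a
  · simp only [TensorProduct.tmul_add, map_add, h, h']
  · rw [R_eq, UMod.tw_act, leftMod_act]
    have h := P.flip.slL_T₃ (mB c b) e a
    rw [HB.T₃_mul_left] at h
    refine Eq.trans ?_ h
    generalize HB.T₃ (b ⊗ₜ e) = z
    induction z using TensorProduct.induction_on with
    | zero => simp
    | add u u' hu hu' => simp only [map_add, hu, hu']
    | tmul p q =>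
      rw [HB.L_tmul', slL_lTensor, P.flip.slL_T₃]
      simp [flip]

/-- The product of `A` is a homomorphism of `B`-modules. -/
lemma isHom_lift_mul (P : Pairing HA HB) :
    UMod.IsHom (UMod.diag HB P.leftMod P.leftMod) P.leftMod (lift mA) := by
  intro b t
  induction t using TensorProduct.induction_on with
  | zero => simp
  | add u u' hu hu' => simp only [map_add, hu, hu']
  | tmul a a' =>
    refine P.ext_form fun c => ?_
    rw [UMod.diag_act, lift.tmul, leftMod_act, form_lA, ← form_rB, ← lift_mul_rB_R, R_eq]
    generalize P.leftMod.tw HB (b ⊗ₜ a) = z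
    induction z using TensorProduct.induction_on with
    | zero => simp
    | add u u' hu hu' => simp only [map_add, LinearMap.add_apply, hu, hu']
    | tmul p q => simp [form_rB, ← form_lA]

end Pairing

namespace UMod

variable {m : X →ₗ[K] X →ₗ[K] X}

/-! ### The inverse of `T₂` as a twist map -/

/-- The left module `X` with the action `e ↦ e S(x)`. -/
def antipodeMod (H : RegularMHA m) : UMod m X where
  act := m.flip ∘ₗ H.antipode.toLinearMap
  mul_act x y v := by simp [H.antipode_mul, H.isAlgebra.assoc]
  surj := by
    have h : (⇑(lift (m.flip ∘ₗ H.antipode.toLinearMap)) : X ⊗[K] X → X) =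
        ⇑(lift m) ∘ ⇑(comm K X X) ∘ ⇑(H.antipode.rTensor X) := by
      funext t
      induction t using TensorProduct.induction_on with
      | zero => simp
      | add u u' hu hu' => rw [map_add, hu, hu']; simp
      | tmul p q => simp
    rw [h]
    exact H.lift_mul_surjective.comp ((LinearEquiv.surjective _).comp (LinearEquiv.surjective _))

/-- `X` as a trivial module. -/
def triv (H : RegularMHA m) : UMod m X where
  act := LinearMap.lsmul K X ∘ₗ H.counit
  mul_act x y v := by
    simp only [LinearMap.comp_apply, H.counit_mul, LinearMap.lsmul_apply, mul_smul]
  surj v := by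
    by_cases hv : v = 0
    · exact ⟨0, by simp [hv]⟩
    obtain ⟨e, he⟩ := H.exists_counit_eq_one hv
    exact ⟨e ⊗ₜ v, by simp [he]⟩

lemma isHom_lift_mul_triv (H : RegularMHA m) :
    IsHom (diag H (antipodeMod H) (reg H)) (triv H) (lift m) := by
  intro x t
  induction t using TensorProduct.induction_on with
  | zero => simp
  | add u u' hu hu' => simp only [map_add, hu, hu']
  | tmul e s =>
    rw [diag_act', tw'_reg]
    have h : ∀ t, lift m (((antipodeMod H).act.flip e).rTensor X t) = m e (H.antipodeMul t) := by
      intro t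
      induction t using TensorProduct.induction_on with
      | zero => simp
      | add u u' hu hu' => simp only [map_add, hu, hu']
      | tmul p q => simp [antipodeMod, H.antipodeMul_eq, H.isAlgebra.assoc]
    rw [h, H.antipodeMul_T₁]
    simp [triv]

/-- `e S(x₁) x₂ ⊗ x₃ = e ⊗ x`. -/
lemma T₂_tw_antipodeMod (H : RegularMHA m) (x e : X) :
    H.T₂ ((antipodeMod H).tw H (x ⊗ₜ e)) = e ⊗ₜ x := by
  refine H.isAlgebra.mul₂_ext_right fun w => ?_
  have h := ((isHom_lift_mul_triv H).rTensor H (reg H)).comp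
    (isHom_assoc H (antipodeMod H) (reg H) (reg H)).symm x (e ⊗ₜ w)
  rw [diag_act] at h
  simp only [LinearMap.comp_apply, LinearEquiv.coe_coe] at h
  rw [rTensor_lift_assoc_symm] at h
  have h1 : ∀ w : X ⊗[K] X, (diag H (triv H) (reg H)).act x w = (m x).lTensor X w := by
    intro w
    induction w using TensorProduct.induction_on with
    | zero => simp
    | add u u' hu hu' => simp only [map_add, hu, hu']
    | tmul p q =>
      rw [diag_act', tw'_reg]
      have h2 : ∀ t, ((triv H).act.flip p).rTensor X t = p ⊗ₜ slL X H.counit t := by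
        intro t
        induction t using TensorProduct.induction_on with
        | zero => simp
        | add u u' hu hu' => simp only [map_add, TensorProduct.tmul_add, hu, hu']
        | tmul p q => simp [triv, TensorProduct.smul_tmul]
      rw [h2, H.slL_counit_T₁]
      simp
  rw [mul₂_tmul_left, ← lTensor_rTensor_comm, ← h1, ← h]
  generalize (antipodeMod H).tw H (x ⊗ₜ e) = z
  induction z using TensorProduct.induction_on with
  | zero => simp
  | add u u' hu hu' => simp only [map_add, LinearMap.add_apply, hu, hu']
  | tmul a b =>
    rw [H.T₂_spec, LinearMap.lTensor_tmul, LinearMap.flip_apply, diag_reg_reg,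
      rTensor_lift_assoc_symm]

/-! ### Commuting actions -/

/-- The twist maps `x ⊗ v ↦ x₁ v ⊗ x₂` and `x ⊗ v ↦ x₂ v ⊗ x₁` of commuting actions commute. -/
lemma tw_copReg_comm_tw (H : RegularMHA m) (M N : UMod m V)
    (hMN : ∀ x y v, M.act x (N.act y v) = N.act y (M.act x v)) (t : X ⊗[K] V) :
    N.tw H.copReg (comm K V X (M.tw H t)) = M.tw H (comm K V X (N.tw H.copReg t)) := by
  induction t using TensorProduct.induction_on with
  | zero => simp
  | add u u' hu hu' => simp only [map_add, hu, hu']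
  | tmul x v =>
    refine M.act_induction (p := fun v => N.tw H.copReg (comm K V X (M.tw H (x ⊗ₜ v))) =
      M.tw H (comm K V X (N.tw H.copReg (x ⊗ₜ v)))) (fun v v' h h' => ?_) (fun e v => ?_) v
    · simp only [TensorProduct.tmul_add, map_add, h, h']
    refine N.act_induction (p := fun v => N.tw H.copReg (comm K V X (M.tw H (x ⊗ₜ M.act e v))) =
      M.tw H (comm K V X (N.tw H.copReg (x ⊗ₜ M.act e v))))
      (fun v v' h h' => ?_) (fun f v => ?_) v
    · simp only [TensorProduct.tmul_add, map_add, h, h']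
    -- `x₁ e f' v ⊗ x₂`, where `f'` stands for the second action
    let κ : X ⊗[K] (X ⊗[K] X) →ₗ[K] V ⊗[K] X :=
      ((lift (LinearMap.compl₁₂ (LinearMap.llcomp K V V V) M.act N.act)).flip v).rTensor X
        ∘ₗ (rightComm K X X X).toLinearMap ∘ₗ (assoc K X X X).symm.toLinearMap
    have h := congrArg κ (tw_tw' H (reg H) (reg H) x e f)
    rw [tw_reg, tw'_reg] at h
    rw [tw_act, hMN, tw_act]
    have h1 : ∀ z : X ⊗[K] X, N.tw H.copReg (comm K V X ((M.act.flip (N.act f v)).rTensor X z)) =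
        κ ((((reg H).tw' H).toLinearMap ∘ₗ (TensorProduct.mk K X X).flip f).lTensor X z) := by
      intro z
      induction z using TensorProduct.induction_on with
      | zero => simp
      | add u u' hu hu' => simp only [map_add, hu, hu']
      | tmul p q =>
        simp only [LinearMap.rTensor_tmul, LinearMap.flip_apply, hMN, TensorProduct.comm_tmul,
          tw_act, LinearMap.lTensor_tmul, LinearMap.comp_apply, TensorProduct.mk_apply,
          LinearEquiv.coe_coe, tw'_reg]
        rw [← H.comm_copReg_T₃]
        generalize H.copReg.T₃ (q ⊗ₜ f) = z
        induction z using TensorProduct.induction_on with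
        | zero => simp
        | add u u' hu hu' => simp only [map_add, TensorProduct.tmul_add, hu, hu']
        | tmul r s => simp [κ, hMN]
    have h2 : ∀ z : X ⊗[K] X, M.tw H (comm K V X ((N.act.flip (M.act e v)).rTensor X z)) =
        κ (assoc K X X X ((((reg H).tw H).toLinearMap ∘ₗ (TensorProduct.mk K X X).flip e).rTensor X
          (comm K X X z))) := by
      intro z
      induction z using TensorProduct.induction_on with
      | zero => simp
      | add u u' hu hu' => simp only [map_add, hu, hu']
      | tmul p q =>
        simp only [LinearMap.rTensor_tmul, LinearMap.flip_apply, ← hMN, TensorProduct.comm_tmul,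
          tw_act, LinearMap.comp_apply, TensorProduct.mk_apply,
          LinearEquiv.coe_coe, tw_reg]
        generalize H.T₃ (q ⊗ₜ e) = z
        induction z using TensorProduct.induction_on with
        | zero => simp
        | add u u' hu hu' => simp only [map_add, TensorProduct.add_tmul, hu, hu']
        | tmul r s => simp [κ]
    rw [h1, ← h, h2, H.comm_copReg_T₃]

end UMod

/-! ### Duality of the counit and the antipode -/

namespace RegularMHA

variable {m : X →ₗ[K] X →ₗ[K] X}

lemma slR_counit_T₁ (H : RegularMHA m) (a x : X) :
    slR X H.counit (H.T₁ (a ⊗ₜ x)) = H.counit x • a := by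
  rw [← sub_eq_zero]
  refine H.isAlgebra.nondeg_left _ fun y => ?_
  rw [map_sub, LinearMap.sub_apply, sub_eq_zero]
  have h := congrArg (slR X H.counit) ((H.L_tmul a y x).symm.trans (H.L_tmul' a y x))
  rw [slR_rTensor, slR_lTensor] at h
  refine h.trans ?_
  have : H.counit ∘ₗ m.flip x = H.counit x • H.counit := by
    ext q; simp [H.counit_mul, mul_comm]
  rw [this]
  have h2 : ∀ t : X ⊗[K] X, slR X (H.counit x • H.counit) t = H.counit x • slR X H.counit t := by
    intro t
    induction t using TensorProduct.induction_on with
    | zero => simp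
    | add u u' hu hu' => simp only [map_add, smul_add, hu, hu']
    | tmul p q => simp [mul_smul]
  rw [h2, H.slR_counit_T₃]
  simp

end RegularMHA

namespace Pairing

variable {HA : RegularMHA mA} {HB : RegularMHA mB}

/-- `ε(a ◀ b) = ⟨a, b⟩`. -/
lemma counit_rA (P : Pairing HA HB) (a : A) (b : B) : HA.counit (P.rA a b) = P.form a b := by
  by_cases ha : a = 0
  · simp [ha]
  obtain ⟨e, he⟩ := HA.exists_counit_eq_one ha
  have h := congrArg HA.counit (P.mul_rA a b e)
  have h2 : ∀ t, HA.counit (slL A (P.form.flip b) t) = P.form (slR A HA.counit t) b := by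
    intro t
    induction t using TensorProduct.induction_on with
    | zero => simp
    | add u u' hu hu' => simp only [map_add, LinearMap.add_apply, hu, hu']
    | tmul p q => simp [mul_comm]
  rwa [HA.counit_mul, h2, HA.slR_counit_T₁, he, mul_one, one_smul] at h

lemma slL_counit_T₃ (HA : RegularMHA mA) (a x : A) :
    slL A HA.counit (HA.T₃ (a ⊗ₜ x)) = HA.counit x • a := by
  have h := HA.copReg.slR_counit_T₁ a x
  rw [HA.counit_copReg] at h
  rw [HA.T₃_apply, slL_comm]
  exact h

lemma counit_lA (P : Pairing HA HB) (a : A) (b : B) : HA.counit (P.lA b a) = P.form a b := by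
  by_cases ha : a = 0
  · simp [ha]
  obtain ⟨e, he⟩ := HA.exists_counit_eq_one ha
  have h := congrArg HA.counit (P.mul_lA b a e)
  have h2 : ∀ t, HA.counit (slR A (P.form.flip b) t) = P.form (slL A HA.counit t) b := by
    intro t
    induction t using TensorProduct.induction_on with
    | zero => simp
    | add u u' hu hu' => simp only [map_add, LinearMap.add_apply, hu, hu']
    | tmul p q => simp [mul_comm]
  rwa [HA.counit_mul, h2, slL_counit_T₃, he, mul_one, one_smul] at h

lemma T₁_rA (P : Pairing HA HB) (a x : A) (b : B) :
    HA.T₁ (P.rA a b ⊗ₜ x) = (P.rA.flip b).rTensor A (HA.T₁ (a ⊗ₜ x)) := by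
  refine P.slL_form_ext fun c => ?_
  rw [← mul_rA, slL_rTensor, ← P.rA_mul, mul_rA]
  congr 2
  ext p
  simp [form_rA]

/-- `⟨a₂, c⟩ x a₁ = x (c ▶ a)`. -/
lemma slR_T₂ (P : Pairing HA HB) (x a : A) (c : B) :
    slR A (P.form.flip c) (HA.T₂ (x ⊗ₜ a)) = mA x (P.lA c a) := by
  rw [← sub_eq_zero]
  refine HA.isAlgebra.nondeg_left _ fun z => ?_
  have h := congrArg (slR A (P.form.flip c)) (HA.rTensor_T₃ a x z)
  rw [slR_rTensor, slR_rTensor, ← mul_lA] at h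
  rw [map_sub, LinearMap.sub_apply, sub_eq_zero, HA.isAlgebra.assoc, h, LinearMap.flip_apply]

/-- `⟨x a₂, b⟩ a₁ = (b ◀ x) ▶ a`. -/
lemma slL_cop_T₂ (P : Pairing HA HB) (x a : A) (b : B) :
    slL A (P.form.flip b) (HA.cop.T₂ (x ⊗ₜ a)) = P.lA (P.rB b x) a := by
  rw [← sub_eq_zero]
  refine HA.isAlgebra.nondeg_left _ fun y => ?_
  rw [map_sub, LinearMap.sub_apply, sub_eq_zero, mul_lA, HA.T₃_apply, slR_comm]
  have h := congrArg (slL A (P.form.flip b)) (HA.cop.rTensor_T₁ a x y)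
  rw [slL_rTensor, slL_lTensor] at h
  refine h.symm.trans ?_
  congr 2
  ext p
  simp [form_rB]

lemma T₂_lA (P : Pairing HA HB) (x a : A) (b : B) :
    HA.T₂ (x ⊗ₜ P.lA b a) = (P.lA b).lTensor A (HA.T₂ (x ⊗ₜ a)) := by
  refine P.slR_form_ext fun c => ?_
  rw [slR_T₂, slR_lTensor, ← P.lA_mul, ← slR_T₂]
  congr 2
  ext p
  simp [form_lA]

/-- `⟨a₁, b⟩ S(a₂) x = S(a ◀ b) x`. -/
lemma slL_T₁_symm (P : Pairing HA HB) (a x : A) (b : B) :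
    slL A (P.form.flip b) (HA.T₁.symm (a ⊗ₜ x)) = mA (HA.antipode (P.rA a b)) x := by
  have h : ∀ t, slL A (P.form.flip b) t =
      HA.antipodeMul ((P.rA.flip b).rTensor A (HA.T₁ t)) := by
    intro t
    induction t using TensorProduct.induction_on with
    | zero => simp
    | add u u' hu hu' => simp only [map_add, hu, hu']
    | tmul p q => rw [← T₁_rA, HA.antipodeMul_T₁, slL_tmul, slL_tmul, counit_rA]; rfl
  rw [h, LinearEquiv.apply_symm_apply]
  simp [HA.antipodeMul_eq]

/-- `⟨a₂, b⟩ x S(a₁) = x S(b ▶ a)`. -/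
lemma slR_T₂_symm (P : Pairing HA HB) (x a : A) (b : B) :
    slR A (P.form.flip b) (HA.T₂.symm (x ⊗ₜ a)) = mA x (HA.antipode (P.lA b a)) := by
  have h : ∀ t, slR A (P.form.flip b) t =
      lift mA (HA.antipode.toLinearMap.lTensor A ((P.lA b).lTensor A (HA.T₂ t))) := by
    intro t
    induction t using TensorProduct.induction_on with
    | zero => simp
    | add u u' hu hu' => simp only [map_add, hu, hu']
    | tmul p q =>
      rw [← T₂_lA, (HA.isAntipode_antipode p _).2, slR_tmul, counit_lA]; rfl
  rw [h, LinearEquiv.apply_symm_apply]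
  simp

/-- The pairing of `A ⊗ A` and `B ⊗ B`. -/
def form₂ (P : Pairing HA HB) : A ⊗[K] A →ₗ[K] B ⊗[K] B →ₗ[K] K :=
  (TensorProduct.map₂ P.form P.form).compr₂ (TensorProduct.lid K K).toLinearMap

lemma form₂_tmul_left (P : Pairing HA HB) (a x : A) (u : B ⊗[K] B) :
    P.form₂ (a ⊗ₜ x) u = P.form a (slR B (P.form x) u) := by
  induction u using TensorProduct.induction_on with
  | zero => simp
  | add u u' hu hu' => simp only [map_add, hu, hu']
  | tmul p q => simp [form₂, mul_comm]

lemma form₂_tmul_right (P : Pairing HA HB) (t : A ⊗[K] A) (b c : B) :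
    P.form₂ t (b ⊗ₜ c) = P.form (slL A (P.form.flip b) t) c := by
  induction t using TensorProduct.induction_on with
  | zero => simp
  | add u u' hu hu' => simp only [map_add, LinearMap.add_apply, hu, hu']
  | tmul p q => simp [form₂]

lemma form₂_tmul_right' (P : Pairing HA HB) (t : A ⊗[K] A) (b c : B) :
    P.form₂ t (b ⊗ₜ c) = P.form (slR A (P.form.flip c) t) b := by
  induction t using TensorProduct.induction_on with
  | zero => simp
  | add u u' hu hu' => simp only [map_add, LinearMap.add_apply, hu, hu']
  | tmul p q => simp [form₂, mul_comm]

/-- `T₁` for `A` and `T₂` for `B` are transposes of each other. -/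
lemma form₂_T₁ (P : Pairing HA HB) (t : A ⊗[K] A) (u : B ⊗[K] B) :
    P.form₂ (HA.T₁ t) u = P.form₂ t (HB.T₂ u) := by
  induction t using TensorProduct.induction_on with
  | zero => simp
  | add t t' ht ht' => simp only [map_add, LinearMap.add_apply, ht, ht']
  | tmul a x =>
    induction u using TensorProduct.induction_on with
    | zero => simp
    | add u u' hu hu' => simp only [map_add, hu, hu']
    | tmul b c =>
      rw [form₂_tmul_right', slR_T₁, form₂_tmul_left, form_lA]
      exact congrArg (P.form a) (P.flip.slR_T₂ b c x).symm

/-- The antipodes are dual to each other. On elements `a ◀ b` and `x ▶ c`, both sides are values of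
the pairing of `A ⊗ A` and `B ⊗ B` involving `T₁⁻¹` and `T₂⁻¹`, which are transposes. -/
lemma form_antipode (P : Pairing HA HB) (a : A) (b : B) :
    P.form (HA.antipode a) b = P.form a (HB.antipode b) := by
  have h1 : ∀ a b x c, P.form (HA.antipode (P.rA a b)) (P.lB x c) =
      P.form (P.rA a b) (HB.antipode (P.lB x c)) := by
    intro a b x c
    rw [form_lB, ← slL_T₁_symm, ← form₂_tmul_right, form_rA]
    have h := form₂_T₁ P (HA.T₁.symm (a ⊗ₜ x)) (HB.T₂.symm (b ⊗ₜ c))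
    rw [LinearEquiv.apply_symm_apply, LinearEquiv.apply_symm_apply, form₂_tmul_left] at h
    rw [← h]
    exact congrArg (P.form a) (P.flip.slR_T₂_symm b c x)
  obtain ⟨t, rfl⟩ := P.lift_rA_surjective a
  induction t using TensorProduct.induction_on with
  | zero => simp
  | add u u' hu hu' => simp only [map_add, LinearMap.add_apply, hu, hu']
  | tmul a b' =>
    refine P.flip.leftMod.act_induction (p := fun b => P.form (HA.antipode (lift P.rA (a ⊗ₜ b'))) b =
      P.form (lift P.rA (a ⊗ₜ b')) (HB.antipode b)) (fun v v' h h' => ?_) (fun e v => ?_) b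
    · simp only [map_add, h, h']
    · exact h1 a b' e v

lemma form_antipode_symm (P : Pairing HA HB) (a : A) (b : B) :
    P.form (HA.antipode.symm a) b = P.form a (HB.antipode.symm b) := by
  have h := P.form_antipode (HA.antipode.symm a) (HB.antipode.symm b)
  rw [LinearEquiv.apply_symm_apply, LinearEquiv.apply_symm_apply] at h
  exact h.symm

/-! ### The pairing of the co-opposites -/

/-- The pairing `⟨b, a⟩ = ⟨S⁻¹(a), b⟩` of `(B, Δᶜᵒᵖ)` and `(A, Δᶜᵒᵖ)`. It exchanges the action
`a ▶ b` with `b ◀ S⁻¹(a)`, and the maps `R` and `T` with their inverses. -/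
def tilde (P : Pairing HA HB) : Pairing HB.copReg HA.copReg where
  form := P.form.flip.compl₂ HA.antipode.symm.toLinearMap
  nondeg_left b h := P.nondeg_right b fun a => by simpa using h (HA.antipode a)
  nondeg_right a h := by
    simpa using P.nondeg_left (HA.antipode.symm a) fun b => by simpa using h b
  lA := P.rBinv
  rA := P.lB.flip.compl₂ HA.antipode.symm.toLinearMap
  lB := P.rAinv
  rB := P.lA.flip.compl₂ HB.antipode.symm.toLinearMap
  lA_spec a b b' := by
    refine (P.rB_spec b (HA.antipode.symm a) b').trans ?_
    rw [RegularMHA.copReg_T₃, HB.copT₃_apply]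
    exact (slR_comm _ _).symm
  rA_spec b a b' := by
    refine (P.lB_spec (HA.antipode.symm a) b b').trans ?_
    exact slR_comm _ _
  lB_spec b a a' := by
    refine (P.rA_spec a (HB.antipode.symm b) a').trans ?_
    rw [RegularMHA.copReg_T₃, HA.copT₃_apply]
    refine Eq.trans (congrArg (fun φ => slL A φ (HA.T₁ (a ⊗ₜ a'))) (LinearMap.ext fun x => ?_))
      (slR_comm _ _).symm
    simp [form_antipode_symm]
  rB_spec a b a' := by
    refine (P.lA_spec (HB.antipode.symm b) a a').trans ?_
    refine (slR_comm _ _).trans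
      (congrArg (fun φ => slL A φ (HA.cop.T₁ (a ⊗ₜ a'))) (LinearMap.ext fun x => ?_))
    simp [form_antipode_symm]
  form_mul_left b b' a := by
    simp [form_antipode_symm, rAinv, form_rA, form_lA, HB.antipode_symm_mul]
  form_mul_right b a a' := by
    simp [rBinv, form_rB, form_lB, HA.antipode_symm_mul]

lemma tilde_rightMod (P : Pairing HA HB) : P.tilde.rightMod = P.flip.leftMod := by
  have h : P.tilde.rAinv = P.lB := by
    ext a b
    simp [rAinv, tilde, HA.antipode_copReg]
  simp only [rightMod, leftMod, h]
  rfl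

/-! ### The inverses of `R`, `R'` and `T` -/

/-- `(b ◀ S⁻¹(a₂)) ▶ a₁ = ε(b) a`. -/
lemma lift_lA_tw (P : Pairing HA HB) (a : A) (b : B) :
    lift P.lA (P.flip.rightMod.tw HA.copReg (a ⊗ₜ b)) = HB.counit b • a := by
  obtain ⟨t, rfl⟩ := P.flip.lift_rA_surjective b
  induction t using TensorProduct.induction_on with
  | zero => simp
  | add u u' hu hu' => simp only [map_add, TensorProduct.tmul_add, add_smul, hu, hu']
  | tmul b e =>
    have h1 : UMod.IsHom (UMod.antipodeMod HA.copReg) P.flip.rightMod (P.rB b) := fun x e => by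
      simp only [UMod.antipodeMod, HA.antipode_copReg, rightMod_act, rAinv_apply]
      exact P.flip.rA_mul e (HA.antipode.symm x) b
    have h2 := UMod.T₂_tw_antipodeMod HA.copReg a e
    have h3 := h1.tw_lTensor (H := HA.copReg) (a ⊗ₜ e)
    rw [lift.tmul, P.flip.counit_rA]
    rw [LinearMap.lTensor_tmul] at h3
    refine (congrArg _ h3).trans ?_
    have h4 : ∀ t, lift P.lA ((P.rB b).rTensor A t) = slL A (P.form.flip b) (HA.cop.T₂ t) := by
      intro t
      induction t using TensorProduct.induction_on with
      | zero => simp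
      | add u u' hu hu' => simp only [map_add, hu, hu']
      | tmul x y => rw [slL_cop_T₂]; simp
    rw [h4]
    exact (congrArg _ h2).trans (by simp [flip])

/-- The inverse of `R` is `a ⊗ b ↦ b ◀ S⁻¹(a₂) ⊗ a₁`. This reduces to `lift_lA_tw` by pairing
the second leg with `x ∈ A`, as `x ▶` commutes with the action `b ◀ S⁻¹(a)`. -/
lemma R_tw (P : Pairing HA HB) (a : A) (b : B) :
    P.R (P.flip.rightMod.tw HA.copReg (a ⊗ₜ b)) = a ⊗ₜ b := by
  refine P.flip.slR_form_ext fun x => ?_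
  have h1 : UMod.IsHom P.flip.rightMod P.flip.rightMod (P.lB x) := fun y b =>
    P.flip.lA_rA _ _ _
  have h2 := h1.tw_lTensor (H := HA.copReg) (a ⊗ₜ b)
  rw [LinearMap.lTensor_tmul] at h2
  have h3 := P.lift_lA_tw a (P.lB x b)
  rw [h2] at h3
  refine Eq.trans ?_ (h3.trans ?_)
  · generalize P.flip.rightMod.tw HA.copReg (a ⊗ₜ b) = z
    induction z using TensorProduct.induction_on with
    | zero => simp
    | add u u' hu hu' => simp only [map_add, hu, hu']
    | tmul x y => rw [R_eq, P.flip.slR_tw]; rfl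
  · rw [slR_tmul]
    exact congrArg (· • a) (P.flip.counit_lA b x)

lemma R_symm (P : Pairing HA HB) : P.R.symm = P.flip.rightMod.tw HA.copReg := by
  refine LinearEquiv.toLinearMap_injective (TensorProduct.ext' fun a b => ?_)
  simp only [LinearEquiv.coe_coe]
  rw [LinearEquiv.symm_apply_eq, R_tw]

lemma tilde_R (P : Pairing HA HB) : P.tilde.R = P.R.symm := P.R_symm.symm

lemma flip_R_symm (P : Pairing HA HB) : P.flip.R.symm = P.R' := P.flip.R_symm

lemma tilde_R' (P : Pairing HA HB) : P.tilde.R' = P.R'.symm := by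
  rw [← flip_R_symm P, LinearEquiv.symm_symm, R'_eq, tilde_rightMod]
  rfl

/-- The actions `b ▶ a` and `a ◀ S⁻¹(b)` commute, so `T` may apply them in either order. -/
lemma T_eq (P : Pairing HA HB) : P.T = P.R' ≪≫ₗ comm K A B ≪≫ₗ P.R := by
  refine LinearEquiv.ext fun t => ?_
  refine UMod.tw_copReg_comm_tw HB P.leftMod P.rightMod (fun x y v => ?_) t
  exact P.lA_rA _ _ _

lemma tilde_T (P : Pairing HA HB) : P.tilde.T = P.T.symm := by
  rw [T_eq, T, tilde_R, tilde_R']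
  rfl

end Pairing

/-! ### Twisted tensor products of algebras -/

section Twisted

variable {mX : X →ₗ[K] X →ₗ[K] X} {mV : V →ₗ[K] V →ₗ[K] V}

/-- `τ (v v' ⊗ x) = τ (v ⊗ xᵢ) (1 ⊗ vᵢ)`, where `τ (v' ⊗ x) = ∑ xᵢ ⊗ vᵢ`. -/
def HexagonLeft (mV : V →ₗ[K] V →ₗ[K] V) (τ : V ⊗[K] X →ₗ[K] X ⊗[K] V) : Prop :=
  ∀ v v' x, τ (mV v v' ⊗ₜ x) = (lift mV).lTensor X (assoc K X V V
    ((τ ∘ₗ TensorProduct.mk K V X v).rTensor V (τ (v' ⊗ₜ x))))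

/-- `τ (v ⊗ x x') = (xᵢ ⊗ 1) τ (vᵢ ⊗ x')`, where `τ (v ⊗ x) = ∑ xᵢ ⊗ vᵢ`. -/
def HexagonRight (mX : X →ₗ[K] X →ₗ[K] X) (τ : V ⊗[K] X →ₗ[K] X ⊗[K] V) : Prop :=
  ∀ v x x', τ (v ⊗ₜ mX x x') = (lift mX).rTensor V ((assoc K X X V).symm
    ((τ ∘ₗ (TensorProduct.mk K V X).flip x').lTensor X (τ (v ⊗ₜ x))))

lemma twistedMul_tmul (τ : V ⊗[K] X →ₗ[K] X ⊗[K] V) (x x' : X) (v v' : V) :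
    twistedMul mX mV τ (x ⊗ₜ v) (x' ⊗ₜ v') = map (mX x) (mV.flip v') (τ (v ⊗ₜ x')) := by
  simp only [twistedMul, TensorProduct.curry_apply, LinearMap.comp_apply, LinearEquiv.coe_coe,
    TensorProduct.assoc_tmul, LinearMap.lTensor_tmul, TensorProduct.assoc_symm_tmul,
    LinearMap.rTensor_tmul]
  generalize τ (v ⊗ₜ x') = z
  induction z using TensorProduct.induction_on with
  | zero => simp
  | add u u' hu hu' => simp only [map_add, TensorProduct.add_tmul, TensorProduct.tmul_add, hu, hu']
  | tmul p q => simp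

lemma twistedMul_assoc (hX : IsAlgebra mX) (hV : IsAlgebra mV) {τ : V ⊗[K] X →ₗ[K] X ⊗[K] V}
    (hl : HexagonLeft mV τ) (hr : HexagonRight mX τ) (x x' x'' : X) (v v' v'' : V) :
    twistedMul mX mV τ (twistedMul mX mV τ (x ⊗ₜ v) (x' ⊗ₜ v')) (x'' ⊗ₜ v'') =
      twistedMul mX mV τ (x ⊗ₜ v) (twistedMul mX mV τ (x' ⊗ₜ v') (x'' ⊗ₜ v'')) := by
  rw [twistedMul_tmul, twistedMul_tmul]
  have h1 : ∀ w : X ⊗[K] V, twistedMul mX mV τ (x ⊗ₜ v) (map (mX x') (mV.flip v'') w) =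
      map (mX x) (lift mV) (assoc K X V V ((τ ∘ₗ (TensorProduct.mk K V X v) ∘ₗ mX x').rTensor V
        ((mV.flip v'').lTensor X w))) := by
    intro w
    induction w using TensorProduct.induction_on with
    | zero => simp
    | add u u' hu hu' => simp only [map_add, hu, hu']
    | tmul r s =>
      simp only [TensorProduct.map_tmul, twistedMul_tmul, LinearMap.flip_apply,
        LinearMap.lTensor_tmul, LinearMap.rTensor_tmul, LinearMap.comp_apply,
        TensorProduct.mk_apply]
      generalize τ (v ⊗ₜ mX x' r) = z
      induction z using TensorProduct.induction_on with
      | zero => simp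
      | add u u' hu hu' => simp only [map_add, TensorProduct.add_tmul, hu, hu']
      | tmul p q => simp
  rw [h1]
  -- both sides are `x p τ (q ⊗ r) (s v'')` with `p ⊗ q = τ (v ⊗ x')` and `r ⊗ s = τ (v' ⊗ x'')`
  have h3 : ∀ z : X ⊗[K] V, twistedMul mX mV τ (map (mX x) (mV.flip v') z) (x'' ⊗ₜ v'') =
      twistedMul mX mV τ (map (mX x) LinearMap.id z) ((mV.flip v'').lTensor X (τ (v' ⊗ₜ x''))) := by
    intro z
    induction z using TensorProduct.induction_on with
    | zero => simp
    | add u u' hu hu' => simp only [map_add, LinearMap.add_apply, hu, hu']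
    | tmul p q =>
      simp only [TensorProduct.map_tmul, LinearMap.flip_apply, twistedMul_tmul, LinearMap.id_apply,
        hl q v' x'']
      generalize τ (v' ⊗ₜ x'') = w
      induction w using TensorProduct.induction_on with
      | zero => simp
      | add u u' hu hu' => simp only [map_add, hu, hu']
      | tmul r s =>
        simp only [LinearMap.lTensor_tmul, LinearMap.rTensor_tmul, LinearMap.comp_apply,
          TensorProduct.mk_apply, twistedMul_tmul, LinearMap.flip_apply]
        generalize τ (q ⊗ₜ r) = z
        induction z using TensorProduct.induction_on with
        | zero => simp
        | add u u' hu hu' => simp only [map_add, TensorProduct.add_tmul, hu, hu']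
        | tmul a b => simp [hV.assoc]
  rw [h3]
  generalize τ (v' ⊗ₜ x'') = w
  induction w using TensorProduct.induction_on with
  | zero => simp
  | add u u' hu hu' => simp only [map_add, hu, hu']
  | tmul r s =>
    simp only [LinearMap.lTensor_tmul, LinearMap.rTensor_tmul, LinearMap.comp_apply,
      TensorProduct.mk_apply, LinearMap.flip_apply, hr v x' r]
    generalize τ (v ⊗ₜ x') = z
    induction z using TensorProduct.induction_on with
    | zero => simp
    | add u u' hu hu' => simp only [map_add, LinearMap.add_apply, TensorProduct.add_tmul, hu, hu']
    | tmul p q =>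
      simp only [TensorProduct.map_tmul, LinearMap.id_apply, twistedMul_tmul,
        LinearMap.lTensor_tmul, LinearMap.comp_apply, TensorProduct.mk_apply, LinearMap.flip_apply]
      generalize τ (q ⊗ₜ r) = z
      induction z using TensorProduct.induction_on with
      | zero => simp
      | add u u' hu hu' => simp only [map_add, TensorProduct.tmul_add, TensorProduct.add_tmul, hu, hu']
      | tmul a b => simp [hX.assoc]

/-- `(t (x ⊗ v)) = ((m ⊗ ι)(ι ⊗ τ)(t ⊗ x)) (1 ⊗ v)`. -/
lemma twistedMul_apply_tmul (τ : V ⊗[K] X →ₗ[K] X ⊗[K] V) (t : X ⊗[K] V) (x : X) (v : V) :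
    twistedMul mX mV τ t (x ⊗ₜ v) = (mV.flip v).lTensor X ((lift mX).rTensor V
      ((assoc K X X V).symm ((τ ∘ₗ (TensorProduct.mk K V X).flip x).lTensor X t))) := by
  induction t using TensorProduct.induction_on with
  | zero => simp
  | add u u' hu hu' => simp only [map_add, LinearMap.add_apply, hu, hu']
  | tmul p q =>
    simp only [twistedMul_tmul, LinearMap.lTensor_tmul, LinearMap.comp_apply, LinearMap.flip_apply,
      TensorProduct.mk_apply]
    generalize τ (q ⊗ₜ x) = z
    induction z using TensorProduct.induction_on with
    | zero => simp
    | add u u' hu hu' => simp only [map_add, TensorProduct.tmul_add, hu, hu']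
    | tmul r s => simp

lemma twistedMul_tmul_apply (τ : V ⊗[K] X →ₗ[K] X ⊗[K] V) (t : X ⊗[K] V) (x : X) (v : V) :
    twistedMul mX mV τ (x ⊗ₜ v) t = (mX x).rTensor V ((lift mV).lTensor X
      (assoc K X V V ((τ ∘ₗ TensorProduct.mk K V X v).rTensor V t))) := by
  induction t using TensorProduct.induction_on with
  | zero => simp
  | add u u' hu hu' => simp only [map_add, hu, hu']
  | tmul p q =>
    simp only [twistedMul_tmul, LinearMap.rTensor_tmul, LinearMap.comp_apply,
      TensorProduct.mk_apply]
    generalize τ (v ⊗ₜ p) = z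
    induction z using TensorProduct.induction_on with
    | zero => simp
    | add u u' hu hu' => simp only [map_add, TensorProduct.add_tmul, hu, hu']
    | tmul r s => simp

lemma HexagonRight.apply {τ : V ⊗[K] X →ₗ[K] X ⊗[K] V} (hr : HexagonRight mX τ) (u : V ⊗[K] X)
    (x : X) : (lift mX).rTensor V ((assoc K X X V).symm
      ((τ ∘ₗ (TensorProduct.mk K V X).flip x).lTensor X (τ u))) = τ ((mX.flip x).lTensor V u) := by
  induction u using TensorProduct.induction_on with
  | zero => simp
  | add u u' hu hu' => simp only [map_add, hu, hu']
  | tmul p q => simp [hr p q x]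

lemma HexagonLeft.apply {τ : V ⊗[K] X →ₗ[K] X ⊗[K] V} (hl : HexagonLeft mV τ) (u : V ⊗[K] X)
    (v : V) : (lift mV).lTensor X (assoc K X V V ((τ ∘ₗ TensorProduct.mk K V X v).rTensor V
      (τ u))) = τ ((mV v).rTensor X u) := by
  induction u using TensorProduct.induction_on with
  | zero => simp
  | add u u' hu hu' => simp only [map_add, hu, hu']
  | tmul p q => simp [hl v p q]

/-- Non-degeneracy holds as `τ(u)(x ⊗ 1) = τ(u (1 ⊗ x))` and `(1 ⊗ v) τ(u) = τ((v ⊗ 1) u)` by the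
hexagon properties, and `τ` is bijective. -/
lemma isAlgebra_twistedMul (hX : IsAlgebra mX) (hV : IsAlgebra mV) (τ : V ⊗[K] X ≃ₗ[K] X ⊗[K] V)
    (hl : HexagonLeft mV τ.toLinearMap) (hr : HexagonRight mX τ.toLinearMap) :
    IsAlgebra (twistedMul mX mV τ.toLinearMap) where
  assoc s t u := by
    induction s using TensorProduct.induction_on with
    | zero => simp
    | add u u' hu hu' => simp only [map_add, LinearMap.add_apply, hu, hu']
    | tmul x v =>
      induction t using TensorProduct.induction_on with
      | zero => simp
      | add u u' hu hu' => simp only [map_add, LinearMap.add_apply, hu, hu']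
      | tmul x' v' =>
        induction u using TensorProduct.induction_on with
        | zero => simp
        | add u u' hu hu' => simp only [map_add, hu, hu']
        | tmul x'' v'' => exact twistedMul_assoc hX hV hl hr x x' x'' v v' v''
  nondeg_left t ht := by
    obtain ⟨u, rfl⟩ := τ.surjective t
    suffices u = 0 by rw [this, map_zero]
    refine hX.lTensor_flip_ext fun x => τ.injective ?_
    refine hV.lTensor_flip_ext fun v => ?_
    have h := ht (x ⊗ₜ v)
    rw [twistedMul_apply_tmul] at h
    have h2 := hr.apply u x
    simp only [LinearEquiv.coe_coe] at h2
    rw [← h2, h]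
    simp
  nondeg_right t ht := by
    obtain ⟨u, rfl⟩ := τ.surjective t
    suffices u = 0 by rw [this, map_zero]
    refine hV.rTensor_mul_ext fun v => τ.injective ?_
    refine hX.rTensor_mul_ext fun x => ?_
    have h := ht (x ⊗ₜ v)
    rw [twistedMul_tmul_apply] at h
    have h2 := hl.apply u v
    simp only [LinearEquiv.coe_coe] at h2
    rw [← h2, h]
    simp

/-- If `f` and `g` commute for all values of the parameters, the composite of two maps with the
left hexagon property has it as well. -/
lemma HexagonLeft.comp {σ τ : V ⊗[K] X →ₗ[K] X ⊗[K] V} (hσ : HexagonLeft mV σ)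
    (hτ : HexagonLeft mV τ)
    (h : ∀ v v' x, (τ ∘ₗ TensorProduct.mk K V X v).rTensor V (σ (v' ⊗ₜ x)) =
      rightComm K X V V ((σ ∘ₗ TensorProduct.mk K V X v').rTensor V (τ (v ⊗ₜ x)))) :
    HexagonLeft mV (σ ∘ₗ (comm K X V).toLinearMap ∘ₗ τ) := by
  intro v v' x
  simp only [LinearMap.comp_apply, hτ v v' x, LinearEquiv.coe_coe]
  generalize τ (v' ⊗ₜ x) = z
  induction z using TensorProduct.induction_on with
  | zero => simp
  | add u u' hu hu' => simp only [map_add, hu, hu']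
  | tmul p q =>
    have h1 : (σ ∘ₗ (comm K X V).toLinearMap ∘ₗ τ) ∘ₗ TensorProduct.mk K V X v =
      (σ ∘ₗ (comm K X V).toLinearMap) ∘ₗ (τ ∘ₗ TensorProduct.mk K V X v) := rfl
    rw [h1, TensorProduct.comm_tmul, LinearMap.rTensor_comp_apply _ _ _ (σ (q ⊗ₜ p)), h]
    simp only [LinearMap.rTensor_tmul, LinearMap.comp_apply, TensorProduct.mk_apply]
    generalize τ (v ⊗ₜ p) = w
    induction w using TensorProduct.induction_on with
    | zero => simp
    | add u u' hu hu' => simp only [map_add, TensorProduct.add_tmul, hu, hu']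
    | tmul r s =>
      simp only [LinearMap.rTensor_tmul, LinearMap.comp_apply, TensorProduct.mk_apply,
        TensorProduct.assoc_tmul, LinearMap.lTensor_tmul, lift.tmul, TensorProduct.comm_tmul,
        hσ s q r]
      generalize σ (q ⊗ₜ r) = u
      induction u using TensorProduct.induction_on with
      | zero => simp
      | add u u' hu hu' => simp only [map_add, TensorProduct.add_tmul, hu, hu']
      | tmul a b => simp

/-- The inverse of a twist with the left hexagon property has the right one. -/
lemma HexagonLeft.symm {τ : V ⊗[K] X ≃ₗ[K] X ⊗[K] V} (h : HexagonLeft mV τ.toLinearMap) :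
    HexagonRight mV τ.symm.toLinearMap := by
  intro x v v'
  simp only [LinearEquiv.coe_coe]
  rw [LinearEquiv.symm_apply_eq]
  obtain ⟨z, hz⟩ := τ.surjective (x ⊗ₜ v)
  rw [← hz, LinearEquiv.symm_apply_apply]
  have h1 : ∀ z : V ⊗[K] X, τ ((lift mV).rTensor X ((assoc K V V X).symm
      ((τ.symm.toLinearMap ∘ₗ (TensorProduct.mk K X V).flip v').lTensor V z))) =
      (mV.flip v').lTensor X (τ z) := by
    intro z
    induction z using TensorProduct.induction_on with
    | zero => simp
    | add u u' hu hu' => simp only [map_add, hu, hu']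
    | tmul p q =>
      have h2 := h.apply (τ.symm (q ⊗ₜ v')) p
      simp only [LinearEquiv.coe_coe, LinearEquiv.apply_symm_apply] at h2
      rw [LinearMap.lTensor_tmul, rTensor_lift_assoc_symm]
      simp only [LinearMap.comp_apply, LinearMap.flip_apply, TensorProduct.mk_apply,
        LinearEquiv.coe_coe]
      rw [← h2]
      simp only [LinearMap.rTensor_tmul, LinearMap.comp_apply, TensorProduct.mk_apply,
        LinearEquiv.coe_coe]
      generalize τ (p ⊗ₜ q) = w
      induction w using TensorProduct.induction_on with
      | zero => simp
      | add u u' hu hu' => simp only [map_add, TensorProduct.add_tmul, hu, hu']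
      | tmul a b => simp
  rw [h1, hz]
  simp

end Twisted

lemma UMod.hexagonLeft_tw {m : X →ₗ[K] X →ₗ[K] X} (H : RegularMHA m) (M : UMod m V) :
    HexagonLeft m (M.tw H).toLinearMap := fun x y v => M.tw_mul H x y v

/-- Twists for commuting actions commute. -/
lemma UMod.tw_comm_tw {m : X →ₗ[K] X →ₗ[K] X} (H H' : RegularMHA m) (M N : UMod m V)
    (hMN : ∀ x y v, M.act x (N.act y v) = N.act y (M.act x v)) (x y : X) (v : V) :
    ((M.tw H).toLinearMap ∘ₗ TensorProduct.mk K X V x).rTensor X (N.tw H' (y ⊗ₜ v)) =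
      rightComm K V X X (((N.tw H').toLinearMap ∘ₗ TensorProduct.mk K X V y).rTensor X
        (M.tw H (x ⊗ₜ v))) := by
  refine slR_ext (fun φ : X →ₗ[K] K => φ) (fun x hx => ?_) fun φ => ?_
  · by_contra h
    obtain ⟨φ, hφ⟩ := exists_dual_eq_one (K := K) h
    simp [hx] at hφ
  have h1 : ∀ z : V ⊗[K] X, slR (V ⊗[K] X) φ (rightComm K V X X
      (((N.tw H').toLinearMap ∘ₗ TensorProduct.mk K X V y).rTensor X z)) =
      (slR V φ ∘ₗ (N.tw H').toLinearMap ∘ₗ TensorProduct.mk K X V y).rTensor X z := by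
    intro z
    induction z using TensorProduct.induction_on with
    | zero => simp
    | add u u' hu hu' => simp only [map_add, hu, hu']
    | tmul p q =>
      simp only [LinearMap.rTensor_tmul, LinearMap.comp_apply, TensorProduct.mk_apply,
        LinearEquiv.coe_coe]
      generalize N.tw H' (y ⊗ₜ p) = w
      induction w using TensorProduct.induction_on with
      | zero => simp
      | add u u' hu hu' => simp only [map_add, TensorProduct.add_tmul, hu, hu']
      | tmul a b => simp [TensorProduct.smul_tmul']
  have h2 : IsHom M M (slR V φ ∘ₗ (N.tw H').toLinearMap ∘ₗ TensorProduct.mk K X V y) := by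
    intro x v
    have h3 : IsHom N N (M.act x) := fun z v => hMN x z v
    have h4 := h3.tw_lTensor (H := H') (y ⊗ₜ v)
    rw [LinearMap.lTensor_tmul] at h4
    simp only [LinearMap.comp_apply, TensorProduct.mk_apply, LinearEquiv.coe_coe, h4,
      slR_rTensor]
  rw [h1, slR_rTensor, ← h2.tw_lTensor]
  simp

namespace UMod

variable {m : X →ₗ[K] X →ₗ[K] X}

/-! ### Free modules and transport of structure -/

/-- The module `X ⊗ W`, where `X` acts on the first factor by multiplication. -/
def free (H : RegularMHA m) (W : Type*) [AddCommGroup W] [Module K W] : UMod m (X ⊗[K] W) where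
  act := LinearMap.rTensorHom W ∘ₗ m
  mul_act x y t := by
    simp only [LinearMap.comp_apply, LinearMap.coe_rTensorHom, ← LinearMap.rTensor_comp_apply]
    congr 2
    ext z
    simp [H.isAlgebra.assoc]
  surj := by
    have h : (⇑(lift (LinearMap.rTensorHom W ∘ₗ m)) : X ⊗[K] (X ⊗[K] W) → X ⊗[K] W) =
        ⇑((lift m).rTensor W) ∘ ⇑(assoc K X X W).symm := by
      funext t
      induction t using TensorProduct.induction_on with
      | zero => simp
      | add u u' hu hu' => rw [map_add, hu, hu']; simp
      | tmul p q => rw [Function.comp_apply, rTensor_lift_assoc_symm]; rfl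
    rw [h]
    exact (LinearMap.rTensor_surjective W H.lift_mul_surjective).comp (LinearEquiv.surjective _)

lemma free_act (H : RegularMHA m) (x : X) (t : X ⊗[K] W) :
    (free H W).act x t = (m x).rTensor W t := rfl

lemma tw_free (H : RegularMHA m) (x c : X) (w : W) :
    (free H W).tw H (x ⊗ₜ (c ⊗ₜ w)) = rightComm K X X W (H.T₃ (x ⊗ₜ c) ⊗ₜ w) := by
  have h := (free H W).eq_tw H (G := (rightComm K X X W).toLinearMap ∘ₗ H.T₃.rTensor W ∘ₗ
    (assoc K X X W).symm.toLinearMap) (fun x e t => by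
      induction t using TensorProduct.induction_on with
      | zero => simp
      | add u u' hu hu' =>
        simp only [map_add, TensorProduct.tmul_add, LinearMap.rTensor_add, LinearMap.add_apply,
          hu, hu']
      | tmul p q =>
        simp only [free_act, LinearMap.rTensor_tmul, LinearMap.comp_apply, LinearEquiv.coe_coe,
          TensorProduct.assoc_symm_tmul, H.T₃_mul_right]
        generalize H.T₃ (x ⊗ₜ e) = z
        induction z using TensorProduct.induction_on with
        | zero => simp
        | add u u' hu hu' => simp only [map_add, TensorProduct.add_tmul, hu, hu']
        | tmul r s => simp [free_act])
  simpa using (LinearMap.congr_fun h (x ⊗ₜ (c ⊗ₜ w))).symm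

lemma tw'_free (H : RegularMHA m) (x c : X) (w : W) :
    (free H W).tw' H (x ⊗ₜ (c ⊗ₜ w)) = assoc K X X W (H.T₁ (x ⊗ₜ c) ⊗ₜ w) := by
  have h := tw_free H.copReg x c w
  refine (congrArg (comm K (X ⊗[K] W) X) h).trans ?_
  rw [← H.comm_copReg_T₃]
  generalize H.copReg.T₃ (x ⊗ₜ c) = z
  induction z using TensorProduct.induction_on with
  | zero => simp
  | add u u' hu hu' => simp only [map_add, TensorProduct.add_tmul, hu, hu']
  | tmul r s => simp

/-- Transport of a module structure along a linear bijection. -/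
def transport (M : UMod m V) (e : V ≃ₗ[K] W) : UMod m W where
  act := LinearMap.compl₂ (M.act.compr₂ e.toLinearMap) e.symm.toLinearMap
  mul_act x y w := by simp [M.mul_act]
  surj w := by
    obtain ⟨t, ht⟩ := M.surj (e.symm w)
    refine ⟨e.toLinearMap.lTensor X t, ?_⟩
    rw [LinearEquiv.eq_symm_apply] at ht
    rw [← ht]
    clear ht
    induction t using TensorProduct.induction_on with
    | zero => simp
    | add u u' hu hu' => simp only [map_add, hu, hu']
    | tmul p q => simp

lemma transport_act (M : UMod m V) (e : V ≃ₗ[K] W) (x : X) (w : W) :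
    (M.transport e).act x w = e (M.act x (e.symm w)) := rfl

lemma isHom_transport (M : UMod m V) (e : V ≃ₗ[K] W) : IsHom M (M.transport e) e.toLinearMap :=
  fun x v => by simp [transport_act]

end UMod

namespace Pairing

variable {HA : RegularMHA mA} {HB : RegularMHA mB}

/-! ### The products of the Heisenberg and Drinfel'd doubles -/

lemma hexagonLeft_R (P : Pairing HA HB) : HexagonLeft mB P.R.toLinearMap :=
  P.leftMod.hexagonLeft_tw HB

lemma hexagonLeft_R' (P : Pairing HA HB) : HexagonLeft mB P.R'.toLinearMap :=
  P.rightMod.hexagonLeft_tw HB.copReg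

lemma hexagonRight_R (P : Pairing HA HB) : HexagonRight mA P.R.toLinearMap := by
  intro b a a'
  have h := P.isHom_lift_mul.tw_lTensor (H := HB) (b ⊗ₜ (a ⊗ₜ a'))
  rw [LinearMap.lTensor_tmul, UMod.tw_tmul] at h
  refine h.trans ?_
  rw [R_eq]
  simp only [LinearEquiv.coe_coe]
  congr 2
  generalize P.leftMod.tw HB (b ⊗ₜ a) = z
  induction z using TensorProduct.induction_on with
  | zero => simp
  | add u u' hu hu' => simp only [map_add, TensorProduct.add_tmul, hu, hu']
  | tmul p q => simp

/-- The map `T` is composed of the twists of two commuting actions of `B`. -/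
lemma hexagonLeft_T (P : Pairing HA HB) : HexagonLeft mB P.T.toLinearMap :=
  P.hexagonLeft_R'.comp P.hexagonLeft_R fun v v' x =>
    UMod.tw_comm_tw HB HB.copReg P.leftMod P.rightMod (fun _ _ _ => P.lA_rA _ _ _) v v' x

/-- This is the left hexagon property of `T⁻¹`, the map `T` of the pairing `tilde`. -/
lemma hexagonRight_T (P : Pairing HA HB) : HexagonRight mA P.T.toLinearMap := by
  have h := P.tilde.hexagonLeft_T.symm
  rwa [tilde_T, LinearEquiv.symm_symm] at h

theorem isAlgebra_mulD (P : Pairing HA HB) : IsAlgebra P.mulD :=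
  isAlgebra_twistedMul HA.isAlgebra HB.isAlgebra P.T P.hexagonLeft_T P.hexagonRight_T

theorem isAlgebra_mulH (P : Pairing HA HB) : IsAlgebra P.mulH :=
  isAlgebra_twistedMul HA.isAlgebra HB.isAlgebra P.R P.hexagonLeft_R P.hexagonRight_R

/-! ### Modules over the Drinfel'd double -/

/-- The action of `a ⊗ b` is the action of `b` followed by that of `a`. -/
def pairAct (α : A →ₗ[K] V →ₗ[K] V) (β : B →ₗ[K] V →ₗ[K] V) : A ⊗[K] B →ₗ[K] V →ₗ[K] V :=
  lift (LinearMap.compl₁₂ (LinearMap.llcomp K V V V) α β)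

@[simp] lemma pairAct_tmul (α : A →ₗ[K] V →ₗ[K] V) (β : B →ₗ[K] V →ₗ[K] V) (a : A) (b : B) (v : V) :
    pairAct α β (a ⊗ₜ b) v = α a (β b v) := rfl

/-- Actions of `A` and `B` on `V` define an action of the Drinfel'd double if
`b · (a · v) = T(b ⊗ a) · v`. -/
def IsDouble (P : Pairing HA HB) (α : UMod mA V) (β : UMod mB V) : Prop :=
  ∀ t v, pairAct β.act α.act t v = pairAct α.act β.act (P.T t) v

lemma isDouble_tilde (P : Pairing HA HB) {α : UMod mA V} {β : UMod mB V} :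
    P.tilde.IsDouble β α ↔ P.IsDouble α β := by
  refine ⟨fun h t v => ?_, fun h t v => ?_⟩
  · rw [h, tilde_T, LinearEquiv.symm_apply_apply]
  · rw [h, tilde_T, LinearEquiv.apply_symm_apply]

/-- The condition `b · (a · v) = T(b ⊗ a) · v` is equivalent to
`(a₁ ▶ b) · (a₂ · v) = (b₁ ▶ a) · (b₂ · v)`. -/
lemma isDouble_iff (P : Pairing HA HB) {α : UMod mA V} {β : UMod mB V} : P.IsDouble α β ↔
    ∀ a b v, pairAct β.act α.act (P.flip.R (a ⊗ₜ b)) v = pairAct α.act β.act (P.R (b ⊗ₜ a)) v := by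
  have h1 : ∀ t, P.T (P.flip.R t) = P.R (comm K A B t) := by
    intro t
    rw [T_eq, ← flip_R_symm]
    simp
  refine ⟨fun h a b v => ?_, fun h t v => ?_⟩
  · rw [h, h1, TensorProduct.comm_tmul]
  · obtain ⟨t, rfl⟩ := P.flip.R.surjective t
    rw [h1]
    induction t using TensorProduct.induction_on with
    | zero => simp
    | add u u' hu hu' => simp only [map_add, LinearMap.add_apply, hu, hu']
    | tmul p q => rw [h, TensorProduct.comm_tmul]

lemma tw_copReg_rA (P : Pairing HA HB) (α : UMod mA V) (a : A) (c : B) (v : V) :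
    α.tw HA.copReg (P.rA a c ⊗ₜ v) = (P.rA.flip c).lTensor V (α.tw HA.copReg (a ⊗ₜ v)) := by
  refine P.slR_form_ext fun d => ?_
  rw [slR_tw_copReg, slR_lTensor, ← P.rA_mul, ← slR_tw_copReg]
  congr 2
  ext p
  simp [form_rA]

/-- The double modules are the modules for which `a ⊗ v ↦ a₂ v ⊗ a₁` is a homomorphism of
`B`-modules. -/
lemma isDouble_iff_isHom (P : Pairing HA HB) {α : UMod mA V} {β : UMod mB V} : P.IsDouble α β ↔
    UMod.IsHom (UMod.diag HB P.leftMod β) (UMod.diag HB β P.leftMod)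
      (α.tw HA.copReg).toLinearMap := by
  have h1 : ∀ a b c v, slR V (P.form.flip c) (α.tw HA.copReg
      ((UMod.diag HB P.leftMod β).act b (a ⊗ₜ v))) =
      pairAct α.act β.act (P.R (b ⊗ₜ P.rA a c)) v := by
    intro a b c v
    have h : UMod.IsHom P.leftMod P.leftMod (P.rA.flip c) := fun b a => (P.lA_rA b c a).symm
    have h' := h.tw_lTensor (H := HB) (b ⊗ₜ a)
    rw [LinearMap.lTensor_tmul, LinearMap.flip_apply] at h'
    rw [UMod.diag_act, R_eq, h']
    generalize P.leftMod.tw HB (b ⊗ₜ a) = z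
    induction z using TensorProduct.induction_on with
    | zero => simp
    | add u u' hu hu' => simp only [map_add, LinearMap.add_apply, hu, hu']
    | tmul p q => simp [slR_tw_copReg]
  have h2 : ∀ a b c v, slR V (P.form.flip c) ((UMod.diag HB β P.leftMod).act b
      (α.tw HA.copReg (a ⊗ₜ v))) = pairAct β.act α.act (P.flip.R (P.rA a c ⊗ₜ b)) v := by
    intro a b c v
    have h3 : ∀ z : V ⊗[K] A, slR V (P.form.flip c) ((UMod.diag HB β P.leftMod).act b z) =
        lift β.act ((P.lB.flip b).rTensor V (comm K V A ((P.rA.flip c).lTensor V z))) := by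
      intro z
      induction z using TensorProduct.induction_on with
      | zero => simp
      | add u u' hu hu' => simp only [map_add, hu, hu']
      | tmul p q =>
        rw [UMod.diag_act', slR_rTensor, UMod.tw'_apply, slR_comm]
        have h5 : slL B (P.form.flip c) (P.leftMod.tw HB.copReg (b ⊗ₜ q)) =
            P.lB (P.rA q c) b := by
          refine P.flip.ext_form fun x => ?_
          have h4 : ∀ z : A ⊗[K] B, P.flip.form (slL B (P.form.flip c) z) x =
              P.form (slR A (P.form x) z) c := by
            intro z
            induction z using TensorProduct.induction_on with
            | zero => simp
            | add u u' hu hu' => simp only [map_add, LinearMap.add_apply, hu, hu']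
            | tmul p q => simp [flip, mul_comm]
          rw [h4]
          refine (congrArg (P.form.flip c) (P.flip.slR_tw_copReg P.leftMod b x q)).trans ?_
          simp only [LinearMap.flip_apply, leftMod_act]
          change P.form (P.lA (P.rB b x) q) c = P.form x (P.lB (P.rA q c) b)
          rw [form_lA, ← form_rA, form_rB, form_lB]
        rw [h5]
        simp
    have h6 := P.tw_copReg_rA α a c v
    have h7 := (UMod.diag_act' HA P.flip.leftMod α (P.rA a c) b v).symm.trans
      (UMod.diag_act HA P.flip.leftMod α (P.rA a c) b v)
    rw [h3, ← h6]
    refine (congrArg (lift β.act) h7).trans ?_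
    rw [R_eq]
    generalize P.flip.leftMod.tw HA (P.rA a c ⊗ₜ b) = z
    induction z using TensorProduct.induction_on with
    | zero => simp
    | add u u' hu hu' => simp only [map_add, LinearMap.add_apply, hu, hu']
    | tmul p q => simp
  rw [isDouble_iff]
  refine ⟨fun h b t => ?_, fun h a b v => ?_⟩
  · induction t using TensorProduct.induction_on with
    | zero => simp
    | add u u' hu hu' => simp only [map_add, hu, hu']
    | tmul a v =>
      refine P.slR_form_ext fun c => ?_
      simp only [LinearEquiv.coe_coe]
      rw [h1, h2, h]
  · obtain ⟨t, rfl⟩ := P.lift_rA_surjective a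
    induction t using TensorProduct.induction_on with
    | zero => simp
    | add u u' hu hu' =>
      simp only [map_add, TensorProduct.tmul_add, TensorProduct.add_tmul, LinearMap.add_apply, hu,
        hu']
    | tmul a c =>
      have h3 := congrArg (slR V (P.form.flip c)) (h b (a ⊗ₜ v))
      simp only [LinearEquiv.coe_coe] at h3
      rw [h1, h2] at h3
      exact h3.symm

lemma IsDouble.isHom {P : Pairing HA HB} {α : UMod mA V} {β : UMod mB V} (h : P.IsDouble α β) :
    UMod.IsHom (UMod.diag HB P.leftMod β) (UMod.diag HB β P.leftMod)
      (α.tw HA.copReg).toLinearMap := P.isDouble_iff_isHom.1 h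

/-- The mirror image of `IsDouble.isHom`. -/
lemma IsDouble.isHom' {P : Pairing HA HB} {α : UMod mA V} {β : UMod mB V} (h : P.IsDouble α β) :
    UMod.IsHom (UMod.diag HA.copReg P.flip.rightMod α) (UMod.diag HA.copReg α P.flip.rightMod)
      (β.tw HB).toLinearMap := (P.isDouble_tilde.2 h).isHom

lemma _root_.Heis.UMod.tw_diag {m : X →ₗ[K] X →ₗ[K] X} (H : RegularMHA m) (M : UMod m V)
    (N : UMod m W) : ((UMod.diag H M N).tw H).toLinearMap = (assoc K V W X).symm.toLinearMap ∘ₗ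
      (N.tw H).toLinearMap.lTensor V ∘ₗ (assoc K V X W).toLinearMap ∘ₗ
        (M.tw H).toLinearMap.rTensor W ∘ₗ (assoc K X V W).symm.toLinearMap := by
  refine TensorProduct.ext_threefold' fun x v w => ?_
  simpa using UMod.tw_tmul H M N x v w

/-- The tensor product of double modules. -/
lemma IsDouble.diag {P : Pairing HA HB} {α : UMod mA V} {β : UMod mB V} {α' : UMod mA W}
    {β' : UMod mB W} (h : P.IsDouble α β) (h' : P.IsDouble α' β') :
    P.IsDouble (UMod.diag HA.copReg α α') (UMod.diag HB β β') := by
  rw [isDouble_iff_isHom, UMod.tw_diag]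
  exact (UMod.isHom_assoc HB β β' P.leftMod).symm.comp ((h'.isHom.lTensor HB β).comp
    ((UMod.isHom_assoc HB β P.leftMod β').comp ((h.isHom.rTensor HB β').comp
      (UMod.isHom_assoc HB P.leftMod β β').symm)))

/-! ### The adjoint module as a double module -/

lemma slR_cop_T₂ (P : Pairing HA HB) (x a : A) (c : B) :
    slR A (P.form.flip c) (HA.cop.T₂ (x ⊗ₜ a)) = mA x (P.rA a c) := by
  rw [← sub_eq_zero]
  refine HA.isAlgebra.nondeg_left _ fun z => ?_
  have h := congrArg (slR A (P.form.flip c)) (HA.copReg.rTensor_T₃ a x z)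
  rw [slR_rTensor, slR_rTensor, RegularMHA.copReg_T₃, HA.copT₃_apply, slR_comm, ← mul_rA] at h
  rw [map_sub, LinearMap.sub_apply, sub_eq_zero, HA.isAlgebra.assoc, h, LinearMap.flip_apply]
  rfl

lemma slR_copT₃ (P : Pairing HA HB) (a x : A) (c : B) :
    slR A (P.form.flip c) (HA.copT₃ (a ⊗ₜ x)) = mA (P.rA a c) x := by
  rw [HA.copT₃_apply, slR_comm, mul_rA]

/-- `(b₁ ▶ x)(b₂ ▶ a)₂ ⊗ (b₂ ▶ a)₁ = b ▶ (x a₂) ⊗ a₁`. -/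
lemma cop_T₂_diag (P : Pairing HA HB) (b : B) (t : A ⊗[K] A) :
    HA.cop.T₂ ((UMod.diag HB P.leftMod P.leftMod).act b t) =
      (P.lA b).rTensor A (HA.cop.T₂ t) := by
  refine P.slR_form_ext fun c => ?_
  have h1 : ∀ t, slR A (P.form.flip c) (HA.cop.T₂ t) = lift mA ((P.rA.flip c).lTensor A t) := by
    intro t
    induction t using TensorProduct.induction_on with
    | zero => simp
    | add u u' hu hu' => simp only [map_add, hu, hu']
    | tmul p q => simp [slR_cop_T₂]
  have h : UMod.IsHom P.leftMod P.leftMod (P.rA.flip c) := fun b a => (P.lA_rA b c a).symm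
  rw [slR_rTensor, h1, h1, h.lTensor HB, P.isHom_lift_mul]
  rfl

/-- `(b₁ ▶ a)₂ (b₂ ▶ x) ⊗ (b₁ ▶ a)₁ = b ▶ (a₂ x) ⊗ a₁`. -/
lemma copT₃_diag (P : Pairing HA HB) (b : B) (t : A ⊗[K] A) :
    HA.copT₃ ((UMod.diag HB P.leftMod P.leftMod).act b t) = (P.lA b).rTensor A (HA.copT₃ t) := by
  refine P.slR_form_ext fun c => ?_
  have h1 : ∀ t, slR A (P.form.flip c) (HA.copT₃ t) = lift mA ((P.rA.flip c).rTensor A t) := by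
    intro t
    induction t using TensorProduct.induction_on with
    | zero => simp
    | add u u' hu hu' => simp only [map_add, hu, hu']
    | tmul p q => simp [slR_copT₃]
  have h : UMod.IsHom P.leftMod P.leftMod (P.rA.flip c) := fun b a => (P.lA_rA b c a).symm
  rw [slR_rTensor, h1, h1, h.rTensor HB, P.isHom_lift_mul]
  rfl

/-- `T₂` of `Δᶜᵒᵖ` maps the twist of the adjoint module to `copT₃`, and both intertwine the diagonal
action of `B` with its action on the first factor. -/
lemma isDouble_ad (P : Pairing HA HB) : P.IsDouble (UMod.ad HA.copReg) P.leftMod := by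
  rw [isDouble_iff_isHom]
  intro b t
  refine HA.cop.T₂.injective ?_
  have h : ∀ t, HA.cop.T₂ ((UMod.ad HA.copReg).tw HA.copReg t) = HA.copT₃ t :=
    UMod.T₂_tw_ad HA.copReg
  simp only [LinearEquiv.coe_coe]
  rw [h, cop_T₂_diag, h, copT₃_diag]

lemma isDouble_ad' (P : Pairing HA HB) : P.IsDouble P.flip.rightMod (UMod.ad HB) :=
  P.isDouble_tilde.1 P.tilde.isDouble_ad

/-! ### The regular module of the Drinfel'd double -/

/-- The left multiplication by elements of `A` on the Drinfel'd double. -/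
def regA (_ : Pairing HA HB) : UMod mA (A ⊗[K] B) := UMod.free HA B

/-- The left multiplication by elements of `B` on the Drinfel'd double. -/
def regB (P : Pairing HA HB) : UMod mB (A ⊗[K] B) := (UMod.free HB A).transport P.T

lemma regA_act (P : Pairing HA HB) (a : A) (t : A ⊗[K] B) :
    P.regA.act a t = (mA a).rTensor B t := rfl

lemma regB_act (P : Pairing HA HB) (b : B) (t : A ⊗[K] B) :
    P.regB.act b t = (lift mB).lTensor A (assoc K A B B
      ((P.T.toLinearMap ∘ₗ TensorProduct.mk K B A b).rTensor B t)) := by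
  have h := P.hexagonLeft_T.apply (P.T.symm t) b
  simp only [LinearEquiv.coe_coe, LinearEquiv.apply_symm_apply] at h
  exact h.symm

lemma regB_act_tmul (P : Pairing HA HB) (b d : B) (c : A) :
    P.regB.act b (c ⊗ₜ d) = (mB.flip d).lTensor A (P.T (b ⊗ₜ c)) := by
  rw [regB_act]
  simp only [LinearMap.rTensor_tmul, LinearMap.comp_apply, TensorProduct.mk_apply,
    LinearEquiv.coe_coe]
  generalize P.T (b ⊗ₜ c) = z
  induction z using TensorProduct.induction_on with
  | zero => simp
  | add u u' hu hu' => simp only [map_add, TensorProduct.add_tmul, hu, hu']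
  | tmul p q => simp

/-- `T(b ⊗ a)` is the product of `1 ⋈ b` and `a ⋈ 1`, so this is associativity in `𝒟`. -/
lemma isDouble_reg (P : Pairing HA HB) : P.IsDouble P.regA P.regB := by
  intro t v
  induction t using TensorProduct.induction_on with
  | zero => simp
  | add u u' hu hu' => simp only [map_add, LinearMap.add_apply, hu, hu']
  | tmul b a =>
    induction v using TensorProduct.induction_on with
    | zero => simp
    | add u u' hu hu' => simp only [map_add, hu, hu']
    | tmul c d =>
      have h := P.hexagonRight_T b a c
      simp only [LinearEquiv.coe_coe] at h
      rw [pairAct_tmul, regA_act, LinearMap.rTensor_tmul, regB_act_tmul, h]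
      generalize P.T (b ⊗ₜ a) = z
      induction z using TensorProduct.induction_on with
      | zero => simp
      | add u u' hu hu' => simp only [map_add, LinearMap.add_apply, hu, hu']
      | tmul p q =>
        simp only [LinearMap.lTensor_tmul, LinearMap.comp_apply, LinearMap.flip_apply,
          TensorProduct.mk_apply, LinearEquiv.coe_coe, pairAct_tmul, regB_act_tmul, regA_act]
        rw [rTensor_lift_assoc_symm, lTensor_rTensor_comm]

lemma mulD_eq (P : Pairing HA HB) : P.mulD = pairAct P.regA.act P.regB.act := by
  refine TensorProduct.ext' fun a b => LinearMap.ext fun t => ?_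
  rw [pairAct_tmul, regA_act, regB_act]
  exact twistedMul_tmul_apply P.T.toLinearMap t a b

lemma mulH_eq (P : Pairing HA HB) (a a' : A) (b b' : B) :
    P.mulH (a ⊗ₜ b) (a' ⊗ₜ b') = map (mA a) (mB.flip b') (P.R (b ⊗ₜ a')) :=
  twistedMul_tmul P.R.toLinearMap a a' b b'

lemma leftA_eq (P : Pairing HA HB) : P.leftA = (P.regA.tw HA.copReg).toLinearMap := by
  refine TensorProduct.ext_threefold' fun a c d => ?_
  simp only [leftA, LinearMap.comp_apply, LinearEquiv.coe_coe, TensorProduct.assoc_symm_tmul,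
    LinearMap.rTensor_tmul]
  exact (UMod.tw_free HA.copReg a c d).symm

lemma leftA'_eq (P : Pairing HA HB) : P.leftA' = (P.regA.tw' HA.copReg).toLinearMap := by
  refine TensorProduct.ext_threefold' fun a c d => ?_
  simp only [leftA', LinearMap.comp_apply, LinearEquiv.coe_coe, TensorProduct.assoc_symm_tmul,
    LinearMap.rTensor_tmul]
  exact (UMod.tw'_free HA.copReg a c d).symm

lemma leftB_eq (P : Pairing HA HB) : P.leftB = (P.regB.tw HB).toLinearMap := by
  have h : (rightComm K B B A).toLinearMap ∘ₗ HB.T₃.rTensor A ∘ₗ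
      (assoc K B B A).symm.toLinearMap = ((UMod.free HB A).tw HB).toLinearMap := by
    refine TensorProduct.ext_threefold' fun a c d => ?_
    simp only [LinearMap.comp_apply, LinearEquiv.coe_coe, TensorProduct.assoc_symm_tmul,
      LinearMap.rTensor_tmul, UMod.tw_free]
  refine LinearMap.ext fun t => ?_
  obtain ⟨t, rfl⟩ := (LinearEquiv.lTensor B P.T).surjective t
  have h2 := (UMod.isHom_transport (UMod.free HB A) P.T).tw_lTensor (H := HB) t
  refine Eq.trans ?_ h2.symm
  have h3 := LinearMap.congr_fun h t
  simp only [LinearMap.comp_apply, LinearEquiv.coe_coe] at h3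
  have h4 : P.T.symm.toLinearMap.lTensor B (LinearEquiv.lTensor B P.T t) = t :=
    (LinearEquiv.lTensor B P.T).symm_apply_apply t
  simp only [leftB, LinearMap.comp_apply, LinearEquiv.coe_coe, h4, h3]

lemma leftB'_eq (P : Pairing HA HB) : P.leftB' = (P.regB.tw' HB).toLinearMap := by
  have h : (assoc K B B A).toLinearMap ∘ₗ HB.T₁.toLinearMap.rTensor A ∘ₗ
      (assoc K B B A).symm.toLinearMap = ((UMod.free HB A).tw' HB).toLinearMap := by
    refine TensorProduct.ext_threefold' fun a c d => ?_
    simp only [LinearMap.comp_apply, LinearEquiv.coe_coe, TensorProduct.assoc_symm_tmul,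
      LinearMap.rTensor_tmul, UMod.tw'_free]
  refine LinearMap.ext fun t => ?_
  obtain ⟨t, rfl⟩ := (LinearEquiv.lTensor B P.T).surjective t
  have h2 := (UMod.isHom_transport (UMod.free HB A) P.T).tw'_lTensor (H := HB) t
  refine Eq.trans ?_ h2.symm
  have h3 := LinearMap.congr_fun h t
  simp only [LinearMap.comp_apply, LinearEquiv.coe_coe] at h3
  have h4 : P.T.symm.toLinearMap.lTensor B (LinearEquiv.lTensor B P.T t) = t :=
    (LinearEquiv.lTensor B P.T).symm_apply_apply t
  simp only [leftB', LinearMap.comp_apply, LinearEquiv.coe_coe, h4, h3]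

end Pairing

namespace Pairing

variable {HA : RegularMHA mA} {HB : RegularMHA mB}

/-! ### The coproduct of the Drinfel'd double and its modules -/

lemma IsDouble.mulD_act {P : Pairing HA HB} {α : UMod mA V} {β : UMod mB V} (h : P.IsDouble α β)
    (x y : A ⊗[K] B) (v : V) : pairAct α.act β.act (P.mulD x y) v =
      pairAct α.act β.act x (pairAct α.act β.act y v) := by
  induction x using TensorProduct.induction_on with
  | zero => simp
  | add u u' hu hu' => simp only [map_add, LinearMap.add_apply, hu, hu']
  | tmul a b =>
    induction y using TensorProduct.induction_on with
    | zero => simp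
    | add u u' hu hu' => simp only [map_add, LinearMap.add_apply, hu, hu']
    | tmul c d =>
      have h1 : ∀ z : A ⊗[K] B, pairAct α.act β.act (map (mA a) (mB.flip d) z) v =
          α.act a (pairAct α.act β.act z (β.act d v)) := by
        intro z
        induction z using TensorProduct.induction_on with
        | zero => simp
        | add u u' hu hu' => simp only [map_add, LinearMap.add_apply, hu, hu']
        | tmul p q => simp [α.mul_act, β.mul_act]
      rw [mulD, twistedMul_tmul, h1]
      simp only [LinearEquiv.coe_coe]
      rw [← h, pairAct_tmul, pairAct_tmul, pairAct_tmul]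

lemma IsDouble.isUnitalModule {P : Pairing HA HB} {α : UMod mA V} {β : UMod mB V}
    (h : P.IsDouble α β) : IsUnitalModule P.double (pairAct α.act β.act) where
  mul_act := h.mulD_act
  unital := by
    refine top_le_iff.1 fun v _ => ?_
    refine α.act_induction (p := fun v => v ∈ Submodule.span K {w | ∃ x v,
      pairAct α.act β.act x v = w}) (fun _ _ => add_mem) (fun a v => ?_) v
    refine β.act_induction (p := fun v => α.act a v ∈ Submodule.span K {w | ∃ x v,
      pairAct α.act β.act x v = w}) (fun v v' hv hv' => ?_) (fun b v => ?_) v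
    · rw [map_add]; exact add_mem hv hv'
    · exact Submodule.subset_span ⟨a ⊗ₜ b, v, rfl⟩

/-- The orbit map `𝒟 → V`, `d ↦ d · v`, commutes with the action of `A`. -/
lemma isHom_pairAct_regA (P : Pairing HA HB) (α : UMod mA V) (β : UMod mB V) (v : V) :
    UMod.IsHom P.regA α ((pairAct α.act β.act).flip v) := by
  intro a x
  induction x using TensorProduct.induction_on with
  | zero => simp
  | add u u' hu hu' => simp only [map_add, hu, hu']
  | tmul c d => simp [regA_act, α.mul_act]

/-- The orbit map `𝒟 → V`, `d ↦ d · v`, commutes with the action of `B`. -/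
lemma IsDouble.isHom_pairAct_regB {P : Pairing HA HB} {α : UMod mA V} {β : UMod mB V}
    (h : P.IsDouble α β) (v : V) : UMod.IsHom P.regB β ((pairAct α.act β.act).flip v) := by
  intro b x
  induction x using TensorProduct.induction_on with
  | zero => simp
  | add u u' hu hu' => simp only [map_add, hu, hu']
  | tmul c d =>
    have h1 : ∀ z : A ⊗[K] B, (pairAct α.act β.act).flip v ((mB.flip d).lTensor A z) =
        pairAct α.act β.act z (β.act d v) := by
      intro z
      induction z using TensorProduct.induction_on with
      | zero => simp
      | add u u' hu hu' => simp only [map_add, LinearMap.add_apply, hu, hu']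
      | tmul p q => simp [β.mul_act]
    rw [regB_act_tmul, h1, ← h]
    simp

/-- `(a ⊗ b) ⊗ v ↦ a₂ · b₁ · v ⊗ (a₁ ⊗ b₂)`. -/
def pairTw (_ : Pairing HA HB) (α : UMod mA V) (β : UMod mB V) :
    (A ⊗[K] B) ⊗[K] V ≃ₗ[K] V ⊗[K] (A ⊗[K] B) :=
  assoc K A B V ≪≫ₗ (β.tw HB).lTensor A ≪≫ₗ (assoc K A V B).symm ≪≫ₗ
    (α.tw HA.copReg).rTensor B ≪≫ₗ assoc K V A B

lemma pairTw_tmul (P : Pairing HA HB) (α : UMod mA V) (β : UMod mB V) (a : A) (b : B) (v : V) :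
    P.pairTw α β ((a ⊗ₜ b) ⊗ₜ v) = assoc K V A B ((α.tw HA.copReg).toLinearMap.rTensor B
      ((assoc K A V B).symm (a ⊗ₜ β.tw HB (b ⊗ₜ v)))) := rfl

lemma leftAB_eq (P : Pairing HA HB) : P.leftAB = (P.pairTw P.regA P.regB).toLinearMap := by
  rw [leftAB, leftA_eq, leftB_eq]
  rfl

lemma pairTw_lTensor (P : Pairing HA HB) {α : UMod mA V} {β : UMod mB V} {α' : UMod mA W}
    {β' : UMod mB W} {f : V →ₗ[K] W} (hα : UMod.IsHom α α' f) (hβ : UMod.IsHom β β' f)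
    (t : (A ⊗[K] B) ⊗[K] V) : P.pairTw α' β' (f.lTensor _ t) = f.rTensor _ (P.pairTw α β t) := by
  induction t using TensorProduct.induction_on with
  | zero => simp
  | add u u' hu hu' => simp only [map_add, hu, hu']
  | tmul x v =>
    induction x using TensorProduct.induction_on with
    | zero => simp
    | add u u' hu hu' => simp only [TensorProduct.add_tmul, map_add, hu, hu']
    | tmul a b =>
      have h := hβ.tw_lTensor (H := HB) (b ⊗ₜ v)
      rw [LinearMap.lTensor_tmul] at h
      rw [LinearMap.lTensor_tmul, pairTw_tmul, pairTw_tmul, h]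
      generalize β.tw HB (b ⊗ₜ v) = z
      induction z using TensorProduct.induction_on with
      | zero => simp
      | add u u' hu hu' => simp only [TensorProduct.tmul_add, map_add, hu, hu']
      | tmul p q =>
        have h2 := hα.tw_lTensor (H := HA.copReg) (a ⊗ₜ p)
        rw [LinearMap.lTensor_tmul] at h2
        simp only [LinearMap.rTensor_tmul, TensorProduct.assoc_symm_tmul, LinearEquiv.coe_coe, h2]
        generalize α.tw HA.copReg (a ⊗ₜ p) = z
        induction z using TensorProduct.induction_on with
        | zero => simp
        | add u u' hu hu' => simp only [TensorProduct.add_tmul, map_add, hu, hu']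
        | tmul r s => simp

/-- The action of the Drinfel'd double on a tensor product of modules. -/
lemma pairAct_diag (P : Pairing HA HB) (α : UMod mA V) (β : UMod mB V) (α' : UMod mA W)
    (β' : UMod mB W) (x : A ⊗[K] B) (v : V) (w : W) :
    pairAct (UMod.diag HA.copReg α α').act (UMod.diag HB β β').act x (v ⊗ₜ w) =
      ((pairAct α'.act β'.act).flip w).lTensor V (P.pairTw α β (x ⊗ₜ v)) := by
  induction x using TensorProduct.induction_on with
  | zero => simp
  | add u u' hu hu' =>
    simp only [TensorProduct.add_tmul, map_add, LinearMap.add_apply, hu, hu']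
  | tmul a b =>
    rw [pairAct_tmul, UMod.diag_act, pairTw_tmul]
    generalize β.tw HB (b ⊗ₜ v) = z
    induction z using TensorProduct.induction_on with
    | zero => simp
    | add u u' hu hu' => simp only [TensorProduct.tmul_add, map_add, hu, hu']
    | tmul p q =>
      simp only [LinearMap.lTensor_tmul, UMod.diag_act, LinearMap.rTensor_tmul,
        TensorProduct.assoc_symm_tmul, LinearEquiv.coe_coe]
      generalize α.tw HA.copReg (a ⊗ₜ p) = z
      induction z using TensorProduct.induction_on with
      | zero => simp
      | add u u' hu hu' => simp only [TensorProduct.add_tmul, map_add, hu, hu']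
      | tmul r s => simp

lemma IsDouble.map_flip_leftAB {P : Pairing HA HB} {α : UMod mA V} {β : UMod mB V}
    (h : P.IsDouble α β) (α' : UMod mA W) (β' : UMod mB W) (x y : A ⊗[K] B) (v : V) (w : W) :
    map ((pairAct α.act β.act).flip v) ((pairAct α'.act β'.act).flip w) (P.leftAB (x ⊗ₜ y)) =
      pairAct (UMod.diag HA.copReg α α').act (UMod.diag HB β β').act x
        (pairAct α.act β.act y v ⊗ₜ w) := by
  have h1 := P.pairTw_lTensor (P.isHom_pairAct_regA α β v) (h.isHom_pairAct_regB v) (x ⊗ₜ y)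
  rw [LinearMap.lTensor_tmul, LinearMap.flip_apply] at h1
  rw [P.pairAct_diag, h1, leftAB_eq, ← LinearMap.lTensor_comp_rTensor]
  rfl

lemma IsDouble.isModuleAlgebra {P : Pairing HA HB} {α : UMod mA V} {β : UMod mB V}
    (h : P.IsDouble α β) {mV : V →ₗ[K] V →ₗ[K] V}
    (hα : UMod.IsHom (UMod.diag HA.copReg α α) α (lift mV))
    (hβ : UMod.IsHom (UMod.diag HB β β) β (lift mV)) :
    IsModuleAlgebra P.double mV (pairAct α.act β.act) := by
  intro x y v w
  have h1 : ∀ t, pairAct α.act β.act x (lift mV t) = lift mV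
      (pairAct (UMod.diag HA.copReg α α).act (UMod.diag HB β β).act x t) := by
    intro t
    induction x using TensorProduct.induction_on with
    | zero => simp
    | add u u' hu hu' => simp only [map_add, LinearMap.add_apply, hu, hu']
    | tmul a b => rw [pairAct_tmul, pairAct_tmul, hα, hβ]
  rw [show P.double.cov₃ = P.leftAB from rfl, h.map_flip_leftAB]
  exact h1 (pairAct α.act β.act y v ⊗ₜ w)

lemma IsDouble.isDiagonalAction {P : Pairing HA HB} {α : UMod mA V} {β : UMod mB V}
    (h : P.IsDouble α β) (α' : UMod mA W) (β' : UMod mB W) :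
    IsDiagonalAction P.double (pairAct α.act β.act) (pairAct α'.act β'.act)
      (pairAct (UMod.diag HA.copReg α α').act (UMod.diag HB β β').act) :=
  fun x y v w => (h.map_flip_leftAB α' β' x y v w).symm

lemma leftAB'_tmul (P : Pairing HA HB) (a : A) (b : B) (y : A ⊗[K] B) :
    P.leftAB' ((a ⊗ₜ b) ⊗ₜ y) = (assoc K A B (A ⊗[K] B)).symm (leftComm K B A (A ⊗[K] B)
      ((P.leftA'.lTensor B) (leftComm K A B (A ⊗[K] B) (a ⊗ₜ P.leftB' (b ⊗ₜ y))))) := rfl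

lemma rTensor_flip_leftAB' (P : Pairing HA HB) (α : UMod mA V) (β : UMod mB V) (x y : A ⊗[K] B)
    (v : V) : ((pairAct α.act β.act).flip v).rTensor _ (P.leftAB' (x ⊗ₜ y)) =
      pairAct (UMod.diag HA.copReg α P.regA).act (UMod.diag HB β P.regB).act x (v ⊗ₜ y) := by
  induction x using TensorProduct.induction_on with
  | zero => simp
  | add u u' hu hu' =>
    simp only [TensorProduct.add_tmul, map_add, LinearMap.add_apply, hu, hu']
  | tmul a b =>
    rw [pairAct_tmul, UMod.diag_act', leftAB'_tmul, leftB'_eq]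
    simp only [LinearEquiv.coe_coe]
    generalize P.regB.tw' HB (b ⊗ₜ y) = z
    induction z using TensorProduct.induction_on with
    | zero => simp
    | add u u' hu hu' => simp only [TensorProduct.tmul_add, map_add, hu, hu']
    | tmul p q =>
      simp only [LinearMap.rTensor_tmul, TensorProduct.leftComm_tmul, LinearMap.lTensor_tmul,
        UMod.diag_act', leftA'_eq, LinearEquiv.coe_coe]
      generalize P.regA.tw' HA.copReg (a ⊗ₜ q) = z
      induction z using TensorProduct.induction_on with
      | zero => simp
      | add u u' hu hu' => simp only [TensorProduct.tmul_add, map_add, hu, hu']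
      | tmul r s => simp

/-- The two sides of the Yetter-Drinfel'd condition are the coaction after the diagonal action on
`V ⊗ 𝒟` and the diagonal action on `𝒟 ⊗ V` after the coaction. -/
lemma isYDCompatible (P : Pairing HA HB) {α : UMod mA V} {β : UMod mB V}
    {Γ : Coaction K (A ⊗[K] B) V}
    (hα : UMod.IsHom (UMod.diag HA.copReg α P.regA) (UMod.diag HA.copReg P.regA α) Γ.L)
    (hβ : UMod.IsHom (UMod.diag HB β P.regB) (UMod.diag HB P.regB β) Γ.L) :
    IsYDCompatible P.double (pairAct α.act β.act) Γ := by
  intro x y v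
  rw [show P.double.cov₁ = P.leftAB' from rfl, show P.double.cov₃ = P.leftAB from rfl,
    rTensor_flip_leftAB']
  have h1 : ∀ t, Γ.L (pairAct (UMod.diag HA.copReg α P.regA).act (UMod.diag HB β P.regB).act x t) =
      pairAct (UMod.diag HA.copReg P.regA α).act (UMod.diag HB P.regB β).act x (Γ.L t) := by
    intro t
    induction x using TensorProduct.induction_on with
    | zero => simp
    | add u u' hu hu' => simp only [map_add, LinearMap.add_apply, hu, hu']
    | tmul a b => rw [pairAct_tmul, pairAct_tmul, hα, hβ]
  rw [h1]
  generalize Γ.L (v ⊗ₜ y) = z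
  induction z using TensorProduct.induction_on with
  | zero => simp
  | add u u' hu hu' => simp only [map_add, hu, hu']
  | tmul p q =>
    rw [pairAct_diag, leftAB_eq]
    simp only [LinearMap.rTensor_tmul, LinearMap.comp_apply, TensorProduct.mk_apply,
      LinearEquiv.coe_coe]
    generalize P.pairTw P.regA P.regB (x ⊗ₜ p) = z
    induction z using TensorProduct.induction_on with
    | zero => simp
    | add u u' hu hu' => simp only [TensorProduct.add_tmul, map_add, hu, hu']
    | tmul r s => simp

/-- The left multiplication by the coproduct of an element of the Drinfel'd double. -/
def mulCoprod (P : Pairing HA HB) : A ⊗[K] B →ₗ[K] (A ⊗[K] B) ⊗[K] (A ⊗[K] B) →ₗ[K]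
    (A ⊗[K] B) ⊗[K] (A ⊗[K] B) :=
  pairAct (UMod.diag HA.copReg P.regA P.regA).act (UMod.diag HB P.regB P.regB).act

lemma mulCoprod_tmul (P : Pairing HA HB) (d p q : A ⊗[K] B) :
    P.mulCoprod d (p ⊗ₜ q) = (P.mulD.flip q).lTensor _ (P.leftAB (d ⊗ₜ p)) := by
  rw [mulCoprod, P.pairAct_diag, mulD_eq, leftAB_eq]
  rfl

lemma leftAB_regA (P : Pairing HA HB) (a : A) (x y : A ⊗[K] B) :
    P.leftAB (P.regA.act a x ⊗ₜ y) =
      (UMod.diag HA.copReg P.regA P.regA).act a (P.leftAB (x ⊗ₜ y)) := by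
  refine P.isAlgebra_mulD.lTensor_flip_ext fun w => ?_
  have h2 : UMod.IsHom P.regA P.regA (P.mulD.flip w) := by
    rw [mulD_eq]
    exact P.isHom_pairAct_regA P.regA P.regB w
  have h3 := P.isHom_pairAct_regA (UMod.diag HA.copReg P.regA P.regA)
    (UMod.diag HB P.regB P.regB) (y ⊗ₜ w) a x
  rw [← mulCoprod_tmul, h2.lTensor HA.copReg, ← mulCoprod_tmul]
  exact h3

lemma leftAB_regB (P : Pairing HA HB) (b : B) (x y : A ⊗[K] B) :
    P.leftAB (P.regB.act b x ⊗ₜ y) =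
      (UMod.diag HB P.regB P.regB).act b (P.leftAB (x ⊗ₜ y)) := by
  refine P.isAlgebra_mulD.lTensor_flip_ext fun w => ?_
  have h2 : UMod.IsHom P.regB P.regB (P.mulD.flip w) := by
    rw [mulD_eq]
    exact P.isDouble_reg.isHom_pairAct_regB w
  have h3 := (P.isDouble_reg.diag P.isDouble_reg).isHom_pairAct_regB (y ⊗ₜ w) b x
  rw [← mulCoprod_tmul, h2.lTensor HB, ← mulCoprod_tmul]
  exact h3

/-- The coproduct of the Drinfel'd double is multiplicative. -/
lemma leftAB_mulD (P : Pairing HA HB) (d x y : A ⊗[K] B) :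
    P.leftAB (P.mulD d x ⊗ₜ y) = P.mulCoprod d (P.leftAB (x ⊗ₜ y)) := by
  rw [mulD_eq]
  induction d using TensorProduct.induction_on with
  | zero => simp
  | add u u' hu hu' =>
    simp only [TensorProduct.add_tmul, map_add, LinearMap.add_apply, hu, hu']
  | tmul a b => rw [pairAct_tmul, leftAB_regA, leftAB_regB]; rfl

/-- A criterion for comodules in terms of the slices `(ι ⊗ φᵢ)Γ(v)`, which are multiplications by
elements `hᵢ v`. -/
lemma isComodule_of_slices (P : Pairing HA HB) {ι : Type*} {Γ : Coaction K (A ⊗[K] B) V}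
    (φ : ι → V →ₗ[K] K) (hφ : ∀ v, (∀ i, φ i v = 0) → v = 0) (h : ι → V →ₗ[K] V)
    (hh : ∀ i j, ∃ k, φ j ∘ₗ h i = φ k ∧ h j ∘ₗ h i = h k)
    (l : V →ₗ[K] A ⊗[K] B →ₗ[K] A ⊗[K] B) (r : V → A ⊗[K] B → A ⊗[K] B)
    (hL : ∀ i v y, slR _ (φ i) (Γ.L (v ⊗ₜ y)) = l (h i v) y)
    (hR : ∀ i v x, slR _ (φ i) (Γ.R (x ⊗ₜ v)) = r (h i v) x)
    (hlr : ∀ v x y, P.mulD x (l v y) = P.mulD (r v x) y)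
    (δ : V → (A ⊗[K] B) ⊗[K] (A ⊗[K] B) →ₗ[K] (A ⊗[K] B) ⊗[K] (A ⊗[K] B))
    (hδ : ∀ v p q, δ v (p ⊗ₜ q) = (l.flip q).lTensor _ (Γ.L (v ⊗ₜ p)))
    (hl : ∀ v x y, P.leftAB (l v x ⊗ₜ y) = δ v (P.leftAB (x ⊗ₜ y)))
    (hinj : Function.Injective Γ.L) (hV : ∀ v : V, v ≠ 0 → ∃ y : A ⊗[K] B, y ≠ 0) :
    IsComodule P.double Γ where
  completed x y v := by
    refine slR_ext φ hφ fun i => ?_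
    rw [slR_rTensor, slR_rTensor, hL, hR]
    exact hlr _ _ _
  injective v hv := by
    by_contra hv'
    obtain ⟨y, hy⟩ := hV v hv'
    obtain ⟨ψ, hψ⟩ := exists_dual_eq_one (K := K) hv'
    have h1 : v ⊗ₜ[K] y = 0 := hinj (by rw [(hv y).1, map_zero])
    have h2 := congrArg (slL _ ψ) h1
    rw [slL_tmul, hψ, one_smul, map_zero] at h2
    exact hy h2
  coassoc x y v := by
    refine lTensor_ext (fun i => slR (A ⊗[K] B) (φ i))
      (fun t ht => slR_ext φ hφ fun i => by rw [ht, map_zero]) fun i => ?_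
    have h4 : ∀ p, (h i).lTensor _ (Γ.L (v ⊗ₜ p)) = Γ.L (h i v ⊗ₜ p) := by
      intro p
      refine slR_ext φ hφ fun j => ?_
      obtain ⟨k, hk, hk'⟩ := hh i j
      rw [slR_lTensor, hk, hL, hL, ← hk']
      rfl
    have h5 : ∀ z, (slR (A ⊗[K] B) (φ i)).lTensor _ (Γ.L.lTensor _ (assoc K _ V _
        (Γ.L.rTensor _ ((assoc K V _ _).symm (v ⊗ₜ z))))) = δ (h i v) z := by
      intro z
      induction z using TensorProduct.induction_on with
      | zero => simp
      | add u u' hu hu' => simp only [TensorProduct.tmul_add, map_add, hu, hu']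
      | tmul p q =>
        rw [hδ, ← h4, TensorProduct.assoc_symm_tmul, LinearMap.rTensor_tmul]
        generalize Γ.L (v ⊗ₜ p) = z
        induction z using TensorProduct.induction_on with
        | zero => simp
        | add u u' hu hu' => simp only [TensorProduct.add_tmul, map_add, hu, hu']
        | tmul r s => simp [hL]
    rw [h5]
    change δ (h i v) (P.leftAB (x ⊗ₜ y)) = _
    rw [← hl, ← hL]
    generalize Γ.L (v ⊗ₜ x) = z
    induction z using TensorProduct.induction_on with
    | zero => simp
    | add u u' hu hu' => simp only [TensorProduct.add_tmul, map_add, hu, hu']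
    | tmul r s =>
      simp only [slR_tmul, LinearMap.rTensor_tmul, LinearMap.comp_apply, LinearMap.flip_apply,
        TensorProduct.mk_apply]
      rw [← TensorProduct.smul_tmul', map_smul]
      change φ i s • P.leftAB (r ⊗ₜ y) = (slR (A ⊗[K] B) (φ i)).lTensor _
        (assoc K _ _ V (P.leftAB (r ⊗ₜ y) ⊗ₜ s))
      generalize P.leftAB (r ⊗ₜ y) = z
      induction z using TensorProduct.induction_on with
      | zero => simp
      | add u u' hu hu' => simp only [map_add, TensorProduct.add_tmul, smul_add, hu, hu']
      | tmul r s => simp [TensorProduct.smul_tmul']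

end Pairing

/-! ### The action on the Heisenberg double -/

namespace UMod

variable {m : X →ₗ[K] X →ₗ[K] X}

/-- A twisted product of module algebras is a module algebra if the twist is a homomorphism. -/
lemma isHom_lift_twistedMul (H : RegularMHA m) (M : UMod m V) (N : UMod m W)
    {mV : V →ₗ[K] V →ₗ[K] V} {mW : W →ₗ[K] W →ₗ[K] W} {τ : W ⊗[K] V →ₗ[K] V ⊗[K] W}
    (hM : IsHom (diag H M M) M (lift mV)) (hN : IsHom (diag H N N) N (lift mW))
    (hτ : IsHom (diag H N M) (diag H M N) τ) :
    IsHom (diag H (diag H M N) (diag H M N)) (diag H M N) (lift (twistedMul mV mW τ)) := by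
  have h : lift (twistedMul mV mW τ) = TensorProduct.map (lift mV) (lift mW)
      ∘ₗ (assoc K V V (W ⊗[K] W)).symm.toLinearMap
      ∘ₗ ((assoc K V W W).toLinearMap ∘ₗ τ.rTensor W ∘ₗ (assoc K W V W).symm.toLinearMap).lTensor V
      ∘ₗ (assoc K V W (V ⊗[K] W)).toLinearMap := TensorProduct.ext' fun _ _ => rfl
  rw [h]
  exact (hM.map H hN).comp ((isHom_assoc H M M (diag H N N)).symm.comp
    ((((isHom_assoc H M N N).comp ((hτ.rTensor H N).comp (isHom_assoc H N M N).symm)).lTensor H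
      M).comp (isHom_assoc H M N (diag H M N))))

/-- `(x₁ v S(x₂)) x₃ = x v`. -/
lemma lift_mul_tw_ad (H : RegularMHA m) (t : X ⊗[K] X) : lift m ((ad H).tw H t) = lift m t := by
  rw [← H.slR_counit_T₂, T₂_tw_ad, H.slR_counit_T₃]

end UMod

lemma slR_comp_slR (φ : X →ₗ[K] K) (ψ : Y →ₗ[K] K) (t : (Z ⊗[K] X) ⊗[K] Y) :
    slR Z (φ ∘ₗ slR X ψ) (assoc K Z X Y t) = slR Z φ (slR (Z ⊗[K] X) ψ t) := by
  induction t using TensorProduct.induction_on with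
  | zero => simp
  | add u u' hu hu' => simp only [map_add, hu, hu']
  | tmul u y =>
    induction u using TensorProduct.induction_on with
    | zero => simp
    | add u u' hu hu' => simp only [TensorProduct.add_tmul, map_add, hu, hu']
    | tmul p q => simp [mul_smul]

namespace Pairing

variable {HA : RegularMHA mA} {HB : RegularMHA mB}

/-- The adjoint action `a₂ a' S⁻¹(a₁)` of `A` is that of the co-opposite. -/
lemma adA_eq (P : Pairing HA HB) : P.adA = HA.copReg.adAct := by
  rw [adA, RegularMHA.adAct, RegularMHA.antipode_copReg, RegularMHA.copReg_T₃]

lemma actA_eq (P : Pairing HA HB) :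
    P.actA = pairAct (UMod.ad HA.copReg).act P.leftMod.act := by
  rw [actA, adA_eq]
  rfl

lemma actB_eq (P : Pairing HA HB) : P.actB = pairAct P.flip.rightMod.act (UMod.ad HB).act := rfl

/-- The action of `A` on the Heisenberg double. -/
def heisA (P : Pairing HA HB) : UMod mA (A ⊗[K] B) :=
  UMod.diag HA.copReg (UMod.ad HA.copReg) P.flip.rightMod

/-- The action of `B` on the Heisenberg double. -/
def heisB (P : Pairing HA HB) : UMod mB (A ⊗[K] B) := UMod.diag HB P.leftMod (UMod.ad HB)

lemma isDouble_heis (P : Pairing HA HB) : P.IsDouble P.heisA P.heisB :=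
  P.isDouble_ad.diag P.isDouble_ad'

lemma actH_eq (P : Pairing HA HB) : P.actH = pairAct P.heisA.act P.heisB.act := by
  refine TensorProduct.ext' fun a b => TensorProduct.ext' fun a' b' => ?_
  rw [pairAct_tmul, heisB, UMod.diag_act, ← R_eq]
  simp only [actH, TensorProduct.curry_apply, LinearMap.comp_apply, LinearEquiv.coe_coe,
    TensorProduct.assoc_tmul, LinearMap.lTensor_tmul, TensorProduct.assoc_symm_tmul,
    LinearMap.rTensor_tmul]
  generalize P.R (b ⊗ₜ a') = z
  induction z using TensorProduct.induction_on with
  | zero => simp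
  | add u u' hu hu' => simp only [TensorProduct.tmul_add, TensorProduct.add_tmul, map_add, hu, hu']
  | tmul v d =>
    have h := (UMod.diag_act_comm HA.copReg (UMod.ad HA.copReg) P.flip.rightMod a
      (v ⊗ₜ P.adB d b')).symm
    rw [TensorProduct.comm_tmul] at h
    have h2 := UMod.diag_act HA P.flip.rightMod (UMod.ad HA.copReg) a (P.adB d b') v
    have h3 := congrArg (comm K B A) (h.trans h2)
    rw [TensorProduct.comm_comm] at h3
    simp only [LinearMap.lTensor_tmul, LinearMap.flip_apply, TensorProduct.assoc_tmul,
      LinearEquiv.coe_coe, lift.tmul, TensorProduct.leftComm_tmul, TensorProduct.comm_tmul]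
    refine Eq.trans ?_ h3.symm
    rw [← F_eq]
    generalize P.F (a ⊗ₜ P.adB d b') = z
    induction z using TensorProduct.induction_on with
    | zero => simp
    | add u u' hu hu' => simp only [TensorProduct.add_tmul, map_add, hu, hu']
    | tmul p q => simp [UMod.ad, adA_eq]

/-! ### Right multiplications in the Drinfel'd double and the comodules -/

/-- The right multiplication by `a ∈ A` on the Drinfel'd double. -/
def mulRightA (P : Pairing HA HB) (a : A) : A ⊗[K] B →ₗ[K] A ⊗[K] B :=
  P.T.toLinearMap ∘ₗ (mA.flip a).lTensor B ∘ₗ P.T.symm.toLinearMap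

lemma mulD_T (P : Pairing HA HB) (z : B ⊗[K] A) (y : A ⊗[K] B) :
    P.mulD (P.T z) y = pairAct P.regB.act P.regA.act z y := by
  rw [mulD_eq, P.isDouble_reg]

lemma mulD_mulRightA (P : Pairing HA HB) (a : A) (x y : A ⊗[K] B) :
    P.mulD (P.mulRightA a x) y = P.mulD x (P.regA.act a y) := by
  obtain ⟨z, rfl⟩ := P.T.surjective x
  simp only [mulRightA, LinearMap.comp_apply, LinearEquiv.coe_coe, LinearEquiv.symm_apply_apply]
  rw [mulD_T, mulD_T]
  induction z using TensorProduct.induction_on with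
  | zero => simp
  | add u u' hu hu' => simp only [map_add, LinearMap.add_apply, hu, hu']
  | tmul p q => simp [UMod.mul_act]

lemma mulD_mulRightB (P : Pairing HA HB) (b : B) (x y : A ⊗[K] B) :
    P.mulD ((mB.flip b).lTensor A x) y = P.mulD x (P.regB.act b y) := by
  rw [mulD_eq]
  induction x using TensorProduct.induction_on with
  | zero => simp
  | add u u' hu hu' => simp only [map_add, LinearMap.add_apply, hu, hu']
  | tmul p q => simp [UMod.mul_act]

lemma mulD_tmul_right (P : Pairing HA HB) (x : A ⊗[K] B) (a : A) (b : B) :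
    P.mulD x (a ⊗ₜ b) = (mB.flip b).lTensor A (P.mulRightA a x) := by
  have h := P.hexagonRight_T.apply (P.T.symm x) a
  simp only [LinearEquiv.coe_coe, LinearEquiv.apply_symm_apply] at h
  rw [mulD, twistedMul_apply_tmul, h]
  rfl

lemma slR_rightA (P : Pairing HA HB) (x : A ⊗[K] B) (a : A) (c : B) :
    slR _ (P.form.flip c) (P.rightA (x ⊗ₜ a)) = P.mulRightA (P.rA a c) x := by
  simp only [rightA, mulRightA, LinearMap.comp_apply, LinearEquiv.coe_coe, LinearMap.rTensor_tmul]
  generalize P.T.symm x = z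
  induction z using TensorProduct.induction_on with
  | zero => simp
  | add u u' hu hu' => simp only [TensorProduct.add_tmul, map_add, hu, hu']
  | tmul p q =>
    rw [TensorProduct.assoc_tmul, LinearMap.lTensor_tmul, LinearMap.lTensor_tmul,
      LinearMap.flip_apply, LinearEquiv.coe_coe, ← slR_cop_T₂]
    generalize HA.cop.T₂ (q ⊗ₜ a) = z
    induction z using TensorProduct.induction_on with
    | zero => simp
    | add u u' hu hu' => simp only [TensorProduct.tmul_add, map_add, hu, hu']
    | tmul r s => simp

lemma slR_rightB (P : Pairing HA HB) (x : A ⊗[K] B) (b : B) (e : A) :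
    slR _ (P.form e) (P.rightB (x ⊗ₜ b)) = (mB.flip (P.lB e b)).lTensor A x := by
  induction x using TensorProduct.induction_on with
  | zero => simp
  | add u u' hu hu' => simp only [TensorProduct.add_tmul, map_add, hu, hu']
  | tmul p q =>
    have h := P.flip.slR_T₂ q b e
    simp only [rightB, LinearMap.comp_apply, LinearEquiv.coe_coe, TensorProduct.assoc_tmul,
      LinearMap.lTensor_tmul, LinearMap.flip_apply]
    refine Eq.trans ?_ (congrArg (fun y => p ⊗ₜ[K] y) h)
    generalize HB.T₂ (q ⊗ₜ b) = z
    induction z using TensorProduct.induction_on with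
    | zero => simp
    | add u u' hu hu' => simp only [TensorProduct.tmul_add, map_add, hu, hu']
    | tmul r s => simp [flip]

lemma slR_leftA (P : Pairing HA HB) (y : A ⊗[K] B) (a : A) (c : B) :
    slR _ (P.form.flip c) (P.leftA (a ⊗ₜ y)) = P.regA.act (P.rA a c) y := by
  rw [leftA_eq]
  exact P.slR_tw_copReg P.regA a c y

lemma slR_leftB (P : Pairing HA HB) (y : A ⊗[K] B) (b : B) (e : A) :
    slR _ (P.form e) (P.leftB (b ⊗ₜ y)) = P.regB.act (P.lB e b) y := by
  rw [leftB_eq]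
  exact P.flip.slR_tw P.regB b e y

lemma exists_ne_zero_of_left (P : Pairing HA HB) (a : A) (ha : a ≠ 0) :
    ∃ y : A ⊗[K] B, y ≠ 0 := by
  obtain ⟨b, hb⟩ := P.exists_form_eq_one ha
  refine ⟨a ⊗ₜ b, fun h => ?_⟩
  have h2 := congrArg (lift P.form) h
  simp [hb] at h2

lemma exists_ne_zero_of_right (P : Pairing HA HB) (b : B) (hb : b ≠ 0) :
    ∃ y : A ⊗[K] B, y ≠ 0 := by
  obtain ⟨y, hy⟩ := P.flip.exists_ne_zero_of_left b hb
  exact ⟨comm K B A y, by simpa using hy⟩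

theorem isComodule_coactA (P : Pairing HA HB) : IsComodule P.double P.coactA :=
  P.isComodule_of_slices (fun c => P.form.flip c) P.nondeg_left (fun c => P.rA.flip c)
    (fun c d => ⟨mB c d, LinearMap.ext fun a => by simp [form_rA],
      LinearMap.ext fun a => by simp [rA_mul]⟩)
    P.regA.act (fun a x => P.mulRightA a x) (fun c a y => P.slR_leftA y a c)
    (fun c a x => P.slR_rightA x a c) (fun a x y => (P.mulD_mulRightA a x y).symm)
    (fun a => (UMod.diag HA.copReg P.regA P.regA).act a)
    (fun a p q => by rw [UMod.diag_act, coactA, leftA_eq]; rfl)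
    P.leftAB_regA (by rw [coactA, leftA_eq]; exact LinearEquiv.injective _)
    P.exists_ne_zero_of_left

theorem isComodule_coactB (P : Pairing HA HB) : IsComodule P.double P.coactB :=
  P.isComodule_of_slices (fun e => P.form e) P.nondeg_right (fun e => P.lB e)
    (fun c d => ⟨mA d c, LinearMap.ext fun b => by simp [form_lB],
      LinearMap.ext fun b => (P.flip.lA_mul d c b).symm⟩)
    P.regB.act (fun b x => (mB.flip b).lTensor A x) (fun e b y => P.slR_leftB y b e)
    (fun e b x => P.slR_rightB x b e) (fun b x y => (P.mulD_mulRightB b x y).symm)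
    (fun b => (UMod.diag HB P.regB P.regB).act b)
    (fun b p q => by rw [UMod.diag_act, coactB, leftB_eq]; rfl)
    P.leftAB_regB (by rw [coactB, leftB_eq]; exact LinearEquiv.injective _)
    P.exists_ne_zero_of_right

lemma leftAB_tmul (P : Pairing HA HB) (a : A) (b : B) (y : A ⊗[K] B) :
    P.leftAB ((a ⊗ₜ b) ⊗ₜ y) = assoc K (A ⊗[K] B) A B
      ((P.leftA ∘ₗ TensorProduct.mk K A (A ⊗[K] B) a).rTensor B (P.leftB (b ⊗ₜ y))) := by
  simp only [leftAB, LinearMap.comp_apply, LinearEquiv.coe_coe, TensorProduct.assoc_tmul,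
    LinearMap.lTensor_tmul]
  congr 1
  generalize P.leftB (b ⊗ₜ y) = z
  induction z using TensorProduct.induction_on with
  | zero => simp
  | add u u' hu hu' => simp only [TensorProduct.tmul_add, map_add, hu, hu']
  | tmul r s => simp

lemma rightAB_tmul (P : Pairing HA HB) (a : A) (b : B) (x : A ⊗[K] B) :
    P.rightAB (x ⊗ₜ (a ⊗ₜ b)) = assoc K (A ⊗[K] B) A B (rightComm K (A ⊗[K] B) B A
      ((P.rightB ∘ₗ (TensorProduct.mk K (A ⊗[K] B) B).flip b).rTensor A (P.rightA (x ⊗ₜ a)))) := by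
  simp only [rightAB, LinearMap.comp_apply, LinearEquiv.coe_coe, TensorProduct.assoc_symm_tmul,
    LinearMap.rTensor_tmul]
  congr 2
  generalize P.rightA (x ⊗ₜ a) = z
  induction z using TensorProduct.induction_on with
  | zero => simp
  | add u u' hu hu' => simp only [TensorProduct.add_tmul, map_add, hu, hu']
  | tmul r s => simp

theorem isCodiagonalCoaction (P : Pairing HA HB) :
    IsCodiagonalCoaction P.coactA P.coactB P.coactH :=
  ⟨P.leftAB_tmul, fun a b x => P.rightAB_tmul a b x⟩

lemma slR_leftAB (P : Pairing HA HB) (t y : A ⊗[K] B) (c : B) (e : A) :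
    slR _ (P.form.flip c ∘ₗ slR A (P.form e)) (P.leftAB (t ⊗ₜ y)) =
      P.mulD (map (P.rA.flip c) (P.lB e) t) y := by
  induction t using TensorProduct.induction_on with
  | zero => simp
  | add u u' hu hu' => simp only [TensorProduct.add_tmul, map_add, LinearMap.add_apply, hu, hu']
  | tmul a b =>
    rw [leftAB_tmul, slR_comp_slR, slR_rTensor, slR_leftB, mulD_eq]
    exact P.slR_leftA _ a c

lemma slR_rightAB (P : Pairing HA HB) (t x : A ⊗[K] B) (c : B) (e : A) :
    slR _ (P.form.flip c ∘ₗ slR A (P.form e)) (P.rightAB (x ⊗ₜ t)) =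
      P.mulD x (map (P.rA.flip c) (P.lB e) t) := by
  induction t using TensorProduct.induction_on with
  | zero => simp
  | add u u' hu hu' => simp only [TensorProduct.tmul_add, map_add, hu, hu']
  | tmul a b =>
    rw [rightAB_tmul, slR_comp_slR, TensorProduct.map_tmul, mulD_tmul_right, LinearMap.flip_apply,
      ← slR_rightA]
    generalize P.rightA (x ⊗ₜ a) = z
    induction z using TensorProduct.induction_on with
    | zero => simp
    | add u u' hu hu' => simp only [map_add, hu, hu']
    | tmul r s =>
      rw [slR_tmul, map_smul, ← slR_rightB]
      simp only [LinearMap.rTensor_tmul, LinearMap.comp_apply, LinearMap.flip_apply,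
        TensorProduct.mk_apply]
      generalize P.rightB (r ⊗ₜ b) = z
      induction z using TensorProduct.induction_on with
      | zero => simp
      | add u u' hu hu' => simp only [TensorProduct.add_tmul, map_add, smul_add, hu, hu']
      | tmul r s =>
        simp only [TensorProduct.rightComm_tmul, slR_tmul, map_smul]
        exact smul_comm _ _ _

theorem isComodule_coactH (P : Pairing HA HB) : IsComodule P.double P.coactH :=
  P.isComodule_of_slices (ι := B × A) (fun i => P.form.flip i.1 ∘ₗ slR A (P.form i.2))
    (fun t ht => slR_ext (fun e => P.form e) P.nondeg_right fun e => by
      rw [map_zero]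
      exact P.nondeg_left _ fun c => ht (c, e))
    (fun i => map (P.rA.flip i.1) (P.lB i.2))
    (fun i j => ⟨(mB i.1 j.1, mA j.2 i.2), TensorProduct.ext' fun a b => by
        simp [form_rA, form_lB], TensorProduct.ext' fun a b => by
        simp only [LinearMap.comp_apply, TensorProduct.map_tmul, LinearMap.flip_apply, rA_mul]
        congr 1
        exact (P.flip.lA_mul j.2 i.2 b).symm⟩)
    P.mulD (fun t x => P.mulD x t) (fun i t y => P.slR_leftAB t y i.1 i.2)
    (fun i t x => P.slR_rightAB t x i.1 i.2) (fun t x y => (P.isAlgebra_mulD.assoc x t y).symm)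
    (fun t => P.mulCoprod t) P.mulCoprod_tmul P.leftAB_mulD
    (by
      change Function.Injective P.leftAB
      rw [leftAB_eq]
      exact LinearEquiv.injective _)
    (fun t ht => ⟨t, ht⟩)

end Pairing

/-! ### The Yetter-Drinfel'd module algebras `A` and `B` -/

namespace Pairing

variable {HA : RegularMHA mA} {HB : RegularMHA mB}

theorem isYDModuleAlgebra_A (P : Pairing HA HB) :
    IsYDModuleAlgebra P.double mA P.actA P.coactA where
  isAlgebra := HA.isAlgebra
  isUnitalModule := by
    rw [actA_eq]
    exact P.isDouble_ad.isUnitalModule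
  isComodule := P.isComodule_coactA
  isModuleAlgebra := by
    rw [actA_eq]
    exact P.isDouble_ad.isModuleAlgebra (UMod.isHom_lift_mul_ad HA.copReg) P.isHom_lift_mul
  isComoduleAlgebra := fun v w x => by
    rw [coactA, leftA_eq]
    exact UMod.tw_mul HA.copReg P.regA v w x
  compatible := by
    rw [actA_eq]
    refine P.isYDCompatible ?_ ?_ <;> rw [coactA, leftA_eq]
    · exact UMod.isHom_tw_ad HA.copReg P.regA
    · exact P.isDouble_reg.isHom

theorem isYDModuleAlgebra_B (P : Pairing HA HB) :
    IsYDModuleAlgebra P.double mB P.actB P.coactB where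
  isAlgebra := HB.isAlgebra
  isUnitalModule := P.isDouble_ad'.isUnitalModule
  isComodule := P.isComodule_coactB
  isModuleAlgebra :=
    P.isDouble_ad'.isModuleAlgebra P.tilde.isHom_lift_mul (UMod.isHom_lift_mul_ad HB)
  isComoduleAlgebra := fun v w x => by
    rw [coactB, leftB_eq]
    exact UMod.tw_mul HB P.regB v w x
  compatible := by
    rw [actB_eq]
    refine P.isYDCompatible ?_ ?_ <;> rw [coactB, leftB_eq]
    · exact P.isDouble_reg.isHom'
    · exact UMod.isHom_tw_ad HB P.regB

theorem isBraidedCommutative_A (P : Pairing HA HB) :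
    IsBraidedCommutative mA P.actA P.coactA := fun w x v => by
  rw [coactA, leftA_eq, actA_eq]
  refine Eq.trans ?_ (congrArg (lift mA)
    ((P.isHom_pairAct_regA (UMod.ad HA.copReg) P.leftMod v).tw_lTensor (H := HA.copReg) (w ⊗ₜ x)))
  rw [UMod.lift_mul_tw_ad]
  rfl

theorem isBraidedCommutative_B (P : Pairing HA HB) :
    IsBraidedCommutative mB P.actB P.coactB := fun w x v => by
  rw [coactB, leftB_eq, actB_eq]
  refine Eq.trans ?_ (congrArg (lift mB)
    ((P.isDouble_ad'.isHom_pairAct_regB v).tw_lTensor (H := HB) (w ⊗ₜ x)))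
  rw [UMod.lift_mul_tw_ad]
  rfl

theorem isBraidedProduct (P : Pairing HA HB) :
    IsBraidedProduct mA mB P.actA P.coactB P.mulH := fun v w x v' w' => by
  rw [mulH_eq, coactB, leftB_eq, actA_eq, R_eq]
  have h := (P.isDouble_ad.isHom_pairAct_regB v').tw_lTensor (H := HB) (w ⊗ₜ x)
  rw [LinearMap.lTensor_tmul, LinearMap.flip_apply] at h
  rw [h, ← LinearMap.comp_apply, LinearMap.map_comp_rTensor]
  rfl

theorem isDiagonalAction (P : Pairing HA HB) :
    IsDiagonalAction P.double P.actA P.actB P.actH := by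
  rw [actA_eq, actB_eq, actH_eq]
  exact P.isDouble_ad.isDiagonalAction _ _

/-! ### The Heisenberg double as a Yetter-Drinfel'd module algebra -/

/-- The twist of `ℋ` as a product is `R`, and `R⁻¹` is the twist of an `A`-module for `Δᶜᵒᵖ`. -/
lemma isHom_mulH_heisA (P : Pairing HA HB) :
    (UMod.diag HA.copReg P.heisA P.heisA).IsHom P.heisA (lift P.mulH) := by
  refine UMod.isHom_lift_twistedMul HA.copReg _ _ (UMod.isHom_lift_mul_ad HA.copReg)
    P.tilde.isHom_lift_mul ?_
  have h := (UMod.isHom_tw_ad HA.copReg P.flip.rightMod).symm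
  rw [← R_symm] at h
  exact h

lemma isHom_mulH_heisB (P : Pairing HA HB) :
    (UMod.diag HB P.heisB P.heisB).IsHom P.heisB (lift P.mulH) := by
  refine UMod.isHom_lift_twistedMul HB _ _ P.isHom_lift_mul (UMod.isHom_lift_mul_ad HB) ?_
  rw [R_eq]
  exact UMod.isHom_tw_ad HB P.leftMod

/-- The coaction applies the twist of the `B`-module `𝒟`, which is `A`-linear as `𝒟` is a double
module, and then the twist of the `A`-module `𝒟`, which is `A`-linear for the adjoint action on the
left factor. For `B`, these two reasons are exchanged. -/
lemma isHom_leftAB_heisA (P : Pairing HA HB) :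
    (UMod.diag HA.copReg P.heisA P.regA).IsHom (UMod.diag HA.copReg P.regA P.heisA) P.leftAB := by
  rw [leftAB, leftA_eq, leftB_eq]
  exact (UMod.isHom_assoc HA.copReg _ _ _).comp
    (((UMod.isHom_tw_ad HA.copReg P.regA).rTensor HA.copReg P.flip.rightMod).comp
      ((UMod.isHom_assoc HA.copReg _ _ _).symm.comp
        ((P.isDouble_reg.isHom'.lTensor HA.copReg _).comp (UMod.isHom_assoc HA.copReg _ _ _))))

lemma isHom_leftAB_heisB (P : Pairing HA HB) :
    (UMod.diag HB P.heisB P.regB).IsHom (UMod.diag HB P.regB P.heisB) P.leftAB := by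
  rw [leftAB, leftA_eq, leftB_eq]
  exact (UMod.isHom_assoc HB _ _ _).comp
    ((P.isDouble_reg.isHom.rTensor HB (UMod.ad HB)).comp
      ((UMod.isHom_assoc HB _ _ _).symm.comp
        (((UMod.isHom_tw_ad HB P.regB).lTensor HB _).comp (UMod.isHom_assoc HB _ _ _))))

/-- `Γ(R (b ⊗ a))(d ⊗ 1) = (1 ⋈ b₁)(a₂ ⋈ 1) d ⊗ R (b₂ ⊗ a₁)`: the coaction is multiplicative on the
product of `1 # b` and `a # 1`. -/
lemma leftAB_R (P : Pairing HA HB) (b : B) (a : A) (d : A ⊗[K] B) :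
    P.leftAB (P.R (b ⊗ₜ a) ⊗ₜ d) =
      P.R.toLinearMap.lTensor (A ⊗[K] B) (assoc K (A ⊗[K] B) B A
        ((P.leftB ∘ₗ TensorProduct.mk K B (A ⊗[K] B) b).rTensor A (P.leftA (a ⊗ₜ d)))) := by
  have h := P.isDouble_reg.isHom.tw_lTensor (H := HB) (b ⊗ₜ (a ⊗ₜ d))
  rw [UMod.tw_tmul, LinearMap.lTensor_tmul, ← leftA_eq, ← leftB_eq, ← R_eq] at h
  refine Eq.trans (congrArg (assoc K (A ⊗[K] B) A B) h.symm) ?_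
  generalize P.leftA (a ⊗ₜ d) = z
  induction z using TensorProduct.induction_on with
  | zero => simp
  | add u u' hu hu' => simp only [TensorProduct.tmul_add, map_add, hu, hu']
  | tmul p q =>
    rw [UMod.tw_tmul, LinearEquiv.apply_symm_apply, leftB_eq, R_eq]
    rfl

lemma leftA_mul (P : Pairing HA HB) (a a' : A) (d : A ⊗[K] B) :
    P.leftA (mA a a' ⊗ₜ d) = (lift mA).lTensor (A ⊗[K] B) (assoc K (A ⊗[K] B) A A
      ((P.leftA ∘ₗ TensorProduct.mk K A (A ⊗[K] B) a).rTensor A (P.leftA (a' ⊗ₜ d)))) := by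
  rw [leftA_eq]
  exact UMod.tw_mul HA.copReg P.regA a a' d

lemma leftB_mul (P : Pairing HA HB) (b b' : B) (d : A ⊗[K] B) :
    P.leftB (mB b b' ⊗ₜ d) = (lift mB).lTensor (A ⊗[K] B) (assoc K (A ⊗[K] B) B B
      ((P.leftB ∘ₗ TensorProduct.mk K B (A ⊗[K] B) b).rTensor B (P.leftB (b' ⊗ₜ d)))) := by
  rw [leftB_eq]
  exact UMod.tw_mul HB P.regB b b' d

/-- `(d ⊗ (a' ⊗ b')) ⊗ b ↦ (a₂ ⋈ 1) d ⊗ (a₁ a' ⊗ b' b)`. -/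
def leftRight (P : Pairing HA HB) (a : A) :
    ((A ⊗[K] B) ⊗[K] (A ⊗[K] B)) ⊗[K] B →ₗ[K] (A ⊗[K] B) ⊗[K] (A ⊗[K] B) :=
  (map (lift mA) (lift mB) ∘ₗ (assoc K (A ⊗[K] A) B B).toLinearMap ∘ₗ
      (assoc K A A B).symm.toLinearMap.rTensor B).lTensor (A ⊗[K] B) ∘ₗ
    (assoc K (A ⊗[K] B) (A ⊗[K] (A ⊗[K] B)) B).toLinearMap ∘ₗ
    ((assoc K (A ⊗[K] B) A (A ⊗[K] B)).toLinearMap ∘ₗ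
      (P.leftA ∘ₗ TensorProduct.mk K A (A ⊗[K] B) a).rTensor (A ⊗[K] B)).rTensor B

/-- The coaction on `(a ⊗ 1) t (1 ⊗ b)`. -/
lemma leftAB_map (P : Pairing HA HB) (a : A) (b : B) (x t : A ⊗[K] B) :
    P.leftAB (map (mA a) (mB.flip b) t ⊗ₜ x) = P.leftRight a
      ((P.leftAB ∘ₗ TensorProduct.mk K (A ⊗[K] B) (A ⊗[K] B) t).rTensor B (P.leftB (b ⊗ₜ x))) := by
  induction t using TensorProduct.induction_on with
  | zero => simp
  | add t t' ht ht' =>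
    simp only [map_add, TensorProduct.add_tmul, ht, ht', LinearMap.comp_add,
      LinearMap.rTensor_add, LinearMap.add_apply]
  | tmul p q =>
    rw [TensorProduct.map_tmul, LinearMap.flip_apply, leftAB_tmul, leftB_mul]
    generalize P.leftB (b ⊗ₜ x) = s
    induction s using TensorProduct.induction_on with
    | zero => simp
    | add u u' hu hu' => simp only [map_add, hu, hu']
    | tmul d b' =>
      simp only [LinearMap.rTensor_tmul, LinearMap.comp_apply, TensorProduct.mk_apply,
        leftAB_tmul]
      generalize P.leftB (q ⊗ₜ d) = r
      induction r using TensorProduct.induction_on with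
      | zero => simp
      | add u u' hu hu' => simp only [TensorProduct.add_tmul, map_add, hu, hu']
      | tmul d' q' =>
        simp only [TensorProduct.assoc_tmul, LinearMap.lTensor_tmul, lift.tmul,
          LinearMap.rTensor_tmul, LinearMap.comp_apply, TensorProduct.mk_apply, leftA_mul]
        generalize P.leftA (p ⊗ₜ d') = r
        induction r using TensorProduct.induction_on with
        | zero => simp
        | add u u' hu hu' => simp only [TensorProduct.add_tmul, map_add, hu, hu']
        | tmul d'' p' =>
          simp only [leftRight, TensorProduct.assoc_tmul, LinearMap.comp_apply,
            LinearMap.rTensor_tmul, TensorProduct.mk_apply, LinearEquiv.coe_coe]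
          generalize P.leftA (a ⊗ₜ d'') = r
          induction r using TensorProduct.induction_on with
          | zero => simp
          | add u u' hu hu' => simp only [TensorProduct.add_tmul, map_add, hu, hu']
          | tmul e a' => simp

/-- By `leftAB_map` and `leftAB_R`, both sides are `(a₂ ⋈ 1)(1 ⋈ b₁)(a'₂ ⋈ 1)(1 ⋈ b'₁) x` in the
first leg and `(a₁ ⊗ 1) R (b₂ ⊗ a'₁) (1 ⊗ b'₂)` in the second. -/
theorem isComoduleAlgebra_H (P : Pairing HA HB) : IsComoduleAlgebra P.mulH P.coactH :=
  fun v w x => by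
  change P.leftAB (P.mulH v w ⊗ₜ x) = (lift P.mulH).lTensor _ (assoc K _ _ _
    ((P.leftAB ∘ₗ TensorProduct.mk K _ _ v).rTensor _ (P.leftAB (w ⊗ₜ x))))
  induction w using TensorProduct.induction_on with
  | zero => simp
  | add u u' hu hu' => simp only [TensorProduct.add_tmul, map_add, hu, hu']
  | tmul a' b' =>
    induction v using TensorProduct.induction_on with
    | zero => simp
    | add u u' hu hu' =>
      simp only [TensorProduct.add_tmul, map_add, LinearMap.add_apply, hu, hu',
        LinearMap.comp_add, LinearMap.rTensor_add]
    | tmul a b =>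
      rw [mulH_eq, leftAB_map, leftAB_tmul]
      generalize P.leftB (b' ⊗ₜ x) = s
      induction s using TensorProduct.induction_on with
      | zero => simp
      | add u u' hu hu' => simp only [map_add, hu, hu']
      | tmul d b'' =>
        simp only [leftAB_R, LinearMap.rTensor_tmul, LinearMap.comp_apply, TensorProduct.mk_apply]
        generalize P.leftA (a' ⊗ₜ d) = r
        induction r using TensorProduct.induction_on with
        | zero => simp
        | add u u' hu hu' => simp only [TensorProduct.add_tmul, map_add, hu, hu']
        | tmul d₁ a₁ =>
          simp only [LinearMap.rTensor_tmul, TensorProduct.assoc_tmul, LinearMap.comp_apply,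
            TensorProduct.mk_apply, leftAB_tmul]
          generalize P.leftB (b ⊗ₜ d₁) = r
          induction r using TensorProduct.induction_on with
          | zero => simp
          | add u u' hu hu' => simp only [TensorProduct.add_tmul, map_add, hu, hu']
          | tmul d₂ b₂ =>
            simp only [leftRight, LinearMap.rTensor_tmul, TensorProduct.assoc_tmul,
              LinearMap.comp_apply, TensorProduct.mk_apply, LinearMap.lTensor_tmul,
              LinearEquiv.coe_coe]
            generalize P.leftA (a ⊗ₜ d₂) = r
            induction r using TensorProduct.induction_on with
            | zero => simp
            | add u u' hu hu' => simp only [TensorProduct.add_tmul, map_add, hu, hu']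
            | tmul d₃ a₃ =>
              simp only [TensorProduct.assoc_tmul, LinearMap.lTensor_tmul, lift.tmul, mulH_eq,
                LinearMap.comp_apply, LinearEquiv.coe_coe]
              congr 1
              generalize P.R (b₂ ⊗ₜ a₁) = r
              induction r using TensorProduct.induction_on with
              | zero => simp
              | add u u' hu hu' =>
                simp only [TensorProduct.tmul_add, TensorProduct.add_tmul, map_add, hu, hu']
              | tmul e f => simp

theorem isYDModuleAlgebra_H (P : Pairing HA HB) :
    IsYDModuleAlgebra P.double P.mulH P.actH P.coactH where
  isAlgebra := P.isAlgebra_mulH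
  isUnitalModule := by
    rw [actH_eq]
    exact P.isDouble_heis.isUnitalModule
  isComodule := P.isComodule_coactH
  isModuleAlgebra := by
    rw [actH_eq]
    exact P.isDouble_heis.isModuleAlgebra P.isHom_mulH_heisA P.isHom_mulH_heisB
  isComoduleAlgebra := P.isComoduleAlgebra_H
  compatible := by
    rw [actH_eq]
    exact P.isYDCompatible P.isHom_leftAB_heisA P.isHom_leftAB_heisB

/-! ### Braided commutativity of the Heisenberg double -/

/-- `s ⊗ a ↦ s (a ⊗ 1)` for the product of the Heisenberg double. -/
def heisMulA (P : Pairing HA HB) : (A ⊗[K] B) ⊗[K] A →ₗ[K] A ⊗[K] B :=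
  (lift mA).rTensor B ∘ₗ (assoc K A A B).symm.toLinearMap ∘ₗ P.R.toLinearMap.lTensor A ∘ₗ
    (assoc K A B A).toLinearMap

/-- `s ⊗ b ↦ s (1 ⊗ b)` for the product of the Heisenberg double. -/
def heisMulB (_ : Pairing HA HB) : (A ⊗[K] B) ⊗[K] B →ₗ[K] A ⊗[K] B :=
  (lift mB).lTensor A ∘ₗ (assoc K A B B).toLinearMap

lemma mulH_tmul_right (P : Pairing HA HB) (s : A ⊗[K] B) (a : A) (b : B) :
    P.mulH s (a ⊗ₜ b) = P.heisMulB (P.heisMulA (s ⊗ₜ a) ⊗ₜ b) := by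
  rw [mulH, twistedMul_apply_tmul]
  induction s using TensorProduct.induction_on with
  | zero => simp
  | add u u' hu hu' => simp only [TensorProduct.add_tmul, map_add, hu, hu']
  | tmul p q =>
    simp only [heisMulA, heisMulB, LinearMap.lTensor_tmul, LinearMap.comp_apply,
      LinearMap.flip_apply, TensorProduct.mk_apply, LinearEquiv.coe_coe, TensorProduct.assoc_tmul]
    generalize P.R (q ⊗ₜ a) = r
    induction r using TensorProduct.induction_on with
    | zero => simp
    | add u u' hu hu' => simp only [TensorProduct.tmul_add, TensorProduct.add_tmul, map_add, hu, hu']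
    | tmul e f => simp

/-- `(a₂ · s)(a₁ ⊗ 1) = (a ⊗ 1) s` in the Heisenberg double. -/
lemma heisMulA_tw (P : Pairing HA HB) (a : A) (s : A ⊗[K] B) :
    P.heisMulA (P.heisA.tw HA.copReg (a ⊗ₜ s)) = (mA a).rTensor B s := by
  induction s using TensorProduct.induction_on with
  | zero => simp
  | add u u' hu hu' => simp only [TensorProduct.tmul_add, map_add, hu, hu']
  | tmul p q =>
    have h := UMod.lift_mul_tw_ad HA.copReg (a ⊗ₜ p)
    rw [lift.tmul] at h
    rw [heisA, UMod.tw_tmul, LinearMap.rTensor_tmul, ← h]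
    generalize (UMod.ad HA.copReg).tw HA.copReg (a ⊗ₜ p) = z
    induction z using TensorProduct.induction_on with
    | zero => simp
    | add u u' hu hu' => simp only [TensorProduct.add_tmul, map_add, hu, hu']
    | tmul r s =>
      simp only [heisMulA, LinearMap.comp_apply, LinearEquiv.coe_coe,
        LinearEquiv.apply_symm_apply, TensorProduct.assoc_tmul, LinearMap.lTensor_tmul, R_tw,
        TensorProduct.assoc_symm_tmul, LinearMap.rTensor_tmul]

/-- `(b₁ · s)(1 ⊗ b₂) = (1 ⊗ b) s` in the Heisenberg double. -/
lemma heisMulB_tw (P : Pairing HA HB) (b : B) (p : A) (q : B) :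
    P.heisMulB (P.heisB.tw HB (b ⊗ₜ (p ⊗ₜ q))) = (mB.flip q).lTensor A (P.R (b ⊗ₜ p)) := by
  rw [heisB, UMod.tw_tmul, ← R_eq]
  generalize P.R (b ⊗ₜ p) = z
  induction z using TensorProduct.induction_on with
  | zero => simp
  | add u u' hu hu' => simp only [TensorProduct.add_tmul, map_add, hu, hu']
  | tmul r s =>
    simp only [heisMulB, LinearMap.comp_apply, LinearEquiv.coe_coe,
      LinearEquiv.apply_symm_apply, TensorProduct.assoc_tmul, LinearMap.lTensor_tmul,
      UMod.lift_mul_tw_ad, lift.tmul, LinearMap.flip_apply]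

/-- `(a₂ · b₁ · s)(a₁ ⊗ b₂) = (a ⊗ b) s` in the Heisenberg double. -/
lemma lift_mulH_pairTw (P : Pairing HA HB) (t s : A ⊗[K] B) :
    lift P.mulH (P.pairTw P.heisA P.heisB (t ⊗ₜ s)) = P.mulH t s := by
  induction t using TensorProduct.induction_on with
  | zero => simp
  | add u u' hu hu' => simp only [TensorProduct.add_tmul, map_add, LinearMap.add_apply, hu, hu']
  | tmul a b =>
    induction s using TensorProduct.induction_on with
    | zero => simp
    | add u u' hu hu' => simp only [TensorProduct.tmul_add, map_add, hu, hu']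
    | tmul p q =>
      rw [pairTw_tmul, mulH_eq]
      have h : map (mA a) (mB.flip q) (P.R (b ⊗ₜ p)) =
          (mA a).rTensor B (P.heisMulB (P.heisB.tw HB (b ⊗ₜ (p ⊗ₜ q)))) := by
        rw [heisMulB_tw, ← LinearMap.comp_apply, LinearMap.rTensor_comp_lTensor]
      rw [h]
      generalize P.heisB.tw HB (b ⊗ₜ (p ⊗ₜ q)) = z
      induction z using TensorProduct.induction_on with
      | zero => simp
      | add u u' hu hu' => simp only [TensorProduct.tmul_add, map_add, hu, hu']
      | tmul u b' =>
        have h : (mA a).rTensor B (P.heisMulB (u ⊗ₜ b')) =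
            P.heisMulB ((mA a).rTensor B u ⊗ₜ b') := by
          induction u using TensorProduct.induction_on with
          | zero => simp
          | add u u' hu hu' => simp only [TensorProduct.add_tmul, map_add, hu, hu']
          | tmul e f => simp [heisMulB]
        rw [h, ← heisMulA_tw, TensorProduct.assoc_symm_tmul, LinearMap.rTensor_tmul,
          LinearEquiv.coe_coe]
        generalize P.heisA.tw HA.copReg (a ⊗ₜ u) = z
        induction z using TensorProduct.induction_on with
        | zero => simp
        | add u u' hu hu' => simp only [TensorProduct.add_tmul, map_add, hu, hu']
        | tmul e f => rw [TensorProduct.assoc_tmul, lift.tmul, mulH_tmul_right]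

theorem isBraidedCommutative_H (P : Pairing HA HB) :
    IsBraidedCommutative P.mulH P.actH P.coactH := fun w x v => by
  have h := P.pairTw_lTensor (P.isHom_pairAct_regA P.heisA P.heisB v)
    (P.isDouble_heis.isHom_pairAct_regB v) (w ⊗ₜ x)
  rw [coactH, leftAB_eq, actH_eq]
  refine Eq.trans ?_ (congrArg (lift P.mulH) h)
  rw [LinearMap.lTensor_tmul, lift_mulH_pairTw]
  rfl

end Pairing

end Heis

end

open Heis in
theorem theorem4p3 {K : Type*} [Field K]
    {A : Type*} [NonUnitalRing A] [Module K A] [IsScalarTower K A A] [SMulCommClass K A A]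
    {B : Type*} [NonUnitalRing B] [Module K B] [IsScalarTower K B B] [SMulCommClass K B B]
    (HA : RegularMHA (LinearMap.mul K A)) (HB : RegularMHA (LinearMap.mul K B))
    (P : Pairing HA HB) :
    -- the maps entering the definitions, and the algebra `𝒟`
    P.WellDefined ∧ IsAlgebra P.double.mul ∧
    -- `ℋ` is a braided commutative Yetter-Drinfel'd `𝒟`-module algebra
    IsYDModuleAlgebra P.double P.mulH P.actH P.coactH ∧
    IsBraidedCommutative P.mulH P.actH P.coactH ∧
    -- so are `A` and `B`
    IsYDModuleAlgebra P.double (LinearMap.mul K A) P.actA P.coactA ∧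
    IsBraidedCommutative (LinearMap.mul K A) P.actA P.coactA ∧
    IsYDModuleAlgebra P.double (LinearMap.mul K B) P.actB P.coactB ∧
    IsBraidedCommutative (LinearMap.mul K B) P.actB P.coactB ∧
    -- `ℋ` is the braided product of `A` and `B`, as an algebra, a module and a comodule
    IsBraidedProduct (LinearMap.mul K A) (LinearMap.mul K B) P.actA P.coactB P.mulH ∧
    IsDiagonalAction P.double P.actA P.actB P.actH ∧
    IsCodiagonalCoaction P.coactA P.coactB P.coactH :=
  ⟨P.wellDefined, P.isAlgebra_mulD, P.isYDModuleAlgebra_H, P.isBraidedCommutative_H,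
    P.isYDModuleAlgebra_A, P.isBraidedCommutative_A, P.isYDModuleAlgebra_B,
    P.isBraidedCommutative_B, P.isBraidedProduct, P.isDiagonalAction, P.isCodiagonalCoaction⟩
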